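/- **Definitions.** A *full vertex superalgebra* is an $\mathbb{R}^2$-graded complex vector space $F=\bigoplus_{h,\bar h\in\mathbb{R}}F_{h,\bar h}$ with $F_{h,\bar h}=0$ unless $h-\bar h\in\frac12\mathbb{Z}$, with $\sum_{h+\bar h<H}\dim F_{h,\bar h}<\infty$ for all $H\in\mathbb{R}$, and with $F_{h,\bar h}=0$ unless $h,\bar h\ge N$, for some $N\in\mathbb{R}$, together with a vector $\mathbf 1\in F_{0,0}$ and linear maps $a\mapsto Y(a,\underline z)=\sum_{r,s\in\mathbb{R}}a(r,s)z^{-r-1}\bar z^{-s-1}$, $a(r,s)\in\mathrm{End}\,F$, where $a(r,s)=0$ unless $r-s\in\mathbb{Z}$ and $a(r,s)F_{h',\bar h'}\subset F_{h+h'-r-1,\bar h+\bar h'-s-1}$ for $a\in F_{h,\bar h}$, such that: $Y(a,\underline z)\mathbf 1\in F[[z,\bar z]]$ and $a(-1,-1)\mathbf 1=a$; $Y(\mathbf 1,\underline z)=\mathrm{id}$; and for homogeneous $a,b,c$ and $u\in F_{h_0,\bar h_0}^*$ there is a real analytic function $\mu$ on $\{(z_1,z_2)\in\mathbb{C}^2: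 z_1\ne z_2,\ z_1\neq 0,\ z_2\ne0\}$ to which $u(Y(a,\underline z_1)Y(b,\underline z_2)c)$, $u(Y(Y(a,\underline z_0)b,\underline z_2)c)$ (with $z_0=z_1-z_2$) and $(-1)^{|a||b|}u(Y(b,\underline z_2)Y(a,\underline z_1)c)$ converge absolutely for $|z_1|>|z_2|>0$, $|z_2|>|z_0|>0$ and $|z_2|>|z_1|>0$, respectively. Here $|a|=\bar 0$ or $\bar 1$ according to whether $h-\bar h\in\mathbb{Z}$ or $\frac12+\mathbb{Z}$ for $a\in F_{h,\bar h}$; this defines a $\mathbb{Z}_2$-grading $F=F^{\bar0}\oplus F^{\bar1}$ with sign operator $(-1)^F$. Put $Da=a(-2,-1)\mathbf 1$, $\bar Da=a(-1,-2)\mathbf 1$. It is a *full vertex operator superalgebra* (full VOA) if vectors $\omega\in F_{2,0}$, $\bar\omega\in F_{0,2}$ and scalars $c,\bar c\in\mathbb{C}$ are given with $\bar D\omega=D\bar\omega=0$; $\omega(3,-1)\omega=\frac c2\mathbf 1$, $\bar\omega(-1,3)\bar\omega=\frac{\bar c}2\mathbf 1$ and $\omega(k,-1)\omega=\bar\omega(-1,k)\bar\omega=0$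 for $k=2$ and all integers $k\ge4$; $\omega(0,-1)=D$, $\bar\omega(-1,0)=\bar D$; $\omega(1,-1)=h$ and $\bar\omega(-1,1)=\bar h$ on $F_{h,\bar h}$. Put $L(n)=\omega(n+1,-1)$, $\bar L(n)=\bar\omega(-1,n+1)$. It is an *$N=(2,2)$ full VOA* if moreover vectors $\tau^\pm\in F_{3/2,0}$, $J\in F_{1,0}$ in $\ker\bar L(-1)$ and $\bar\tau^\pm\in F_{0,3/2}$, $\bar J\in F_{0,1}$ in $\ker L(-1)$ are given such that, with $G_r^\pm=\tau^\pm(r+\frac12,-1)$, $J(n)=J(n,-1)$, $\bar G_r^\pm=\bar\tau^\pm(-1,r+\frac12)$, $\bar J(n)=\bar J(-1,n)$ ($n\in\mathbb{Z}$, $r\in\frac12+\mathbb{Z}$), the operators $L(n),J(n),G^\pm_r$ satisfy $$[L(m),L(n)]=(m-n)L(m+n)+\tfrac{c(m^3-m)}{12}\delta_{m+n,0},\quad [J(m),J(n)]=\tfrac c3m\,\delta_{m+n,0},\quad [L(m),J(n)]=-nJ(m+n),$$ $$[J(n),G_r^\pm]=\pm G_{n+r}^\pm,\quad [L(n),G_r^\pm]=(\tfrac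 n2-r)G^\pm_{n+r},\quad [G_r^+,G_s^+]_+=[G_r^-,G_s^-]_+=0,$$ $$[G_r^+,G_s^-]_+=L(r+s)+\tfrac12(r-s)J(r+s)+\tfrac c6(r^2-\tfrac14)\delta_{r+s,0},$$ the operators $\bar L(n),\bar J(n),\bar G_r^\pm$ satisfy the same relations with $\bar c$, the two families supercommute with each other, $J(0)$ and $\bar J(0)$ are semisimple with real eigenvalues, and the eigenvalues of $J(0)-\bar J(0)$ are integers with $\exp(\pi i(J(0)-\bar J(0)))=(-1)^F$. It is *unitary* if there are given a bilinear form $(\cdot,\cdot)$ on $F$ with $(\mathbf 1,\mathbf 1)=1$ and $$(u,Y(a,\underline z)v)=\bigl(Y(e^{L(1)z+\bar L(1)\bar z}(-1)^{(L(0)-\bar L(0))+2(L(0)-\bar L(0))^2}z^{-2L(0)}\bar z^{-2\bar L(0)}a,\underline z^{-1})u,v\bigr),$$ and an anti-linear map $\phi:F\to F$ with $\phi^2=\mathrm{id}$, $\phi(\mathbf 1)=\mathbf 1$, $\phi(\omega)=\omega$, $\phi(\bar\omega)=\bar\omega$, $\phi(a(r,s)b)=\phi(a)(r,s)\phi(b)$,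 $\phi(J)=-J$, $\phi(\tau^\pm)=\tau^\mp$, $\phi(\bar J)=-\bar J$, $\phi(\bar\tau^\pm)=-\bar\tau^\mp$, such that $(\phi(v),v)>0$ for all $v\ne0$. Let $F^{p,q}=\{v: J(0)v=pv,\ \bar J(0)v=qv\}$ for $p,q\in\mathbb{R}$. A vector $v\in F_{h,\bar h}\cap F^{p,q}$ is *c-c primary* if $L(n)v=\bar L(n)v=J(n)v=\bar J(n)v=0$ for $n\ge1$, $G_r^\pm v=\bar G_r^\pm v=0$ for $r\ge\frac12$, and $G^+_{-1/2}v=\bar G^+_{-1/2}v=0$. Let $C(F)$ be the span of all c-c primary vectors, let $d_B=G^+_{-1/2}+\bar G^+_{-1/2}$ (so $d_B^2=0$ and $C(F)\subset\ker d_B$), let $H(F,d_B)=\ker d_B/\mathrm{Im}\,d_B$, and let $R:C(F)\to H(F,d_B)$ be the map induced by the inclusion. Both spaces carry the $\mathbb{Z}_2$-grading by fermion number. **Proposition.** Let $F$ be a unitary $N=(2,2)$ full VOA. The product $a\otimes b\mapsto a(-1,-1)b$ is well defined on $C(F)$ and on $H(F,d_B)$ and makes both into $\mathbb{Z}_2$-graded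 unital associative supercommutative algebras with unit $\mathbf 1$, and $R$ is an isomorphism of $\mathbb{Z}_2$-graded supercommutative algebras. Moreover, the eigenvalues of $J(0)$ and $\bar J(0)$ make both into $\mathbb{R}^2$-graded algebras: $C(F)=\bigoplus_{p,q}C(F)^{p,q}$, where $C(F)^{p,q}=C(F)\cap F^{p,q}$ is the space of c-c primary vectors in $F_{p/2,q/2}\cap F^{p,q}$, and $H(F,d_B)=\bigoplus_{p,q}H^{p,q}$, where $H^{p,q}=R(C(F)^{p,q})$ consists of the classes that have a representative in $\ker d_B\cap F^{p,q}$. These gradings refine the $\mathbb{Z}_2$-gradings: a component can be non-zero only if $p-q\in\mathbb{Z}$, and it then has parity $p-q \bmod 2$. -/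

import Mathlib

noncomputable section

namespace FullCFT

/-! ### Full vertex superalgebras -/

/-- The single-valued monomial `z ^ r * zbar ^ s = |z| ^ (r + s) * exp (i (r - s) arg z)`, to be used
for `z ≠ 0` and `r - s ∈ ℤ`. -/
def monomial (z : ℂ) (r s : ℝ) : ℂ :=
  ((‖z‖ ^ (r + s) : ℝ) : ℂ) * Complex.exp (Complex.I * ((r - s : ℝ) : ℂ) * (z.arg : ℂ))

/-- The configuration space of pairs of distinct non-zero complex numbers. -/
def Y2 : Set (ℂ × ℂ) := {x | x.1 ≠ x.2 ∧ x.1 ≠ 0 ∧ x.2 ≠ 0}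

open Classical in
/-- The fermion number of a vector of spin `x = h - hbar`: `0` if `x ∈ ℤ` and `1` otherwise
(i.e. `x ∈ 1/2 + ℤ`, the only other possibility). -/
def fermion (x : ℝ) : ℕ := if ∃ n : ℤ, x = n then 0 else 1

/-- A full vertex superalgebra on the complex vector space `F`.
`Y r s a b` is `a(r,s)b`, the coefficient of `z ^ (-r-1) * zbar ^ (-s-1)` in `Y(a,z,zbar)b`. -/
structure FullVertexSuperalgebra (F : Type*) [AddCommGroup F] [Module ℂ F] where
  /-- the homogeneous component of weight `(h, hbar)` -/
  wt : ℝ → ℝ → Submodule ℂ F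
  wt_internal : DirectSum.IsInternal (fun x : ℝ × ℝ => wt x.1 x.2)
  wt_spin : ∀ h hb : ℝ, (∀ n : ℤ, h - hb ≠ (n : ℝ) / 2) → wt h hb = ⊥
  wt_finite : ∀ H : ℝ,
    FiniteDimensional ℂ ↥(⨆ x : {x : ℝ × ℝ // x.1 + x.2 < H}, wt x.1.1 x.1.2)
  wt_bounded : ∃ N : ℝ, ∀ h hb : ℝ, ¬ (N ≤ h ∧ N ≤ hb) → wt h hb = ⊥
  Y : ℝ → ℝ → F →ₗ[ℂ] F →ₗ[ℂ] F
  /-- Only monomials `z ^ r * zbar ^ s` with `r - s ∈ ℤ` occur. Given the next field,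
  this says that the vertex operator is an even map. -/
  Y_even : ∀ r s : ℝ, (∀ n : ℤ, r - s ≠ n) → Y r s = 0
  /-- Covariance under `L(0)` and `Lbar(0)`, in terms of homogeneous components:
  `[L(0), Y(a,z)] = z d/dz Y(a,z) + Y(L(0)a,z)` and its conjugate. -/
  Y_wt : ∀ (h hb h' hb' r s : ℝ) (a b : F), a ∈ wt h hb → b ∈ wt h' hb' →
    Y r s a b ∈ wt (h + h' - r - 1) (hb + hb' - s - 1)
  one : F
  one_wt : one ∈ wt 0 0
  creation : ∀ (a : F) (r s : ℝ), (¬ ∃ m n : ℕ, r = -(m : ℝ) - 1 ∧ s = -(n : ℝ) - 1) →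
    Y r s a one = 0
  creation_eq : ∀ a : F, Y (-1) (-1) a one = a
  one_Y : Y (-1) (-1) one = LinearMap.id
  one_Y_ne : ∀ r s : ℝ, (r, s) ≠ (-1, -1) → Y r s one = 0
  /-- Convergence, associativity and locality of the four point functions. Here `u` is an element of
  the dual space of `wt h₀ hb₀`, extended by zero to the other components. -/
  bootstrap : ∀ (h₀ hb₀ h₁ hb₁ h₂ hb₂ h₃ hb₃ : ℝ) (a b c : F) (u : F →ₗ[ℂ] ℂ),
    a ∈ wt h₁ hb₁ → b ∈ wt h₂ hb₂ → c ∈ wt h₃ hb₃ →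
    (∀ h hb : ℝ, (h, hb) ≠ (h₀, hb₀) → ∀ v ∈ wt h hb, u v = 0) →
    ∃ μ : ℂ × ℂ → ℂ, AnalyticOnNhd ℝ μ Y2 ∧
      (∀ z₁ z₂ : ℂ, z₂ ≠ 0 → ‖z₂‖ < ‖z₁‖ →
        HasSum (fun x : (ℝ × ℝ) × (ℝ × ℝ) =>
          u (Y x.1.1 x.1.2 a (Y x.2.1 x.2.2 b c)) *
            monomial z₁ (-x.1.1 - 1) (-x.1.2 - 1) * monomial z₂ (-x.2.1 - 1) (-x.2.2 - 1))
          (μ (z₁, z₂))) ∧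
      (∀ z₀ z₂ : ℂ, z₀ ≠ 0 → ‖z₀‖ < ‖z₂‖ →
        HasSum (fun x : (ℝ × ℝ) × (ℝ × ℝ) =>
          u (Y x.2.1 x.2.2 (Y x.1.1 x.1.2 a b) c) *
            monomial z₀ (-x.1.1 - 1) (-x.1.2 - 1) * monomial z₂ (-x.2.1 - 1) (-x.2.2 - 1))
          (μ (z₀ + z₂, z₂))) ∧
      (∀ z₁ z₂ : ℂ, z₁ ≠ 0 → ‖z₁‖ < ‖z₂‖ →
        HasSum (fun x : (ℝ × ℝ) × (ℝ × ℝ) =>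
          (-1 : ℂ) ^ (fermion (h₁ - hb₁) * fermion (h₂ - hb₂)) *
          (u (Y x.2.1 x.2.2 b (Y x.1.1 x.1.2 a c)) *
            monomial z₁ (-x.1.1 - 1) (-x.1.2 - 1) * monomial z₂ (-x.2.1 - 1) (-x.2.2 - 1)))
          (μ (z₁, z₂)))

namespace FullVertexSuperalgebra

variable {F : Type*} [AddCommGroup F] [Module ℂ F] (V : FullVertexSuperalgebra F)

/-- The even (`i = 0`) and odd (`i = 1`) part of `F`: the sum of the homogeneous components with
`h - hbar ∈ i / 2 + ℤ`. -/
def par (i : ZMod 2) : Submodule ℂ F :=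
  ⨆ x : {x : ℝ × ℝ // ∃ n : ℤ, x.1 - x.2 = n + (i.val : ℝ) / 2}, V.wt x.1.1 x.1.2

/-- The translation operator `D a = a(-2,-1)1`. -/
def D : Module.End ℂ F := (V.Y (-2) (-1)).flip V.one

/-- The translation operator `Dbar a = a(-1,-2)1`. -/
def Dbar : Module.End ℂ F := (V.Y (-1) (-2)).flip V.one

end FullVertexSuperalgebra

/-! ### Full vertex operator superalgebras -/

/-- A full vertex operator superalgebra: a full vertex superalgebra with a holomorphic and an
antiholomorphic conformal vector `ω`, `ωb`, of central charges `c`, `cb`. -/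
structure FullVOA (F : Type*) [AddCommGroup F] [Module ℂ F] extends FullVertexSuperalgebra F where
  ω : F
  ωb : F
  c : ℂ
  cb : ℂ
  ω_wt : ω ∈ wt 2 0
  ωb_wt : ωb ∈ wt 0 2
  Dbar_ω : toFullVertexSuperalgebra.Dbar ω = 0
  D_ωb : toFullVertexSuperalgebra.D ωb = 0
  ω_three : Y 3 (-1) ω ω = (c / 2) • one
  ωb_three : Y (-1) 3 ωb ωb = (cb / 2) • one
  ω_ω : ∀ k : ℤ, k = 2 ∨ 4 ≤ k → Y k (-1) ω ω = 0
  ωb_ωb : ∀ k : ℤ, k = 2 ∨ 4 ≤ k → Y (-1) k ωb ωb = 0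
  ω_zero : Y 0 (-1) ω = toFullVertexSuperalgebra.D
  ωb_zero : Y (-1) 0 ωb = toFullVertexSuperalgebra.Dbar
  ω_one : ∀ (h hb : ℝ), ∀ v ∈ wt h hb, Y 1 (-1) ω v = (h : ℂ) • v
  ωb_one : ∀ (h hb : ℝ), ∀ v ∈ wt h hb, Y (-1) 1 ωb v = (hb : ℂ) • v

namespace FullVOA

variable {F : Type*} [AddCommGroup F] [Module ℂ F] (V : FullVOA F)

/-- The Virasoro operator `L(n) = ω(n+1,-1)`, for `n ∈ ℤ`. -/
def L (n : ℝ) : Module.End ℂ F := V.Y (n + 1) (-1) V.ω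

/-- The Virasoro operator `Lbar(n) = ωbar(-1,n+1)`, for `n ∈ ℤ`. -/
def Lb (n : ℝ) : Module.End ℂ F := V.Y (-1) (n + 1) V.ωb

end FullVOA

/-! ### `N = (2,2)` full vertex operator superalgebras -/

/-- The set `1/2 + ℤ`. -/
def HalfInt : Set ℝ := {r | ∃ n : ℤ, r = n + 1 / 2}

/-- The operators `L n`, `J n` (`n ∈ ℤ`) and `Gp r`, `Gm r` (`r ∈ 1/2 + ℤ`) on `F` satisfy the
relations of the `N = 2` Neveu-Schwarz superconformal algebra of central charge `c`. -/
structure IsNeveuSchwarz {F : Type*} [AddCommGroup F] [Module ℂ F] (c : ℂ)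
    (L J Gp Gm : ℝ → Module.End ℂ F) : Prop where
  L_L : ∀ m n : ℤ, L m * L n - L n * L m = ((m : ℂ) - n) • L (m + n) +
    (if m + n = 0 then c * ((m : ℂ) ^ 3 - m) / 12 else 0) • (1 : Module.End ℂ F)
  J_J : ∀ m n : ℤ, J m * J n - J n * J m =
    (if m + n = 0 then c / 3 * m else 0) • (1 : Module.End ℂ F)
  L_J : ∀ m n : ℤ, L m * J n - J n * L m = (-(n : ℂ)) • J (m + n)
  J_Gp : ∀ n : ℤ, ∀ r ∈ HalfInt, J n * Gp r - Gp r * J n = Gp (n + r)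
  J_Gm : ∀ n : ℤ, ∀ r ∈ HalfInt, J n * Gm r - Gm r * J n = -Gm (n + r)
  L_Gp : ∀ n : ℤ, ∀ r ∈ HalfInt,
    L n * Gp r - Gp r * L n = ((n : ℂ) / 2 - (r : ℂ)) • Gp (n + r)
  L_Gm : ∀ n : ℤ, ∀ r ∈ HalfInt,
    L n * Gm r - Gm r * L n = ((n : ℂ) / 2 - (r : ℂ)) • Gm (n + r)
  Gp_Gp : ∀ r ∈ HalfInt, ∀ s ∈ HalfInt, Gp r * Gp s + Gp s * Gp r = 0
  Gm_Gm : ∀ r ∈ HalfInt, ∀ s ∈ HalfInt, Gm r * Gm s + Gm s * Gm r = 0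
  Gp_Gm : ∀ r ∈ HalfInt, ∀ s ∈ HalfInt, Gp r * Gm s + Gm s * Gp r =
    L (r + s) + (((r : ℂ) - s) / 2) • J (r + s) +
    (if r + s = 0 then c / 6 * ((r : ℂ) ^ 2 - 1 / 4) else 0) • (1 : Module.End ℂ F)

/-- The operators `L n`, `J n`, `n ∈ ℤ`. -/
def evenOps {F : Type*} [AddCommGroup F] [Module ℂ F] (L J : ℝ → Module.End ℂ F) :
    Set (Module.End ℂ F) := {A | ∃ n : ℤ, A = L n ∨ A = J n}

/-- The operators `Gp r`, `Gm r`, `r ∈ 1/2 + ℤ`. -/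
def oddOps {F : Type*} [AddCommGroup F] [Module ℂ F] (Gp Gm : ℝ → Module.End ℂ F) :
    Set (Module.End ℂ F) := {A | ∃ r ∈ HalfInt, A = Gp r ∨ A = Gm r}

/-- The superconformal vectors of an `N = (2,2)` structure, before any relation is imposed
besides weights and (anti)holomorphy. -/
structure PreN22FullVOA (F : Type*) [AddCommGroup F] [Module ℂ F] extends FullVOA F where
  τp : F
  τm : F
  J : F
  τbp : F
  τbm : F
  Jb : F
  τp_wt : τp ∈ wt (3 / 2) 0
  τm_wt : τm ∈ wt (3 / 2) 0
  J_wt : J ∈ wt 1 0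
  τbp_wt : τbp ∈ wt 0 (3 / 2)
  τbm_wt : τbm ∈ wt 0 (3 / 2)
  Jb_wt : Jb ∈ wt 0 1
  Lb_τp : toFullVOA.Lb (-1) τp = 0
  Lb_τm : toFullVOA.Lb (-1) τm = 0
  Lb_J : toFullVOA.Lb (-1) J = 0
  L_τbp : toFullVOA.L (-1) τbp = 0
  L_τbm : toFullVOA.L (-1) τbm = 0
  L_Jb : toFullVOA.L (-1) Jb = 0

namespace PreN22FullVOA

variable {F : Type*} [AddCommGroup F] [Module ℂ F] (V : PreN22FullVOA F)

/-- `J(n)`, for `n ∈ ℤ`. -/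
def Jop (n : ℝ) : Module.End ℂ F := V.Y n (-1) V.J
/-- `Jbar(n)`, for `n ∈ ℤ`. -/
def Jbop (n : ℝ) : Module.End ℂ F := V.Y (-1) n V.Jb
/-- `G⁺_r = τ⁺(r + 1/2)`, for `r ∈ 1/2 + ℤ`. -/
def Gp (r : ℝ) : Module.End ℂ F := V.Y (r + 1 / 2) (-1) V.τp
/-- `G⁻_r = τ⁻(r + 1/2)`, for `r ∈ 1/2 + ℤ`. -/
def Gm (r : ℝ) : Module.End ℂ F := V.Y (r + 1 / 2) (-1) V.τm
/-- `Gbar⁺_r`, for `r ∈ 1/2 + ℤ`. -/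
def Gbp (r : ℝ) : Module.End ℂ F := V.Y (-1) (r + 1 / 2) V.τbp
/-- `Gbar⁻_r`, for `r ∈ 1/2 + ℤ`. -/
def Gbm (r : ℝ) : Module.End ℂ F := V.Y (-1) (r + 1 / 2) V.τbm

end PreN22FullVOA

/-- An `N = (2,2)` full vertex operator superalgebra. -/
structure N22FullVOA (F : Type*) [AddCommGroup F] [Module ℂ F] extends PreN22FullVOA F where
  left_rel : IsNeveuSchwarz c toFullVOA.L toPreN22FullVOA.Jop
    toPreN22FullVOA.Gp toPreN22FullVOA.Gm
  right_rel : IsNeveuSchwarz cb toFullVOA.Lb toPreN22FullVOA.Jbop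
    toPreN22FullVOA.Gbp toPreN22FullVOA.Gbm
  /-- The two copies of the superconformal algebra supercommute. -/
  even_even : ∀ A ∈ evenOps toFullVOA.L toPreN22FullVOA.Jop,
    ∀ B ∈ evenOps toFullVOA.Lb toPreN22FullVOA.Jbop, A * B - B * A = 0
  even_odd : ∀ A ∈ evenOps toFullVOA.L toPreN22FullVOA.Jop,
    ∀ B ∈ oddOps toPreN22FullVOA.Gbp toPreN22FullVOA.Gbm, A * B - B * A = 0
  odd_even : ∀ A ∈ oddOps toPreN22FullVOA.Gp toPreN22FullVOA.Gm,
    ∀ B ∈ evenOps toFullVOA.Lb toPreN22FullVOA.Jbop, A * B - B * A = 0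
  odd_odd : ∀ A ∈ oddOps toPreN22FullVOA.Gp toPreN22FullVOA.Gm,
    ∀ B ∈ oddOps toPreN22FullVOA.Gbp toPreN22FullVOA.Gbm, A * B + B * A = 0
  /-- `J(0)` and `Jbar(0)` are semisimple with real eigenvalues. -/
  J_semisimple : ⨆ p : ℝ, (toPreN22FullVOA.Jop 0).eigenspace (p : ℂ) = ⊤
  Jb_semisimple : ⨆ q : ℝ, (toPreN22FullVOA.Jbop 0).eigenspace (q : ℂ) = ⊤
  /-- The eigenvalues of `J(0) - Jbar(0)` are integers. -/
  charge_int : ∀ lam : ℂ,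
    (toPreN22FullVOA.Jop 0 - toPreN22FullVOA.Jbop 0).HasEigenvalue lam → ∃ n : ℤ, lam = n
  /-- `exp (π i (J(0) - Jbar(0))) = (-1)^F`: eigenvectors of `J(0) - Jbar(0)` with even, respectively
  odd, eigenvalue are even, respectively odd. -/
  charge_par : ∀ n : ℤ,
    (toPreN22FullVOA.Jop 0 - toPreN22FullVOA.Jbop 0).eigenspace (n : ℂ) ≤
      toFullVertexSuperalgebra.par (n : ZMod 2)

namespace N22FullVOA

variable {F : Type*} [AddCommGroup F] [Module ℂ F] (V : N22FullVOA F)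

/-- The vectors of charge `(p, q)`: `J(0)v = p v` and `Jbar(0)v = q v`. -/
def charge (p q : ℝ) : Submodule ℂ F :=
  (V.Jop 0).eigenspace (p : ℂ) ⊓ (V.Jbop 0).eigenspace (q : ℂ)

/-! ### The B-twist and its cohomology -/

/-- The B-twist `d = G⁺_{-1/2} + Gbar⁺_{-1/2}`. -/
def d : Module.End ℂ F := V.Gp (-1 / 2) + V.Gbp (-1 / 2)

theorem neg_half_mem : (-1 / 2 : ℝ) ∈ HalfInt := ⟨-1, by norm_num⟩

theorem d_d : V.d * V.d = 0 := by
  have h1 := V.left_rel.Gp_Gp _ neg_half_mem _ neg_half_mem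
  have h2 := V.right_rel.Gp_Gp _ neg_half_mem _ neg_half_mem
  have h3 := V.odd_odd _ ⟨_, neg_half_mem, Or.inl rfl⟩ _ ⟨_, neg_half_mem, Or.inl rfl⟩
  rw [← two_smul ℂ] at h1 h2
  have h1' := (smul_eq_zero.mp h1).resolve_left two_ne_zero
  have h2' := (smul_eq_zero.mp h2).resolve_left two_ne_zero
  rw [d, mul_add, add_mul, add_mul, h1', h2', zero_add, add_zero, add_comm]
  exact h3

/-- The coboundaries, as a subspace of the cocycles. -/
def boundaries : Submodule ℂ ↥(LinearMap.ker V.d) :=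
  (LinearMap.range V.d).comap (LinearMap.ker V.d).subtype

/-- The cohomology `H(F,d) = ker d / im d`. -/
abbrev H : Type _ := ↥(LinearMap.ker V.d) ⧸ V.boundaries

/-- The class of a cocycle. -/
abbrev cls : ↥(LinearMap.ker V.d) →ₗ[ℂ] V.H := V.boundaries.mkQ

/-- The `ℤ/2`-grading on the cohomology by the fermion number. -/
def Hpar (i : ZMod 2) : Submodule ℂ V.H :=
  ((V.par i).comap (LinearMap.ker V.d).subtype).map V.cls

/-- The classes that have a representative of charge `(p, q)`. -/
def Hcharge (x : ℝ × ℝ) : Submodule ℂ V.H :=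
  ((V.charge x.1 x.2).comap (LinearMap.ker V.d).subtype).map V.cls

/-! ### c-c primary vectors -/

/-- The chiral-chiral primary vectors of weight `(h, hb)` and charge `(p, q)`. -/
def ccPrimary (h hb p q : ℝ) : Submodule ℂ F where
  carrier := {v | v ∈ V.wt h hb ∧ v ∈ V.charge p q ∧
    (∀ n : ℤ, 1 ≤ n → V.L n v = 0 ∧ V.Lb n v = 0 ∧ V.Jop n v = 0 ∧ V.Jbop n v = 0) ∧
    (∀ r ∈ HalfInt, 1 / 2 ≤ r →
      V.Gp r v = 0 ∧ V.Gm r v = 0 ∧ V.Gbp r v = 0 ∧ V.Gbm r v = 0) ∧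
    V.Gp (-1 / 2) v = 0 ∧ V.Gbp (-1 / 2) v = 0}
  add_mem' := by
    rintro a b ⟨a1, a2, a3, a4, a5, a6⟩ ⟨b1, b2, b3, b4, b5, b6⟩
    refine ⟨add_mem a1 b1, add_mem a2 b2, fun n hn => ?_, fun r hr hr' => ?_, ?_, ?_⟩
    · obtain ⟨x1, x2, x3, x4⟩ := a3 n hn
      obtain ⟨y1, y2, y3, y4⟩ := b3 n hn
      simp [x1, x2, x3, x4, y1, y2, y3, y4]
    · obtain ⟨x1, x2, x3, x4⟩ := a4 r hr hr'
      obtain ⟨y1, y2, y3, y4⟩ := b4 r hr hr'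
      simp [x1, x2, x3, x4, y1, y2, y3, y4]
    · rw [map_add, a5, b5, add_zero]
    · rw [map_add, a6, b6, add_zero]
  zero_mem' := ⟨zero_mem _, zero_mem _, by simp, by simp, by simp, by simp⟩
  smul_mem' := by
    rintro k a ⟨a1, a2, a3, a4, a5, a6⟩
    refine ⟨Submodule.smul_mem _ _ a1, Submodule.smul_mem _ _ a2, fun n hn => ?_,
      fun r hr hr' => ?_, ?_, ?_⟩
    · obtain ⟨x1, x2, x3, x4⟩ := a3 n hn
      simp [x1, x2, x3, x4]
    · obtain ⟨x1, x2, x3, x4⟩ := a4 r hr hr'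
      simp [x1, x2, x3, x4]
    · rw [map_smul, a5, smul_zero]
    · rw [map_smul, a6, smul_zero]

/-- `C(F)`: the space spanned by all c-c primary vectors. -/
def C : Submodule ℂ F :=
  ⨆ x : (ℝ × ℝ) × (ℝ × ℝ), V.ccPrimary x.1.1 x.1.2 x.2.1 x.2.2

theorem C_le_ker : V.C ≤ LinearMap.ker V.d := by
  refine iSup_le fun x v hv => ?_
  obtain ⟨-, -, -, -, h1, h2⟩ := hv
  simp [d, h1, h2]

/-- The map `R : C(F) → H(F,d)` that sends a vector to its class. -/
def R : ↥V.C →ₗ[ℂ] V.H := V.cls ∘ₗ Submodule.inclusion V.C_le_ker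

/-- The `ℤ/2`-grading on `C(F)` by the fermion number. -/
def Cpar (i : ZMod 2) : Submodule ℂ ↥V.C := (V.par i).comap V.C.subtype

/-- The vectors of charge `(p, q)` in `C(F)`. -/
def Ccharge (x : ℝ × ℝ) : Submodule ℂ ↥V.C := (V.charge x.1 x.2).comap V.C.subtype

end N22FullVOA

/-! ### Unitarity -/

/-- A unitary `N = (2,2)` full vertex operator superalgebra. -/
structure UnitaryN22FullVOA (F : Type*) [AddCommGroup F] [Module ℂ F] extends N22FullVOA F where
  form : F →ₗ[ℂ] F →ₗ[ℂ] ℂ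
  /-- Invariance, coefficient by coefficient: for `a` of weight `(h, hb)`,
  `(u, Y(a,z)v) = (Y(exp(L(1)z + Lbar(1)zbar) (-1)^{x + 2x²} z^{-2h} zbar^{-2hb} a, 1/z)u, v)` with
  `x = h - hb`; if `x = n/2` then `x + 2x² = n(n+1)/2`. The sum has only finitely many
  non-zero terms. -/
  form_invariant : ∀ (h hb : ℝ) (n : ℤ), h - hb = (n : ℝ) / 2 → ∀ a ∈ wt h hb,
    ∀ (u v : F) (r s : ℝ), form u (Y r s a v) = (-1 : ℂ) ^ (n * (n + 1) / 2) *
      ∑ᶠ x : ℕ × ℕ, (1 / ((x.1.factorial : ℂ) * (x.2.factorial : ℂ))) *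
        form (Y (2 * h - x.1 - r - 2) (2 * hb - x.2 - s - 2)
          ((toFullVOA.L 1 ^ x.1) ((toFullVOA.Lb 1 ^ x.2) a)) u) v
  form_one : form one one = 1
  /-- the anti-linear involution -/
  φ : F →ₛₗ[starRingEnd ℂ] F
  φ_φ : ∀ v, φ (φ v) = v
  φ_one : φ one = one
  φ_ω : φ ω = ω
  φ_ωb : φ ωb = ωb
  φ_Y : ∀ (r s : ℝ) (a b : F), φ (Y r s a b) = Y r s (φ a) (φ b)
  /-- The sesquilinear form `⟨u, v⟩ = (φ(u), v)` is positive definite. -/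
  pos_def : ∀ v : F, v ≠ 0 → 0 < (form (φ v) v).re ∧ (form (φ v) v).im = 0
  φ_J : φ J = -J
  φ_τp : φ τp = τm
  φ_τm : φ τm = τp
  φ_Jb : φ Jb = -Jb
  φ_τbp : φ τbp = -τbm
  φ_τbm : φ τbm = -τbp

/-! ### Graded supercommutative algebras -/

/-- `A` with product `mul`, unit `one` and `ℤ/2`-grading `par` is a `ℤ/2`-graded unital
associative supercommutative algebra. -/
structure IsSupercommAlgebra {A : Type*} [AddCommGroup A] [Module ℂ A]
    (mul : A →ₗ[ℂ] A →ₗ[ℂ] A) (one : A) (par : ZMod 2 → Submodule ℂ A) : Prop where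
  one_mul : ∀ a, mul one a = a
  mul_one : ∀ a, mul a one = a
  mul_assoc : ∀ a b c, mul (mul a b) c = mul a (mul b c)
  par_internal : DirectSum.IsInternal par
  one_par : one ∈ par 0
  mul_par : ∀ i j, ∀ a ∈ par i, ∀ b ∈ par j, mul a b ∈ par (i + j)
  supercomm : ∀ i j, ∀ a ∈ par i, ∀ b ∈ par j,
    mul a b = (-1 : ℂ) ^ (i.val * j.val) • mul b a

/-- The subspaces `gr (p, q)` make `A` (with product `mul` and unit `one`) an `ℝ²`-graded algebra,
and this grading refines the `ℤ/2`-grading `par` through `(p, q) ↦ p - q mod 2`. -/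
structure IsRefinedGrading {A : Type*} [AddCommGroup A] [Module ℂ A]
    (mul : A →ₗ[ℂ] A →ₗ[ℂ] A) (one : A) (par : ZMod 2 → Submodule ℂ A)
    (gr : ℝ × ℝ → Submodule ℂ A) : Prop where
  internal : DirectSum.IsInternal gr
  one_gr : one ∈ gr 0
  mul_gr : ∀ x y, ∀ a ∈ gr x, ∀ b ∈ gr y, mul a b ∈ gr (x + y)
  refines : ∀ x, gr x ≠ ⊥ → ∃ n : ℤ, x.1 - x.2 = n ∧ gr x ≤ par (n : ZMod 2)

end FullCFT

end

noncomputable section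

namespace FullCFT

open Complex Filter Topology Metric

/-! ### Laurent series and residues -/

section Laurent

variable {ι : Type*} {A : ι → ℂ} {N : ι → ℤ} {f : ℂ → ℂ}

/-! The proof is Hodge theory for `d`. By unitarity the adjoint of `d` is `dAdj`, the sum of
G⁻_{1/2} and its conjugate. Since the two chiral halves anticommute, the Laplacian {d, d*} is the
sum of L(0) - J(0)/2 and its conjugate, hence diagonalizable with real eigenvalues. On a cocycle
with nonzero eigenvalue this identity displays the cocycle as a coboundary, so every class has a
harmonic representative (`exists_harmonic`). By positivity a harmonic vector is killed by G⁺_{-1/2},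
G⁻_{1/2} and their conjugates (`harmonic`). The remaining positive modes kill it because they would
produce a negative eigenvalue of L(0) - J(0)/2 or of its conjugate (`primary_of_bound`). So C(F) is
exactly the kernel of the Laplacian (`mem_C_iff`), and `R` is bijective because a harmonic
coboundary is zero.

For the products, two facts about modes are extracted from the bootstrap axiom: translation
covariance (`Y_D`), by comparing two expansions to first order, and the derivation property of zero
modes of holomorphic fields (`Y_zero_mode`), by the residue theorem on ℂ ∖ {0, 1}. Hence `d` is an
odd derivation of all products a(r,s)b. Since L(-1) and its conjugate are anticommutators with `d`,
every product of cocycles with (r,s) ≠ (-1,-1) is a coboundary (`Y_mem_range_d`). A functional that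
vanishes on coboundaries therefore sees a four point function that is constant on each region of
convergence. Comparing the constants where regions overlap gives associativity and
supercommutativity modulo coboundaries (`product_relations`). The Laplacian is a derivation of the
(-1,-1)-product, so products of harmonic vectors are harmonic, and for them these identities hold
exactly.

The algebra structure on the cohomology is carried over from C(F) along `R`. The Laplacian preserves
parity and charge, so harmonic representatives can be chosen inside each graded piece, which matches
the gradings. -/

theorem norm_mul_zpow_le (a z : ℂ) (n : ℤ) {r R : ℝ} (hr : 0 < r) (h1 : r ≤ ‖z‖)
    (h2 : ‖z‖ ≤ R) : ‖a * z ^ n‖ ≤ ‖a * (r : ℂ) ^ n‖ + ‖a * (R : ℂ) ^ n‖ := by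
  have hR : 0 < R := hr.trans_le (h1.trans h2)
  have hz : 0 < ‖z‖ := hr.trans_le h1
  simp only [norm_mul, norm_zpow, Complex.norm_real, Real.norm_of_nonneg hr.le,
    Real.norm_of_nonneg hR.le]
  rw [← mul_add]
  refine mul_le_mul_of_nonneg_left ?_ (norm_nonneg _)
  -- The n-th power of the radius is monotone for n ≥ 0 and antitone for n < 0; the sum of both
  -- endpoint values is a majorant that serves either case.
  rcases le_or_gt 0 n with hn | hn
  · have : ‖z‖ ^ n ≤ R ^ n := zpow_le_zpow_left₀ hn hz.le h2
    have : 0 < r ^ n := zpow_pos hr n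
    linarith
  · have : ‖z‖ ^ n ≤ r ^ n := by
      rw [← neg_neg n, zpow_neg, zpow_neg _ (-n)]
      exact inv_anti₀ (zpow_pos hr _) (zpow_le_zpow_left₀ (by omega) hr.le h1)
    have : 0 < R ^ n := zpow_pos hR n
    linarith

/-- A Laurent series that converges on an annulus is holomorphic there. -/
theorem differentiableOn_of_hasSum_zpow {r R : ℝ} (hr : 0 < r)
    (hRsum : Summable fun i => A i * (R : ℂ) ^ N i) (hrsum : Summable fun i => A i * (r : ℂ) ^ N i)
    (h : ∀ z : ℂ, r < ‖z‖ → ‖z‖ < R → HasSum (fun i => A i * z ^ N i) (f z)) :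
    DifferentiableOn ℂ f {z | r < ‖z‖ ∧ ‖z‖ < R} := by
  have hopen : IsOpen {z : ℂ | r < ‖z‖ ∧ ‖z‖ < R} :=
    (isOpen_lt continuous_const continuous_norm).inter (isOpen_lt continuous_norm continuous_const)
  refine (differentiableOn_tsum_of_summable_norm (hrsum.norm.add hRsum.norm)
    (F := fun i z => A i * z ^ N i) (fun i z hz => ?_) hopen fun i z hz => ?_).congr
      fun z hz => (h z hz.1 hz.2).tsum_eq.symm
  · have : z ≠ 0 := norm_pos_iff.mp (hr.trans hz.1)
    exact ((differentiableAt_zpow.2 (Or.inl this)).const_mul _).differentiableWithinAt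
  · exact norm_mul_zpow_le _ _ _ hr hz.1.le hz.2.le

/-- The integral of a Laurent series over a circle. -/
theorem circleIntegral_of_hasSum_zpow {A : ℤ → ℂ} {R : ℝ} (hR : 0 < R)
    (h : ∀ z : ℂ, ‖z‖ = R → HasSum (fun n : ℤ => A n * z ^ n) (f z)) :
    (∮ z in C(0, R), f z) = 2 * Real.pi * I * A (-1) := by
  have hterm : ∀ n : ℤ, (∮ z in C(0, R), A n * z ^ n) =
      if n = -1 then 2 * Real.pi * I * A (-1) else 0 := by
    intro n
    rw [circleIntegral.integral_const_mul]
    split_ifs with hn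
    · subst hn
      have := circleIntegral.integral_sub_center_inv 0 hR.ne'
      simp only [sub_zero] at this
      simp only [zpow_neg_one]
      rw [this]; ring
    · have := circleIntegral.integral_sub_zpow_of_ne hn 0 0 R
      simp only [sub_zero] at this
      rw [this, mul_zero]
  have hcont : ∀ n : ℤ, Continuous fun θ : ℝ => A n * circleMap 0 R θ ^ n := fun n =>
    continuous_const.mul ((continuous_circleMap 0 R).zpow₀ n
      fun θ => Or.inl (circleMap_ne_center hR.ne'))
  have hsum : Summable fun n : ℤ => A n * (R : ℂ) ^ n :=
    (h R (by rw [Complex.norm_real, Real.norm_of_nonneg hR.le])).summable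
  -- Termwise integration: the norms of the terms are constant on the circle, so absolute
  -- convergence at the single point R dominates everywhere.
  have key : HasSum (fun n : ℤ => ∮ z in C(0, R), A n * z ^ n) (∮ z in C(0, R), f z) := by
    refine intervalIntegral.hasSum_integral_of_dominated_convergence
      (fun n _ => R * ‖A n * (R : ℂ) ^ n‖) (fun n => ?_) (fun n => ?_) ?_ ?_ ?_
    · refine Continuous.aestronglyMeasurable ?_
      simp only [deriv_circleMap]
      exact ((continuous_circleMap 0 R).mul continuous_const).smul (hcont n)
    · refine MeasureTheory.ae_of_all _ fun θ _ => ?_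
      simp [abs_of_pos hR]
    · exact MeasureTheory.ae_of_all _ fun θ _ => hsum.norm.mul_left _
    · exact intervalIntegrable_const
    · refine MeasureTheory.ae_of_all _ fun θ _ => ?_
      exact (h _ (by simp [abs_of_pos hR])).const_smul _
  simp_rw [hterm] at key
  exact key.unique (by
    have := hasSum_ite_eq (-1 : ℤ) (2 * Real.pi * I * A (-1))
    simpa using this)

end Laurent

/-- A real analytic function on a connected open set that is holomorphic on a nonempty open subset
is holomorphic. -/
theorem differentiableAt_of_analyticOnNhd_real {f : ℂ → ℂ} {U : Set ℂ}
    (hf : AnalyticOnNhd ℝ f U) (hU : IsPreconnected U) {z₀ : ℂ} (hz₀ : z₀ ∈ U)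
    (h₀ : ∀ᶠ z in 𝓝 z₀, DifferentiableAt ℂ f z) {z : ℂ} (hz : z ∈ U) : DifferentiableAt ℂ f z := by
  have happ : ∀ w : ℂ, AnalyticOnNhd ℝ (fun z => fderiv ℝ f z w) U := fun w x hx =>
    ((ContinuousLinearMap.apply ℝ ℂ w).analyticAt _).comp (hf.fderiv x hx)
  -- The defect in the Cauchy–Riemann equation is itself real analytic, so the identity theorem
  -- propagates its vanishing from a neighbourhood of `z₀` to `U`.
  have hg : AnalyticOnNhd ℝ (fun z => fderiv ℝ f z I - I • fderiv ℝ f z 1) U := fun x hx =>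
    (happ I x hx).sub ((analyticAt_const (v := I)).fun_smul (happ 1 x hx))
  have h0 := hg.eqOn_zero_of_preconnected_of_eventuallyEq_zero hU hz₀ (by
    filter_upwards [h₀] with x hx
    simp [(differentiableAt_complex_iff_differentiableAt_real.1 hx).2])
  exact differentiableAt_complex_iff_differentiableAt_real.2
    ⟨(hf z hz).differentiableAt, sub_eq_zero.1 (h0 hz)⟩

/-- The residue theorem for a function on `ℂ ∖ {0, 1}`, in terms of its expansions at `∞`, `1`
and `0`. -/
theorem residue_relation {f : ℂ → ℂ} {A B C : ℤ → ℂ}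
    (hf : AnalyticOnNhd ℝ f ({0, 1} : Set ℂ)ᶜ)
    (hA : ∀ z : ℂ, 1 < ‖z‖ → HasSum (fun n : ℤ => A n * z ^ n) (f z))
    (hB : ∀ z : ℂ, z ≠ 0 → ‖z‖ < 1 → HasSum (fun n : ℤ => B n * z ^ n) (f (z + 1)))
    (hC : ∀ z : ℂ, z ≠ 0 → ‖z‖ < 1 → HasSum (fun n : ℤ => C n * z ^ n) (f z))
    {M : ℕ} (hBM : ∀ n : ℤ, n < -M → B n = 0) :
    A (-1) = B (-1) + C (-1) := by
  have hconn : IsPreconnected ({0, 1} : Set ℂ)ᶜ :=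
    ((Set.toFinite ({0, 1} : Set ℂ)).countable.isPathConnected_compl_of_one_lt_rank
      (by simp)).isConnected.isPreconnected
  have hz2 : (2 : ℂ) ∈ ({0, 1} : Set ℂ)ᶜ := by simp
  -- The function is only given as real analytic; its Laurent series at ∞ makes it holomorphic near
  -- 2, and connectedness of ℂ ∖ {0, 1} does the rest.
  have hhol : ∀ z : ℂ, z ≠ 0 → z ≠ 1 → DifferentiableAt ℂ f z := by
    intro z hz0 hz1
    refine differentiableAt_of_analyticOnNhd_real hf hconn hz2 ?_ (by simp [hz0, hz1])
    have hd : DifferentiableOn ℂ f {z | (3 / 2 : ℝ) < ‖z‖ ∧ ‖z‖ < 3} :=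
      differentiableOn_of_hasSum_zpow (by norm_num)
        (hA _ (by rw [Complex.norm_real]; norm_num)).summable
        (hA _ (by rw [Complex.norm_real]; norm_num)).summable
        fun z h1 _ => hA z (by linarith)
    have hopen : IsOpen {z : ℂ | (3 / 2 : ℝ) < ‖z‖ ∧ ‖z‖ < 3} :=
      (isOpen_lt continuous_const continuous_norm).inter
        (isOpen_lt continuous_norm continuous_const)
    filter_upwards [hopen.mem_nhds (show (2 : ℂ) ∈ _ by norm_num)] with x hx
    exact hd.differentiableAt (hopen.mem_nhds hx)
  -- the principal part at `1`
  let P : ℂ → ℂ := fun z => ∑ k ∈ Finset.range M, B (-(k : ℤ) - 1) * (z - 1) ^ (-(k : ℤ) - 1)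
  have hPd : ∀ z : ℂ, z ≠ 1 → DifferentiableAt ℂ P z := fun z hz =>
    DifferentiableAt.fun_sum fun k _ => ((differentiableAt_id.sub_const (1 : ℂ)).zpow
      (Or.inl (sub_ne_zero.2 hz))).const_mul _
  let Q : ℂ → ℂ := fun w => ∑' n : ℕ, B n * w ^ n
  have hQd : DifferentiableOn ℂ Q (ball 0 (1 / 2)) := by
    have hs : Summable fun n : ℕ => B n * (1 / 2 : ℂ) ^ n := by
      have := (hB (1 / 2) (by norm_num) (by norm_num)).summable.comp_injective Nat.cast_injective
      simpa [Function.comp_def] using this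
    refine differentiableOn_tsum_of_summable_norm hs.norm (fun n => ?_) isOpen_ball fun n w hw => ?_
    · exact ((differentiable_id.pow n).const_mul _).differentiableOn
    · rw [norm_mul, norm_mul, norm_pow, norm_pow]
      have : ‖w‖ ≤ ‖(1 / 2 : ℂ)‖ := by
        have := mem_ball_zero_iff.1 hw
        norm_num at this ⊢; linarith
      gcongr
  have hfPQ : ∀ w : ℂ, w ≠ 0 → ‖w‖ < 1 → f (w + 1) - P (w + 1) = Q w := by
    intro w hw0 hw1
    have hs := hB w hw0 hw1
    have hpos := hs.summable.comp_injective (i := fun n : ℕ => (n : ℤ)) Nat.cast_injective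
    have hneg : HasSum (fun k : ℕ => B (-((k : ℤ) + 1)) * w ^ (-((k : ℤ) + 1))) (P (w + 1)) := by
      have := hasSum_sum_of_ne_finset_zero (L := .unconditional ℕ) (s := Finset.range M)
        (f := fun k : ℕ => B (-((k : ℤ) + 1)) * w ^ (-((k : ℤ) + 1))) (fun k hk => by
          rw [hBM _ (by have := Finset.mem_range.not.1 hk; omega), zero_mul])
      simpa only [P, neg_add', add_sub_cancel_right] using this
    have htot := HasSum.of_nat_of_neg_add_one (f := fun n : ℤ => B n * w ^ n) hpos.hasSum hneg
    have := hs.unique htot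
    rw [this]
    simp [Q]
  -- Because the pole at 1 has finite order, `P` is a finite sum defined on all of ℂ ∖ {1}. Removing
  -- it leaves a singularity at 0 only, so the integrals over the circles of radius 2 and 1/2 agree.
  let g : ℂ → ℂ := Function.update (fun z => f z - P z) 1 (Q 0)
  have hgne : ∀ z, z ≠ 1 → g z = f z - P z := fun z hz => Function.update_of_ne hz _ _
  have hg1 : ∀ w, ‖w‖ < 1 → g (w + 1) = Q w := by
    intro w hw
    by_cases h : w = 0
    · subst h; simp [g]
    · rw [hgne _ (by simpa using h), hfPQ w h hw]
  have hgd : ∀ z : ℂ, z ≠ 0 → DifferentiableAt ℂ g z := by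
    intro z hz
    by_cases h : z = 1
    · subst h
      have hQ : DifferentiableAt ℂ (fun z => Q (z - 1)) 1 := by
        refine DifferentiableAt.comp (𝕜 := ℂ) 1 (g := Q) (f := fun z : ℂ => z - 1) ?_ (by fun_prop)
        exact hQd.differentiableAt (isOpen_ball.mem_nhds (by simp))
      refine hQ.congr_of_eventuallyEq ?_
      filter_upwards [ball_mem_nhds (1 : ℂ) one_pos] with x hx
      have := hg1 (x - 1) (by simpa [dist_eq_norm] using hx)
      simpa using this
    · refine ((hhol z hz h).sub (hPd z h)).congr_of_eventuallyEq ?_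
      filter_upwards [isOpen_ne.mem_nhds h] with x hx using hgne x hx
  have hann : (∮ z in C(0, 2), g z) = ∮ z in C(0, 1 / 2), g z := by
    refine Complex.circleIntegral_eq_of_differentiable_on_annulus_off_countable (by norm_num)
      (by norm_num) Set.countable_empty (fun z hz => ?_) fun z hz => ?_
    · refine (hgd z ?_).continuousAt.continuousWithinAt
      rintro rfl
      exact hz.2 (by simp)
    · refine hgd z ?_
      rintro rfl
      exact hz.1.2 (by simp)
  have hcirc : ∀ R : ℝ, 0 < R → R ≠ 1 →
      (∮ z in C(0, R), g z) = (∮ z in C(0, R), f z) - ∮ z in C(0, R), P z := by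
    intro R hR hR1
    have hne : ∀ z ∈ sphere (0 : ℂ) R, z ≠ 0 ∧ z ≠ 1 := by
      intro z hz
      rw [mem_sphere_zero_iff_norm] at hz
      constructor <;> rintro rfl <;> simp at hz
      · exact hR.ne hz
      · exact hR1 hz.symm
    rw [← circleIntegral.integral_sub]
    · exact circleIntegral.integral_congr hR.le fun z hz => hgne z (hne z hz).2
    · exact ContinuousOn.circleIntegrable hR.le fun z hz =>
        (hhol z (hne z hz).1 (hne z hz).2).continuousAt.continuousWithinAt
    · exact ContinuousOn.circleIntegrable hR.le fun z hz =>
        (hPd z (hne z hz).2).continuousAt.continuousWithinAt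
  have hPint : ∀ R : ℝ, 0 < R → R ≠ 1 → (∮ z in C(0, R), P z) =
      ∑ k ∈ Finset.range M, B (-(k : ℤ) - 1) * ∮ z in C(0, R), (z - 1) ^ (-(k : ℤ) - 1) := by
    intro R hR hR1
    have : ∀ k ∈ Finset.range M, CircleIntegrable
        (fun z : ℂ => B (-(k : ℤ) - 1) * (z - 1) ^ (-(k : ℤ) - 1)) 0 R := by
      intro k _
      refine ContinuousOn.circleIntegrable hR.le fun z hz => ?_
      have hz1 : z ≠ 1 := by
        rintro rfl
        rw [mem_sphere_zero_iff_norm] at hz; simp at hz; exact hR1 hz.symm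
      exact (((differentiableAt_id.sub_const (1 : ℂ)).zpow
        (Or.inl (sub_ne_zero.2 hz1))).const_mul _).continuousAt.continuousWithinAt
    rw [circleIntegral.integral_fun_sum this]
    exact Finset.sum_congr rfl fun k _ => circleIntegral.integral_const_mul _ _ _ _
  -- The pole of `P` lies inside the large circle and outside the small one, so only the large
  -- circle picks up B(-1).
  have hP2 : (∮ z in C(0, 2), P z) = 2 * Real.pi * I * B (-1) := by
    rw [hPint 2 (by norm_num) (by norm_num)]
    rcases M.eq_zero_or_pos with rfl | hM
    · rw [hBM (-1) (by simp)]; simp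
    rw [Finset.sum_eq_single_of_mem 0 (Finset.mem_range.2 hM)]
    · have := circleIntegral.integral_sub_inv_of_mem_ball (c := 0) (w := 1) (R := 2) (by simp)
      simp only [Nat.cast_zero, neg_zero, zero_sub, zpow_neg_one]
      rw [this]; ring
    · intro k _ hk
      rw [circleIntegral.integral_sub_zpow_of_ne (by omega), mul_zero]
  have hPhalf : (∮ z in C(0, 1 / 2), P z) = 0 := by
    refine Complex.circleIntegral_eq_zero_of_differentiable_on_off_countable (by norm_num)
      Set.countable_empty (fun z hz => ?_) fun z hz => ?_
    · refine (hPd z ?_).continuousAt.continuousWithinAt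
      rintro rfl; norm_num at hz
    · refine hPd z ?_
      rintro rfl; norm_num at hz
  have hf2 := circleIntegral_of_hasSum_zpow (f := f) (A := A) (R := 2) (by norm_num)
    fun z hz => hA z (by rw [hz]; norm_num)
  have hfhalf := circleIntegral_of_hasSum_zpow (f := f) (A := C) (R := 1 / 2) (by norm_num)
    fun z hz => hC z (norm_pos_iff.1 (by rw [hz]; norm_num)) (by rw [hz]; norm_num)
  rw [hcirc 2 (by norm_num) (by norm_num), hcirc (1 / 2) (by norm_num) (by norm_num), hP2, hPhalf,
    hf2, hfhalf] at hann
  have hpi : (2 * Real.pi * I : ℂ) ≠ 0 := by simp [Real.pi_ne_zero]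
  refine mul_left_cancel₀ hpi ?_
  linear_combination hann

end FullCFT

end

/-! ### First-order coefficients, monomials and complex conjugation -/

noncomputable section

namespace FullCFT

open Complex Filter Topology Metric

/-- The terms of first order of a convergent series in `z` and its conjugate, from the derivative of
its sum along a ray. -/
theorem first_order_of_hasSum {A : ℕ × ℕ → ℂ} {ζ g' : ℂ} {g : ℝ → ℂ} {δ : ℝ} (hδ : 0 < δ)
    (h : ∀ t : ℝ, 0 < t → t < δ →
      HasSum (fun x : ℕ × ℕ => A x * (t * ζ) ^ x.1 * (starRingEnd ℂ (t * ζ)) ^ x.2) (g t))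
    (hg : HasDerivAt g g' 0) (h0 : g 0 = A 0) :
    g' = A (1, 0) * ζ + A (0, 1) * starRingEnd ℂ ζ := by
  let E : ℕ × ℕ → ℂ := fun x => A x * ζ ^ x.1 * (starRingEnd ℂ ζ) ^ x.2
  have hE : ∀ (t : ℝ) (x : ℕ × ℕ), A x * (t * ζ) ^ x.1 * (starRingEnd ℂ (t * ζ)) ^ x.2 =
      E x * (t : ℂ) ^ (x.1 + x.2) := by
    intro t x
    simp only [E, map_mul, conj_ofReal]
    ring
  -- The terms of the difference quotient. The constant term needs its own case since the truncated
  -- exponent 0 - 1 is 0; at t = 0 exactly the terms of total degree one survive.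
  let Φ : ℝ → ℕ × ℕ → ℂ := fun t x => if x = 0 then 0 else E x * (t : ℂ) ^ (x.1 + x.2 - 1)
  have hpow : ∀ (t : ℝ) (x : ℕ × ℕ), x ≠ 0 → (t : ℂ) * (t : ℂ) ^ (x.1 + x.2 - 1) =
      (t : ℂ) ^ (x.1 + x.2) := by
    intro t x hx
    rw [mul_comm]
    refine pow_sub_one_mul ?_ _
    intro h
    exact hx (Prod.ext (by simp; omega) (by simp; omega))
  have hΦ : ∀ t : ℝ, 0 < t → t < δ → HasSum (Φ t) (t⁻¹ • (g t - g 0)) := by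
    intro t ht htδ
    have h1 := (h t ht htδ).sub (hasSum_ite_eq (0 : ℕ × ℕ) (A 0))
    rw [h0]
    have ht' : (t : ℂ) ≠ 0 := by exact_mod_cast ht.ne'
    refine (h1.const_smul (t⁻¹ : ℝ)).congr_fun ?_
    intro x
    simp only [hE, Φ]
    split_ifs with hx
    · subst hx; simp [E]
    · rw [← hpow t x hx, sub_zero, Complex.real_smul]
      push_cast
      field_simp
  -- The terms grow with t, so their values at δ/2 dominate the limit t → 0.
  have hsum : Summable fun x : ℕ × ℕ => ‖Φ (δ / 2) x‖ :=
    (hΦ (δ / 2) (by linarith) (by linarith)).summable.norm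
  have hlim := tendsto_tsum_of_dominated_convergence (𝓕 := 𝓝[>] (0 : ℝ)) (f := Φ) (g := Φ 0) hsum
    (fun x => by
      have : Continuous fun t : ℝ => Φ t x := by
        by_cases hx : x = 0
        · simp only [Φ, if_pos hx]; fun_prop
        · simp only [Φ, if_neg hx]; fun_prop
      exact (this.tendsto 0).mono_left nhdsWithin_le_nhds)
    (by
      filter_upwards [Ioo_mem_nhdsGT (show (0 : ℝ) < δ / 2 by linarith)] with t ht x
      simp only [Φ]
      split_ifs
      · simp
      · rw [norm_mul (E x), norm_mul (E x), norm_pow _ (x.1 + x.2 - 1),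
          norm_pow _ (x.1 + x.2 - 1), Complex.norm_real, Complex.norm_real,
          Real.norm_of_nonneg ht.1.le, Real.norm_of_nonneg (ht.1.trans ht.2).le]
        exact mul_le_mul_of_nonneg_left (pow_le_pow_left₀ ht.1.le ht.2.le _) (norm_nonneg _))
  have hder : Tendsto (fun t : ℝ => t⁻¹ • (g t - g 0)) (𝓝[>] 0) (𝓝 g') := by
    have := (hasDerivAt_iff_tendsto_slope_zero.1 hg).mono_left
      (nhdsWithin_mono (0 : ℝ) (show Set.Ioi (0 : ℝ) ⊆ {0}ᶜ from fun t ht => ne_of_gt ht))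
    simpa using this
  have heq : (fun t : ℝ => ∑' x, Φ t x) =ᶠ[𝓝[>] 0] fun t : ℝ => t⁻¹ • (g t - g 0) := by
    filter_upwards [Ioo_mem_nhdsGT hδ] with t ht using (hΦ t ht.1 ht.2).tsum_eq
  rw [tendsto_nhds_unique (hder.congr' heq.symm) hlim,
    tsum_eq_sum (s := {(1, 0), (0, 1)}) (fun x hx => ?_), Finset.sum_pair (by simp)]
  · simp [Φ, E]
  · simp only [Φ]
    split_ifs with h
    · rfl
    · have : x.1 + x.2 - 1 ≠ 0 := by
        rcases x with ⟨m, n⟩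
        simp at hx h ⊢
        omega
      simp [this]

/-! ### Monomials -/

theorem monomial_nat (z : ℂ) (m n : ℕ) :
    monomial z m n = z ^ m * (starRingEnd ℂ z) ^ n := by
  have h : starRingEnd ℂ z = ‖z‖ * exp (-(z.arg * I)) := by
    conv_lhs => rw [← norm_mul_exp_arg_mul_I z]
    rw [map_mul, conj_ofReal, ← exp_conj, map_mul, conj_ofReal, conj_I, mul_neg]
  have : (monomial z m n) = ((‖z‖ : ℂ) ^ m * (‖z‖ : ℂ) ^ n) *
      (exp (m * (z.arg * I)) * exp (n * (-(z.arg * I)))) := by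
    rw [monomial, ← exp_add, ← pow_add]
    congr 1
    · rw [← Nat.cast_add, Real.rpow_natCast]; push_cast; rfl
    · congr 1; push_cast; ring
  rw [this, exp_nat_mul, exp_nat_mul, h]
  nth_rw 5 [← norm_mul_exp_arg_mul_I z]
  ring

theorem monomial_int (z : ℂ) (n : ℤ) : monomial z n 0 = z ^ n := by
  conv_rhs => rw [← norm_mul_exp_arg_mul_I z]
  rw [mul_zpow, ← exp_int_mul, monomial, add_zero, Real.rpow_intCast]
  push_cast
  congr 2
  ring

theorem monomial_zero_zero (z : ℂ) : monomial z 0 0 = 1 := by simp [monomial]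

theorem monomial_one (r s : ℝ) : monomial 1 r s = 1 := by simp [monomial]

theorem monomial_eq_exp {z : ℂ} (hz : z ≠ 0) (r s : ℝ) :
    monomial z r s = exp (r * log z + s * starRingEnd ℂ (log z)) := by
  have hpos : 0 < ‖z‖ := norm_pos_iff.2 hz
  rw [monomial, Real.rpow_def_of_pos hpos, ofReal_exp, ← exp_add]
  congr 1
  simp only [log, map_add, map_mul, conj_ofReal, conj_I]
  push_cast
  ring

/-- Conjugation negates the argument, except on the negative real axis where the argument stays π;
there the two phases agree only because r - s is an integer. -/
theorem monomial_conj (z : ℂ) {r s : ℝ} {n : ℤ} (hn : r - s = n) :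
    monomial (starRingEnd ℂ z) r s = monomial z s r := by
  rw [monomial, monomial, Complex.norm_conj, add_comm r s, arg_conj]
  split_ifs with h
  · congr 1
    rw [h, hn, ← neg_sub r s, hn, Complex.exp_eq_exp_iff_exists_int]
    refine ⟨n, ?_⟩
    push_cast
    ring
  · congr 2
    push_cast
    ring

theorem hasDerivAt_monomial_ray (ζ : ℂ) (p q : ℝ) :
    HasDerivAt (fun t : ℝ => monomial (1 + t * ζ) p q) (p * ζ + q * starRingEnd ℂ ζ) 0 := by
  have h1 : HasDerivAt (fun t : ℝ => 1 + (t : ℂ) * ζ) ζ 0 := by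
    have := ((hasDerivAt_id (0 : ℝ)).ofReal_comp.mul_const ζ).const_add 1
    simpa using this
  have h2 : HasDerivAt (fun t : ℝ => log (1 + (t : ℂ) * ζ)) ζ 0 := by
    have := h1.clog_real (by simp)
    simpa using this
  have h3 : HasDerivAt (fun t : ℝ => starRingEnd ℂ (log (1 + (t : ℂ) * ζ)))
      (starRingEnd ℂ ζ) 0 := h2.star
  have h4 := ((h2.const_mul (p : ℂ)).add (h3.const_mul (q : ℂ))).cexp
  simp only [ofReal_zero, zero_mul, add_zero, log_one, map_zero, mul_zero, exp_zero, one_mul,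
    Pi.add_apply] at h4
  refine h4.congr_of_eventuallyEq ?_
  have : ∀ᶠ t : ℝ in 𝓝 0, 1 + (t : ℂ) * ζ ≠ 0 :=
    h1.continuousAt.eventually_ne (by simp)
  filter_upwards [this] with t ht using monomial_eq_exp ht p q

theorem fermion_neg (x : ℝ) : fermion (-x) = fermion x := by
  have : (∃ n : ℤ, -x = n) ↔ ∃ n : ℤ, x = n :=
    ⟨fun ⟨n, hn⟩ => ⟨-n, by push_cast; linarith⟩, fun ⟨n, hn⟩ => ⟨-n, by push_cast; linarith⟩⟩
  unfold fermion
  split_ifs <;> tauto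

namespace FullVertexSuperalgebra

variable {F : Type*} [AddCommGroup F] [Module ℂ F] (V : FullVertexSuperalgebra F)

/-! ### Homogeneous components -/

theorem iSup_wt : ⨆ x : ℝ × ℝ, V.wt x.1 x.2 = ⊤ :=
  ((DirectSum.isInternal_submodule_iff_iSupIndep_and_iSup_eq_top _).1 V.wt_internal).2

theorem iSupIndep_wt : iSupIndep fun x : ℝ × ℝ => V.wt x.1 x.2 :=
  ((DirectSum.isInternal_submodule_iff_iSupIndep_and_iSup_eq_top _).1 V.wt_internal).1

theorem wt_induction {p : F → Prop} (mem : ∀ h hb, ∀ v ∈ V.wt h hb, p v)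
    (add : ∀ v w, p v → p w → p (v + w)) (v : F) : p v :=
  Submodule.iSup_induction (fun x : ℝ × ℝ => V.wt x.1 x.2) (motive := p)
    (by rw [V.iSup_wt]; trivial) (fun x v hv => mem x.1 x.2 v hv)
    (mem 0 0 0 (zero_mem _)) add

/-- The operators that act as a scalar on each homogeneous component. -/
def scaling (ε : ℝ × ℝ → ℂ) : F →ₗ[ℂ] F :=
  DirectSum.toModule ℂ (ℝ × ℝ) F (fun x => ε x • (V.wt x.1 x.2).subtype) ∘ₗ
    (LinearEquiv.ofBijective (DirectSum.coeLinearMap fun x : ℝ × ℝ => V.wt x.1 x.2)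
      V.wt_internal).symm.toLinearMap

theorem scaling_apply (ε : ℝ × ℝ → ℂ) {h hb : ℝ} {v : F} (hv : v ∈ V.wt h hb) :
    V.scaling ε v = ε (h, hb) • v := by
  have : (LinearEquiv.ofBijective (DirectSum.coeLinearMap fun x : ℝ × ℝ => V.wt x.1 x.2)
      V.wt_internal).symm v =
      DirectSum.lof ℂ (ℝ × ℝ) (fun x : ℝ × ℝ => V.wt x.1 x.2) (h, hb) ⟨v, hv⟩ := by
    rw [LinearEquiv.symm_apply_eq]
    exact (DirectSum.coeLinearMap_lof (fun x : ℝ × ℝ => V.wt x.1 x.2) (h, hb) ⟨v, hv⟩).symm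
  simp [scaling, this]

/-- The bootstrap axiom speaks only of functionals supported on one weight space; precomposing any
functional with the projection onto that space gives enough of them. -/
theorem eq_of_forall_dual {h hb : ℝ} {v w : F} (hv : v ∈ V.wt h hb) (hw : w ∈ V.wt h hb)
    (H : ∀ u : F →ₗ[ℂ] ℂ, (∀ h' hb' : ℝ, (h', hb') ≠ (h, hb) → ∀ x ∈ V.wt h' hb', u x = 0) →
      u v = u w) : v = w := by
  rw [← sub_eq_zero, ← Module.forall_dual_apply_eq_zero_iff ℂ]
  intro f
  have := H (f ∘ₗ V.scaling (Pi.single (h, hb) 1)) fun h' hb' hne x hx => by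
    rw [LinearMap.comp_apply, V.scaling_apply _ hx, Pi.single_eq_of_ne hne, zero_smul, map_zero]
  simp only [LinearMap.comp_apply, V.scaling_apply _ hv, V.scaling_apply _ hw, Pi.single_eq_same,
    one_smul] at this
  rw [map_sub, this, sub_self]

/-! ### The conjugate algebra -/

/-- The complex conjugate full vertex superalgebra, in which `z` and `zbar` are exchanged. -/
def swap : FullVertexSuperalgebra F where
  wt h hb := V.wt hb h
  wt_internal := by
    rw [DirectSum.isInternal_submodule_iff_iSupIndep_and_iSup_eq_top]
    refine ⟨V.iSupIndep_wt.comp (f := Prod.swap) Prod.swap_injective, ?_⟩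
    rw [← V.iSup_wt]
    exact (Equiv.prodComm ℝ ℝ).iSup_comp (g := fun x : ℝ × ℝ => V.wt x.1 x.2)
  wt_spin h hb hn := V.wt_spin hb h fun n hn' => hn (-n) (by push_cast; linarith)
  wt_finite H := by
    suffices heq : (⨆ x : {x : ℝ × ℝ // x.1 + x.2 < H}, V.wt x.1.2 x.1.1) =
        ⨆ x : {x : ℝ × ℝ // x.1 + x.2 < H}, V.wt x.1.1 x.1.2 by
      rw [heq]; exact V.wt_finite H
    refine le_antisymm (iSup_le fun x => ?_) (iSup_le fun x => ?_)
    · exact le_iSup (fun x : {x : ℝ × ℝ // x.1 + x.2 < H} => V.wt x.1.1 x.1.2)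
        ⟨(x.1.2, x.1.1), by have := x.2; simp only; linarith⟩
    · exact le_iSup (fun x : {x : ℝ × ℝ // x.1 + x.2 < H} => V.wt x.1.2 x.1.1)
        ⟨(x.1.2, x.1.1), by have := x.2; simp only; linarith⟩
  wt_bounded := by
    obtain ⟨N, hN⟩ := V.wt_bounded
    exact ⟨N, fun h hb hh => hN hb h fun h' => hh ⟨h'.2, h'.1⟩⟩
  Y r s := V.Y s r
  Y_even r s hn := V.Y_even s r fun n hn' => hn (-n) (by push_cast; linarith)
  Y_wt h hb h' hb' r s a b ha hb2 := V.Y_wt hb h hb' h' s r a b ha hb2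
  one := V.one
  one_wt := V.one_wt
  creation a r s hn := V.creation a s r fun ⟨m, n, h1, h2⟩ => hn ⟨n, m, h2, h1⟩
  creation_eq := V.creation_eq
  one_Y := V.one_Y
  one_Y_ne r s h := V.one_Y_ne s r fun h' => h (by
    simp only [Prod.mk.injEq] at h' ⊢; exact ⟨h'.2, h'.1⟩)
  bootstrap h₀ hb₀ h₁ hb₁ h₂ hb₂ h₃ hb₃ a b c u ha hb hc hu := by
    obtain ⟨μ, hμ, H1, H2, H3⟩ := V.bootstrap hb₀ h₀ hb₁ h₁ hb₂ h₂ hb₃ h₃ a b c u ha hb hc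
      (fun h hb hne => hu hb h fun h' => hne (by
        simp only [Prod.mk.injEq] at h' ⊢; exact ⟨h'.2, h'.1⟩))
    let e : (ℝ × ℝ) × (ℝ × ℝ) ≃ (ℝ × ℝ) × (ℝ × ℝ) :=
      (Equiv.prodComm ℝ ℝ).prodCongr (Equiv.prodComm ℝ ℝ)
    -- `monomial_conj` needs integral spin; in each of the three series the other terms vanish by
    -- `Y_even`.
    have hmon : ∀ (z : ℂ) (r s : ℝ) (n : ℤ), r - s = n →
        monomial (starRingEnd ℂ z) (-r - 1) (-s - 1) = monomial z (-s - 1) (-r - 1) :=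
      fun z r s n hn => monomial_conj z (n := -n) (by push_cast; linarith)
    have hY0 : ∀ r s : ℝ, ¬ (∃ n : ℤ, r - s = n) → V.Y r s = 0 := fun r s hn =>
      V.Y_even r s fun n hn' => hn ⟨n, hn'⟩
    -- Only real analyticity is required of the correlation function, and that survives conjugating
    -- both variables.
    refine ⟨fun x => μ (starRingEnd ℂ x.1, starRingEnd ℂ x.2), ?_, ?_, ?_, ?_⟩
    · intro x hx
      have hlin : AnalyticAt ℝ
          (fun x : ℂ × ℂ => ((starRingEnd ℂ x.1, starRingEnd ℂ x.2) : ℂ × ℂ)) x :=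
        ((conjCLE.toContinuousLinearMap.analyticAt _).comp analyticAt_fst).prod
          ((conjCLE.toContinuousLinearMap.analyticAt _).comp analyticAt_snd)
      refine (hμ _ ?_).comp hlin
      obtain ⟨h1, h2, h3⟩ := hx
      exact ⟨fun h => h1 ((starRingEnd ℂ).injective h), by simpa using h2, by simpa using h3⟩
    · intro z₁ z₂ hz hlt
      have := H1 (starRingEnd ℂ z₁) (starRingEnd ℂ z₂) (by simpa using hz) (by simpa using hlt)
      rw [← e.hasSum_iff] at this
      refine this.congr_fun fun x => ?_
      rcases x with ⟨⟨r, s⟩, r', s'⟩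
      simp only [e, Function.comp_apply, Equiv.prodCongr_apply, Prod.map, Equiv.prodComm_apply,
        Prod.swap]
      by_cases h1 : ∃ n : ℤ, s - r = n
      · by_cases h2 : ∃ n : ℤ, s' - r' = n
        · obtain ⟨n, hn⟩ := h1
          obtain ⟨n', hn'⟩ := h2
          rw [hmon _ _ _ n hn, hmon _ _ _ n' hn']
        · simp [hY0 s' r' h2]
      · simp [hY0 s r h1]
    · intro z₁ z₂ hz hlt
      have := H2 (starRingEnd ℂ z₁) (starRingEnd ℂ z₂) (by simpa using hz) (by simpa using hlt)
      rw [← e.hasSum_iff, ← map_add] at this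
      refine this.congr_fun fun x => ?_
      rcases x with ⟨⟨r, s⟩, r', s'⟩
      simp only [e, Function.comp_apply, Equiv.prodCongr_apply, Prod.map, Equiv.prodComm_apply,
        Prod.swap]
      by_cases h1 : ∃ n : ℤ, s - r = n
      · by_cases h2 : ∃ n : ℤ, s' - r' = n
        · obtain ⟨n, hn⟩ := h1
          obtain ⟨n', hn'⟩ := h2
          rw [hmon _ _ _ n hn, hmon _ _ _ n' hn']
        · simp [hY0 s' r' h2]
      · simp [hY0 s r h1]
    · intro z₁ z₂ hz hlt
      have := H3 (starRingEnd ℂ z₁) (starRingEnd ℂ z₂) (by simpa using hz) (by simpa using hlt)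
      rw [← e.hasSum_iff] at this
      refine this.congr_fun fun x => ?_
      rcases x with ⟨⟨r, s⟩, r', s'⟩
      simp only [e, Function.comp_apply, Equiv.prodCongr_apply, Prod.map, Equiv.prodComm_apply,
        Prod.swap]
      rw [← fermion_neg (h₁ - hb₁), ← fermion_neg (h₂ - hb₂), neg_sub, neg_sub]
      by_cases h1 : ∃ n : ℤ, s - r = n
      · by_cases h2 : ∃ n : ℤ, s' - r' = n
        · obtain ⟨n, hn⟩ := h1
          obtain ⟨n', hn'⟩ := h2
          rw [hmon _ _ _ n hn, hmon _ _ _ n' hn']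
        · simp [hY0 s' r' h2]
      · simp [hY0 s r h1]

end FullVertexSuperalgebra

end FullCFT

end

/-! ### Translation covariance and the residue formula for zero modes -/

noncomputable section

namespace FullCFT

open Complex Filter Topology Metric

namespace FullVertexSuperalgebra

variable {F : Type*} [AddCommGroup F] [Module ℂ F] (V : FullVertexSuperalgebra F)

theorem Y_mem {h hb h' hb' r s k kb : ℝ} {a b : F} (ha : a ∈ V.wt h hb) (hb2 : b ∈ V.wt h' hb')
    (h1 : h + h' - r - 1 = k) (h2 : hb + hb' - s - 1 = kb) : V.Y r s a b ∈ V.wt k kb := by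
  subst h1 h2
  exact V.Y_wt _ _ _ _ _ _ _ _ ha hb2

theorem Y_eq_zero_of_not_int {r s : ℝ} (h : ¬ ∃ n : ℤ, r - s = n) : V.Y r s = 0 :=
  V.Y_even r s fun n hn => h ⟨n, hn⟩

/-! ### Translation covariance -/

theorem D_mem {h hb : ℝ} {a : F} (ha : a ∈ V.wt h hb) : V.D a ∈ V.wt (h + 1) hb :=
  V.Y_mem ha V.one_wt (by ring) (by ring)

/-- Insert the vacuum as the second field, at the point 1. For |z| > 1 the correlator is then a
single monomial in z, while the associativity expansion around 1 is a power series in z - 1 and its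
conjugate whose first-order coefficients contain Da and its conjugate analogue. Comparing first
derivatives at 1 gives the claim. -/
theorem Y_D_of_mem {h hb h' hb' : ℝ} {a c : F} (ha : a ∈ V.wt h hb) (hc : c ∈ V.wt h' hb')
    (r s : ℝ) : V.Y (r + 1) s (V.D a) c = (-(r : ℂ) - 1) • V.Y r s a c := by
  refine V.eq_of_forall_dual (V.Y_mem (V.D_mem ha) hc (k := h + h' - r - 1)
    (kb := hb + hb' - s - 1) (by ring) rfl) (Submodule.smul_mem _ _ (V.Y_mem ha hc rfl rfl))
    fun u hu => ?_
  obtain ⟨μ, -, H1, H2, -⟩ := V.bootstrap _ _ _ _ _ _ _ _ a V.one c u ha V.one_wt hc hu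
  set B : ℂ := u (V.Y r s a c) with hB
  let A : ℕ × ℕ → ℂ := fun x =>
    u (V.Y (r + x.1) (s + x.2) (V.Y (-x.1 - 1) (-x.2 - 1) a V.one) c)
  have hleft : ∀ z : ℂ, 1 < ‖z‖ → μ (z, 1) = B * monomial z (-r - 1) (-s - 1) := by
    intro z hz
    refine (H1 z 1 one_ne_zero (by simpa using hz)).unique ?_
    have := hasSum_single (L := .unconditional _)
      (f := fun x : (ℝ × ℝ) × (ℝ × ℝ) => u (V.Y x.1.1 x.1.2 a (V.Y x.2.1 x.2.2 V.one c)) *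
        monomial z (-x.1.1 - 1) (-x.1.2 - 1) * monomial 1 (-x.2.1 - 1) (-x.2.2 - 1))
      ((r, s), (-1, -1)) (fun x hx => ?_)
    · simpa [V.one_Y, monomial_one, hB] using this
    · rcases x with ⟨⟨r₁, s₁⟩, r₂, s₂⟩
      by_cases h2 : (r₂, s₂) = (-1, -1)
      · obtain ⟨rfl, rfl⟩ := Prod.mk.inj h2
        have hu0 := hu (h + h' - r₁ - 1) (hb + hb' - s₁ - 1) (fun hh => hx ?_) _
          (V.Y_mem ha hc rfl rfl)
        · simp [V.one_Y, hu0]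
        · obtain ⟨e1, e2⟩ := Prod.mk.inj hh
          rw [show r₁ = r by linarith, show s₁ = s by linarith]
      · simp [V.one_Y_ne _ _ h2]
  have hright : ∀ z : ℂ, z ≠ 0 → ‖z‖ < 1 →
      HasSum (fun x : ℕ × ℕ => A x * z ^ x.1 * (starRingEnd ℂ z) ^ x.2) (μ (z + 1, 1)) := by
    intro z hz hz1
    have H := H2 z 1 hz (by simpa using hz1)
    let e : ℕ × ℕ → (ℝ × ℝ) × (ℝ × ℝ) := fun x =>
      ((-(x.1 : ℝ) - 1, -(x.2 : ℝ) - 1), (r + x.1, s + x.2))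
    have he : Function.Injective e := by
      intro x y hxy
      simp only [e, Prod.mk.injEq] at hxy
      exact Prod.ext (by have := hxy.1.1; exact_mod_cast (by linarith : (x.1 : ℝ) = y.1))
        (by have := hxy.1.2; exact_mod_cast (by linarith : (x.2 : ℝ) = y.2))
    rw [← he.hasSum_iff] at H
    · refine H.congr_fun fun x => ?_
      have hm := monomial_nat z x.1 x.2
      simp only [e, Function.comp_apply, monomial_one, mul_one, A, mul_assoc]
      rw [← hm]
      congr 2 <;> ring
    · rintro ⟨⟨r₁, s₁⟩, r₂, s₂⟩ hx
      by_cases h1 : ∃ m n : ℕ, r₁ = -(m : ℝ) - 1 ∧ s₁ = -(n : ℝ) - 1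
      · obtain ⟨m, n, rfl, rfl⟩ := h1
        have hu0 := hu (h + m + h' - r₂ - 1) (hb + n + hb' - s₂ - 1) (fun hh => hx ⟨(m, n), ?_⟩) _
          (V.Y_mem (V.Y_mem (r := -(m : ℝ) - 1) (s := -(n : ℝ) - 1) ha V.one_wt
            (by ring) (by ring)) hc rfl rfl)
        · simp [hu0]
        · obtain ⟨e1, e2⟩ := Prod.mk.inj hh
          simp only [e, Prod.mk.injEq, true_and]
          exact ⟨by linarith, by linarith⟩
      · simp [V.creation a r₁ s₁ h1]
  -- Rays from 1 with Re ζ > 0 stay in |z| > 1, where the monomial expression is valid; ‖ζ‖ ≤ 2 and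
  -- t < 1/2 keep |tζ| < 1 for the other expansion.
  have key : ∀ ζ : ℂ, 0 < ζ.re → ‖ζ‖ ≤ 2 → B * ((-(r : ℂ) - 1) * ζ +
      (-(s : ℂ) - 1) * starRingEnd ℂ ζ) = A (1, 0) * ζ + A (0, 1) * starRingEnd ℂ ζ := by
    intro ζ hre hnorm
    have hζ : ζ ≠ 0 := by rintro rfl; simp at hre
    refine first_order_of_hasSum (A := A) (δ := 1 / 2)
      (g := fun t : ℝ => B * monomial (1 + t * ζ) (-r - 1) (-s - 1)) (by norm_num) ?_ ?_ ?_
    · intro t ht ht2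
      have hn : ‖(t : ℂ) * ζ‖ < 1 := by
        rw [norm_mul, Complex.norm_real, Real.norm_of_nonneg ht.le]
        nlinarith [norm_nonneg ζ]
      have hgt : 1 < ‖1 + (t : ℂ) * ζ‖ := by
        refine lt_of_lt_of_le ?_ (Complex.re_le_norm _)
        simp
        positivity
      have := hright (t * ζ) (mul_ne_zero (by exact_mod_cast ht.ne') hζ) hn
      rwa [add_comm, hleft _ hgt] at this
    · have := (hasDerivAt_monomial_ray ζ (-r - 1) (-s - 1)).const_mul B
      push_cast at this
      exact this
    · simp [A, B, monomial_one, V.creation_eq]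
  have k1 := key 1 (by simp) (by simp)
  have k2 := key (1 + I) (by simp) ((norm_add_le _ _).trans (by norm_num))
  simp only [map_one, map_add, conj_I, mul_one] at k1 k2
  have hA : A (1, 0) = B * (-(r : ℂ) - 1) := by
    have h2I : (2 * I : ℂ) ≠ 0 := by simp
    refine mul_left_cancel₀ h2I ?_
    -- The directions 1 and 1 + I separate ζ from its conjugate; this combination eliminates the
    -- coefficient of the conjugate.
    linear_combination (1 - I) * k1 - k2
  have hA' : u (V.Y (r + 1) s (V.D a) c) = A (1, 0) := by
    simp only [A, D, LinearMap.flip_apply]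
    norm_num
  rw [hA', hA, map_smul, smul_eq_mul, mul_comm]

/-- Translation covariance: `(Da)(r,s) = -r a(r-1,s)`. -/
theorem Y_D (r s : ℝ) (a c : F) : V.Y (r + 1) s (V.D a) c = (-(r : ℂ) - 1) • V.Y r s a c := by
  induction a using V.wt_induction with
  | add a b ha hb => simp [ha, hb]
  | mem h hb a ha =>
    induction c using V.wt_induction with
    | add a b ha hb => simp [ha, hb]
    | mem h' hb' c hc => exact V.Y_D_of_mem ha hc r s

theorem Y_Dbar (r s : ℝ) (a c : F) :
    V.Y r (s + 1) (V.Dbar a) c = (-(s : ℂ) - 1) • V.Y r s a c :=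
  V.swap.Y_D s r a c

/-- Covariance multiplies a(r,s) by -s - 1 and yields zero, so a field killed by `Dbar` has no
dependence on the conjugate variable. -/
theorem Y_eq_zero_of_Dbar {a : F} (ha : V.Dbar a = 0) {r s : ℝ} (hs : s ≠ -1) : V.Y r s a = 0 := by
  ext c
  have := V.Y_Dbar r s a c
  rw [ha, map_zero, LinearMap.zero_apply] at this
  refine (smul_eq_zero.1 this.symm).resolve_left fun h => hs ?_
  have : (-(s : ℂ) - 1) = ((-s - 1 : ℝ) : ℂ) := by push_cast; rfl
  rw [this] at h
  have := ofReal_eq_zero.1 h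
  linarith

/-! ### Commutators with zero modes of holomorphic fields -/

/-- Fix the second point at 1. Since `a` is holomorphic, the three convergent expansions of the
correlator are Laurent series in z at ∞, in z - 1 at 1 and in z at 0. The coefficients of exponent
-1 are the three terms of the formula, and `residue_relation` links them. -/
theorem Y_zero_mode_of_mem {h hb h₂ hb₂ h₃ hb₃ : ℝ} {a b c : F} (ha : a ∈ V.wt h hb)
    (hb2 : b ∈ V.wt h₂ hb₂) (hc : c ∈ V.wt h₃ hb₃) (hol : V.Dbar a = 0) (r s : ℝ) :
    V.Y 0 (-1) a (V.Y r s b c) = V.Y r s (V.Y 0 (-1) a b) c +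
      (-1 : ℂ) ^ (fermion (h - hb) * fermion (h₂ - hb₂)) • V.Y r s b (V.Y 0 (-1) a c) := by
  refine V.eq_of_forall_dual (h := h + h₂ + h₃ - r - 2) (hb := hb + hb₂ + hb₃ - s - 1)
    (V.Y_mem ha (V.Y_mem hb2 hc rfl rfl) (by ring) (by ring))
    (add_mem (V.Y_mem (V.Y_mem ha hb2 rfl rfl) hc (by ring) (by ring))
      (Submodule.smul_mem _ _ (V.Y_mem hb2 (V.Y_mem ha hc rfl rfl) (by ring) (by ring))))
    fun u hu => ?_
  obtain ⟨μ, hμ, H1, H2, H3⟩ := V.bootstrap _ _ _ _ _ _ _ _ a b c u ha hb2 hc hu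
  -- The coefficient of z^n uses the mode -n-1 of `a`; as `u` fixes the total weight, the mode of
  -- `b` must make the sum equal to r. The index n = -1 gives the modes 0 and r.
  let e : ℤ → (ℝ × ℝ) × (ℝ × ℝ) := fun n => ((-(n : ℝ) - 1, -1), (r + n + 1, s))
  have he : Function.Injective e := by
    intro m n hmn
    simp only [e, Prod.mk.injEq] at hmn
    exact_mod_cast (by linarith [hmn.1.1] : (m : ℝ) = n)
  have hrange : ∀ r₁ s₁ r₂ s₂ : ℝ, ((r₁, s₁), (r₂, s₂)) ∉ Set.range e →
      V.Y r₁ s₁ a = 0 ∨ (r₁ + r₂ ≠ r ∨ s₂ ≠ s) ∧ s₁ = -1 := by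
    intro r₁ s₁ r₂ s₂ hx
    by_cases hs : s₁ = -1
    · by_cases hn : ∃ n : ℤ, r₁ - s₁ = n
      · right
        refine ⟨?_, hs⟩
        by_contra! hcon
        obtain ⟨n, hn⟩ := hn
        refine hx ⟨-n, ?_⟩
        simp only [e, Prod.mk.injEq]
        push_cast
        exact ⟨⟨by linarith, hs.symm⟩, by linarith [hcon.1], hcon.2.symm⟩
      · left; rw [V.Y_eq_zero_of_not_int hn, LinearMap.zero_apply]
    · left; exact V.Y_eq_zero_of_Dbar hol hs
  have hmon : ∀ (z : ℂ) (n : ℤ), monomial z (-(-(n : ℝ) - 1) - 1) (-(-1) - 1) = z ^ n := by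
    intro z n
    rw [← monomial_int]
    congr 1 <;> ring
  have hA : ∀ z : ℂ, 1 < ‖z‖ → HasSum (fun n : ℤ =>
      u (V.Y (-(n : ℝ) - 1) (-1) a (V.Y (r + n + 1) s b c)) * z ^ n) (μ (z, 1)) := by
    intro z hz
    have H := H1 z 1 one_ne_zero (by simpa using hz)
    rw [← he.hasSum_iff] at H
    · refine H.congr_fun fun n => ?_
      simp only [e, Function.comp_apply, monomial_one, mul_one, hmon]
    · rintro ⟨⟨r₁, s₁⟩, r₂, s₂⟩ hx
      rcases hrange _ _ _ _ hx with h0 | ⟨hne, rfl⟩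
      · simp [h0]
      · have hu0 := hu (h + (h₂ + h₃ - r₂ - 1) - r₁ - 1) (hb + (hb₂ + hb₃ - s₂ - 1) - -1 - 1)
          (fun hh => ?_) _ (V.Y_mem ha (V.Y_mem hb2 hc rfl rfl) rfl rfl)
        · simp [hu0]
        · obtain ⟨e1, e2⟩ := Prod.mk.inj hh
          rcases hne with hne | hne <;> apply hne <;> linarith
  have hB : ∀ z : ℂ, z ≠ 0 → ‖z‖ < 1 → HasSum (fun n : ℤ =>
      u (V.Y (r + n + 1) s (V.Y (-(n : ℝ) - 1) (-1) a b) c) * z ^ n) (μ (z + 1, 1)) := by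
    intro z hz0 hz
    have H := H2 z 1 hz0 (by simpa using hz)
    rw [← he.hasSum_iff] at H
    · refine H.congr_fun fun n => ?_
      simp only [e, Function.comp_apply, monomial_one, mul_one, hmon]
    · rintro ⟨⟨r₁, s₁⟩, r₂, s₂⟩ hx
      rcases hrange _ _ _ _ hx with h0 | ⟨hne, rfl⟩
      · simp [h0]
      · have hu0 := hu ((h + h₂ - r₁ - 1) + h₃ - r₂ - 1) ((hb + hb₂ - -1 - 1) + hb₃ - s₂ - 1)
          (fun hh => ?_) _ (V.Y_mem (V.Y_mem ha hb2 rfl rfl) hc rfl rfl)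
        · simp [hu0]
        · obtain ⟨e1, e2⟩ := Prod.mk.inj hh
          rcases hne with hne | hne <;> apply hne <;> linarith
  have hC : ∀ z : ℂ, z ≠ 0 → ‖z‖ < 1 → HasSum (fun n : ℤ =>
      (-1 : ℂ) ^ (fermion (h - hb) * fermion (h₂ - hb₂)) *
        u (V.Y (r + n + 1) s b (V.Y (-(n : ℝ) - 1) (-1) a c)) * z ^ n) (μ (z, 1)) := by
    intro z hz0 hz
    have H := H3 z 1 hz0 (by simpa using hz)
    rw [← he.hasSum_iff] at H
    · refine H.congr_fun fun n => ?_
      simp only [e, Function.comp_apply, monomial_one, mul_one, hmon, mul_assoc]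
    · rintro ⟨⟨r₁, s₁⟩, r₂, s₂⟩ hx
      rcases hrange _ _ _ _ hx with h0 | ⟨hne, rfl⟩
      · simp [h0]
      · have hu0 := hu (h₂ + (h + h₃ - r₁ - 1) - r₂ - 1) (hb₂ + (hb + hb₃ - -1 - 1) - s₂ - 1)
          (fun hh => ?_) _ (V.Y_mem hb2 (V.Y_mem ha hc rfl rfl) rfl rfl)
        · simp [hu0]
        · obtain ⟨e1, e2⟩ := Prod.mk.inj hh
          rcases hne with hne | hne <;> apply hne <;> linarith
  have han : AnalyticOnNhd ℝ (fun z => μ (z, 1)) ({0, 1} : Set ℂ)ᶜ := by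
    intro z hz
    have hz' : z ≠ 0 ∧ z ≠ 1 := by simpa using hz
    exact AnalyticAt.comp (f := fun z : ℂ => (z, (1 : ℂ))) (hμ (z, 1) ⟨hz'.2, hz'.1, one_ne_zero⟩)
      (analyticAt_id.prod analyticAt_const)
  obtain ⟨N, hN⟩ := V.wt_bounded
  -- The order of the pole at 1 is finite because a(-n-1,-1)b has weight h + h₂ + n and weights are
  -- bounded below.
  obtain ⟨M, hM⟩ := exists_nat_gt (h + h₂ - N)
  have := residue_relation han hA hB hC (M := M) fun n hn => by
    have hn' : (n : ℝ) + 1 ≤ -(M : ℝ) := by exact_mod_cast hn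
    have h0 : V.Y (-(n : ℝ) - 1) (-1) a b ∈ V.wt (h + h₂ + n) (hb + hb₂) :=
      V.Y_mem ha hb2 (by ring) (by ring)
    rw [hN (h + h₂ + n) _ fun hh => by linarith [hh.1], Submodule.mem_bot] at h0
    simp [h0]
  simp only [Int.cast_neg, Int.cast_one, neg_neg, sub_self, neg_add_cancel_right] at this
  simp only [map_add, map_smul, smul_eq_mul]
  exact this

theorem Y_zero_mode {h hb h₂ hb₂ : ℝ} {a b : F} (ha : a ∈ V.wt h hb)
    (hb2 : b ∈ V.wt h₂ hb₂) (hol : V.Dbar a = 0) (r s : ℝ) (c : F) :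
    V.Y 0 (-1) a (V.Y r s b c) = V.Y r s (V.Y 0 (-1) a b) c +
      (-1 : ℂ) ^ (fermion (h - hb) * fermion (h₂ - hb₂)) • V.Y r s b (V.Y 0 (-1) a c) := by
  induction c using V.wt_induction with
  | add c d hc hd => rw [map_add, map_add, hc, hd]; simp only [map_add, smul_add]; abel
  | mem h' hb' c hc => exact V.Y_zero_mode_of_mem ha hb2 hc hol r s

end FullVertexSuperalgebra

end FullCFT

end

/-! ### Signs, derivations and products of cocycles -/

noncomputable section

namespace FullCFT

theorem neg_one_pow_fermion (n : ℤ) : (-1 : ℂ) ^ fermion ((n : ℝ) / 2) = (-1) ^ n := by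
  rcases Int.even_or_odd' n with ⟨k, rfl | rfl⟩
  · have : ∃ m : ℤ, (((2 * k : ℤ) : ℝ) / 2) = m := ⟨k, by push_cast; ring⟩
    rw [fermion, if_pos this, pow_zero, zpow_mul]
    norm_num
  · have : ¬ ∃ m : ℤ, (((2 * k + 1 : ℤ) : ℝ) / 2) = m := by
      rintro ⟨m, hm⟩
      have : (((2 * k + 1 : ℤ)) : ℝ) = ((2 * m : ℤ) : ℝ) := by push_cast at hm ⊢; linarith
      have := Int.cast_injective this
      omega
    rw [fermion, if_neg this, pow_one, zpow_add₀ (by norm_num), zpow_mul]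
    norm_num

namespace FullVertexSuperalgebra

variable {F : Type*} [AddCommGroup F] [Module ℂ F] (V : FullVertexSuperalgebra F)

/-! ### The sign operator -/

/-- The sign operator `(-1)^F`. -/
def sgn : F →ₗ[ℂ] F := V.scaling fun x => (-1) ^ fermion (x.1 - x.2)

theorem sgn_apply {h hb : ℝ} {v : F} (hv : v ∈ V.wt h hb) :
    V.sgn v = (-1 : ℂ) ^ fermion (h - hb) • v := V.scaling_apply _ hv

theorem spin_of_ne_zero {h hb : ℝ} {v : F} (hv : v ∈ V.wt h hb) (h0 : v ≠ 0) :
    ∃ n : ℤ, h - hb = (n : ℝ) / 2 := by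
  by_contra! hn
  rw [V.wt_spin h hb hn, Submodule.mem_bot] at hv
  exact h0 hv

theorem sgn_sgn (v : F) : V.sgn (V.sgn v) = v := by
  induction v using V.wt_induction with
  | add v w hv hw => simp [hv, hw]
  | mem h hb v hv =>
    rw [V.sgn_apply hv, map_smul, V.sgn_apply hv, smul_smul, ← mul_pow]
    norm_num

/-- The spin of a(r,s)b is the sum of the two spins up to the integer r - s, and (-1)^(2·spin) is
multiplicative and blind to integer shifts. -/
theorem sgn_Y (r s : ℝ) (a b : F) : V.sgn (V.Y r s a b) = V.Y r s (V.sgn a) (V.sgn b) := by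
  induction a using V.wt_induction with
  | add v w hv hw => simp [hv, hw]
  | mem h hb a ha =>
    induction b using V.wt_induction with
    | add v w hv hw => simp [hv, hw]
    | mem h' hb' b hb2 =>
      by_cases hn : ∃ n : ℤ, r - s = n
      · by_cases ha0 : a = 0
        · simp [ha0]
        · by_cases hb0 : b = 0
          · simp [hb0]
          · obtain ⟨n, hn⟩ := hn
            obtain ⟨k, hk⟩ := V.spin_of_ne_zero ha ha0
            obtain ⟨l, hl⟩ := V.spin_of_ne_zero hb2 hb0
            have e : h + h' - r - 1 - (hb + hb' - s - 1) = ((k + l + 2 * (-n) : ℤ) : ℝ) / 2 := by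
              push_cast; linarith
            rw [V.sgn_apply (V.Y_wt _ _ _ _ r s _ _ ha hb2), V.sgn_apply ha, V.sgn_apply hb2, e,
              hk, hl, neg_one_pow_fermion, neg_one_pow_fermion, neg_one_pow_fermion,
              zpow_add₀ (by norm_num), zpow_add₀ (by norm_num), zpow_mul]
            simp [smul_smul, mul_comm]
      · simp [V.Y_eq_zero_of_not_int hn]

/-- Zero modes of even holomorphic fields are derivations. -/
theorem Y_zero_mode_even {h hb : ℝ} {a : F} (ha : a ∈ V.wt h hb) (hf : fermion (h - hb) = 0)
    (hol : V.Dbar a = 0) (r s : ℝ) (b c : F) :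
    V.Y 0 (-1) a (V.Y r s b c) = V.Y r s (V.Y 0 (-1) a b) c + V.Y r s b (V.Y 0 (-1) a c) := by
  induction b using V.wt_induction with
  | add v w hv hw => simp only [map_add, LinearMap.add_apply, hv, hw]; abel
  | mem h hb b hb2 => rw [V.Y_zero_mode ha hb2 hol, hf, zero_mul, pow_zero, one_smul]

/-- Zero modes of odd holomorphic fields are odd derivations. -/
theorem Y_zero_mode_odd {h hb : ℝ} {a : F} (ha : a ∈ V.wt h hb) (hf : fermion (h - hb) = 1)
    (hol : V.Dbar a = 0) (r s : ℝ) (b c : F) :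
    V.Y 0 (-1) a (V.Y r s b c) =
      V.Y r s (V.Y 0 (-1) a b) c + V.Y r s (V.sgn b) (V.Y 0 (-1) a c) := by
  induction b using V.wt_induction with
  | add v w hv hw => simp only [map_add, LinearMap.add_apply, hv, hw]; abel
  | mem h hb b hb2 =>
    rw [V.Y_zero_mode ha hb2 hol, hf, one_mul, V.sgn_apply hb2, map_smul, LinearMap.smul_apply]

theorem swap_sgn : V.swap.sgn = V.sgn := by
  ext v
  induction v using V.wt_induction with
  | add v w hv hw => simp [hv, hw]
  | mem h hb v hv =>
    rw [V.sgn_apply hv, V.swap.sgn_apply (h := hb) (hb := h) hv, ← fermion_neg, neg_sub]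

theorem Y_zero_mode_bar_even {h hb : ℝ} {a : F} (ha : a ∈ V.wt h hb) (hf : fermion (h - hb) = 0)
    (hol : V.D a = 0) (r s : ℝ) (b c : F) :
    V.Y (-1) 0 a (V.Y r s b c) = V.Y r s (V.Y (-1) 0 a b) c + V.Y r s b (V.Y (-1) 0 a c) :=
  V.swap.Y_zero_mode_even (h := hb) (hb := h) ha (by rwa [← fermion_neg, neg_sub]) hol s r b c

theorem Y_zero_mode_bar_odd {h hb : ℝ} {a : F} (ha : a ∈ V.wt h hb) (hf : fermion (h - hb) = 1)
    (hol : V.D a = 0) (r s : ℝ) (b c : F) :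
    V.Y (-1) 0 a (V.Y r s b c) =
      V.Y r s (V.Y (-1) 0 a b) c + V.Y r s (V.sgn b) (V.Y (-1) 0 a c) := by
  rw [← V.swap_sgn]
  exact V.swap.Y_zero_mode_odd (h := hb) (hb := h) ha (by rwa [← fermion_neg, neg_sub]) hol s r b c

/-- Correlation functions of fields whose modes other than `(-1,-1)` do not contribute give an
associative and supercommutative product. -/
theorem product_relations {h₀ hb₀ h₁ hb₁ h₂ hb₂ h₃ hb₃ : ℝ} {a b c : F} {u : F →ₗ[ℂ] ℂ}
    (ha : a ∈ V.wt h₁ hb₁) (hb : b ∈ V.wt h₂ hb₂) (hc : c ∈ V.wt h₃ hb₃)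
    (hu : ∀ h hb : ℝ, (h, hb) ≠ (h₀, hb₀) → ∀ v ∈ V.wt h hb, u v = 0)
    (H : ∀ r s r' s' : ℝ, ((r, s), (r', s')) ≠ ((-1, -1), (-1, -1)) →
      u (V.Y r s a (V.Y r' s' b c)) = 0 ∧ u (V.Y r' s' (V.Y r s a b) c) = 0 ∧
        u (V.Y r' s' b (V.Y r s a c)) = 0) :
    u (V.Y (-1) (-1) a (V.Y (-1) (-1) b c)) = u (V.Y (-1) (-1) (V.Y (-1) (-1) a b) c) ∧
    u (V.Y (-1) (-1) a (V.Y (-1) (-1) b c)) =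
      (-1 : ℂ) ^ (fermion (h₁ - hb₁) * fermion (h₂ - hb₂)) *
        u (V.Y (-1) (-1) b (V.Y (-1) (-1) a c)) := by
  obtain ⟨μ, -, H1, H2, H3⟩ := V.bootstrap _ _ _ _ _ _ _ _ a b c u ha hb hc hu
  have hsingle : ∀ {f : (ℝ × ℝ) × (ℝ × ℝ) → ℂ} {m : ℂ}, HasSum f m →
      (∀ x, x ≠ ((-1, -1), (-1, -1)) → f x = 0) → m = f ((-1, -1), (-1, -1)) :=
    fun hf h0 => hf.unique (hasSum_single _ h0)
  -- Only the term with both modes (-1,-1) survives and its monomials are 1, so the correlator is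
  -- constant on each of the three regions.
  have E1 : ∀ z₁ z₂ : ℂ, z₂ ≠ 0 → ‖z₂‖ < ‖z₁‖ →
      μ (z₁, z₂) = u (V.Y (-1) (-1) a (V.Y (-1) (-1) b c)) := fun z₁ z₂ h1 h2 => by
    rw [hsingle (H1 z₁ z₂ h1 h2) fun x hx => by rw [(H _ _ _ _ hx).1]; simp]
    simp [monomial_zero_zero]
  have E2 : ∀ z₀ z₂ : ℂ, z₀ ≠ 0 → ‖z₀‖ < ‖z₂‖ →
      μ (z₀ + z₂, z₂) = u (V.Y (-1) (-1) (V.Y (-1) (-1) a b) c) := fun z₁ z₂ h1 h2 => by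
    rw [hsingle (H2 z₁ z₂ h1 h2) fun x hx => by rw [(H _ _ _ _ hx).2.1]; simp]
    simp [monomial_zero_zero]
  have E3 : ∀ z₁ z₂ : ℂ, z₁ ≠ 0 → ‖z₁‖ < ‖z₂‖ →
      μ (z₁, z₂) = (-1 : ℂ) ^ (fermion (h₁ - hb₁) * fermion (h₂ - hb₂)) *
        u (V.Y (-1) (-1) b (V.Y (-1) (-1) a c)) := fun z₁ z₂ h1 h2 => by
    rw [hsingle (H3 z₁ z₂ h1 h2) fun x hx => by rw [(H _ _ _ _ hx).2.2]; simp]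
    simp [monomial_zero_zero]
  -- The regions |z₁| > |z₂| and |z₂| > |z₁| are disjoint; the region |z₀| < |z₂| links them,
  -- meeting the first at (3, 2) and the second at (1, 2).
  have h12 := (E1 (1 + 2) 2 (by norm_num) (by norm_num)).symm.trans
    (E2 1 2 (by norm_num) (by norm_num))
  refine ⟨h12, ?_⟩
  rw [h12, ← E2 (-1) 2 (by norm_num) (by norm_num), E3 (-1 + 2) 2 (by norm_num) (by norm_num)]

end FullVertexSuperalgebra

namespace FullVOA

variable {F : Type*} [AddCommGroup F] [Module ℂ F] (V : FullVOA F)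

theorem L_neg_one : V.L (-1) = V.D := by
  rw [L, neg_add_cancel, V.ω_zero]

theorem Lb_neg_one : V.Lb (-1) = V.Dbar := by
  rw [Lb, neg_add_cancel, V.ωb_zero]

theorem L_zero_apply {h hb : ℝ} {v : F} (hv : v ∈ V.wt h hb) : V.L 0 v = (h : ℂ) • v := by
  rw [L, zero_add, V.ω_one h hb v hv]

theorem Lb_zero_apply {h hb : ℝ} {v : F} (hv : v ∈ V.wt h hb) : V.Lb 0 v = (hb : ℂ) • v := by
  rw [Lb, zero_add, V.ωb_one h hb v hv]

end FullVOA

theorem fermion_int (n : ℤ) : fermion n = 0 := if_pos ⟨n, rfl⟩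

theorem fermion_half_int (n : ℤ) : fermion (n + 1 / 2) = 1 := by
  refine if_neg ?_
  rintro ⟨m, hm⟩
  have : ((2 * n + 1 : ℤ) : ℝ) = ((2 * m : ℤ) : ℝ) := by push_cast; linarith
  have := Int.cast_injective this
  omega

namespace PreN22FullVOA

variable {F : Type*} [AddCommGroup F] [Module ℂ F] (V : PreN22FullVOA F)

/-- The half-integer shift makes G⁺_{-1/2} the zero mode of τ⁺, which is what the residue formula
controls. -/
theorem Gp_neg_half : V.Gp (-1 / 2) = V.Y 0 (-1) V.τp := by rw [Gp]; norm_num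

theorem Gbp_neg_half : V.Gbp (-1 / 2) = V.Y (-1) 0 V.τbp := by rw [Gbp]; norm_num

theorem Gp_neg_half_Y (r s : ℝ) (a b : F) : V.Gp (-1 / 2) (V.Y r s a b) =
    V.Y r s (V.Gp (-1 / 2) a) b + V.Y r s (V.sgn a) (V.Gp (-1 / 2) b) := by
  rw [Gp_neg_half]
  refine V.Y_zero_mode_odd V.τp_wt ?_ (by rw [← V.Lb_neg_one, V.Lb_τp]) r s a b
  have := fermion_half_int 1
  norm_num at this ⊢; exact this

theorem Gbp_neg_half_Y (r s : ℝ) (a b : F) : V.Gbp (-1 / 2) (V.Y r s a b) =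
    V.Y r s (V.Gbp (-1 / 2) a) b + V.Y r s (V.sgn a) (V.Gbp (-1 / 2) b) := by
  rw [Gbp_neg_half]
  refine V.Y_zero_mode_bar_odd V.τbp_wt ?_ (by rw [← V.L_neg_one, V.L_τbp]) r s a b
  have := fermion_half_int (-2)
  norm_num at this ⊢; exact this

theorem Jop_zero_Y (r s : ℝ) (a b : F) : V.Jop 0 (V.Y r s a b) =
    V.Y r s (V.Jop 0 a) b + V.Y r s a (V.Jop 0 b) := by
  refine V.Y_zero_mode_even V.J_wt ?_ (by rw [← V.Lb_neg_one, V.Lb_J]) r s a b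
  have := fermion_int 1
  norm_num at this ⊢; exact this

theorem Jbop_zero_Y (r s : ℝ) (a b : F) : V.Jbop 0 (V.Y r s a b) =
    V.Y r s (V.Jbop 0 a) b + V.Y r s a (V.Jbop 0 b) := by
  refine V.Y_zero_mode_bar_even V.Jb_wt ?_ (by rw [← V.L_neg_one, V.L_Jb]) r s a b
  have := fermion_int (-1)
  norm_num at this ⊢; exact this

end PreN22FullVOA

theorem half_mem : (1 / 2 : ℝ) ∈ HalfInt := ⟨0, by norm_num⟩

namespace N22FullVOA

variable {F : Type*} [AddCommGroup F] [Module ℂ F] (V : N22FullVOA F)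

/-! ### The B-twist is an odd derivation -/

theorem d_Y (r s : ℝ) (a b : F) :
    V.d (V.Y r s a b) = V.Y r s (V.d a) b + V.Y r s (V.sgn a) (V.d b) := by
  simp only [d, LinearMap.add_apply, V.Gp_neg_half_Y, V.Gbp_neg_half_Y, map_add]
  abel

theorem sgn_d (v : F) : V.sgn (V.d v) = -V.d (V.sgn v) := by
  have h1 : V.sgn V.τp = -V.τp := by
    rw [V.sgn_apply V.τp_wt]
    have := fermion_half_int 1
    norm_num at this ⊢; simp [this]
  have h2 : V.sgn V.τbp = -V.τbp := by
    rw [V.sgn_apply V.τbp_wt]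
    have := fermion_half_int (-2)
    norm_num at this ⊢; simp [this]
  simp only [d, LinearMap.add_apply, V.Gp_neg_half, V.Gbp_neg_half, map_add, V.sgn_Y, h1, h2,
    map_neg, LinearMap.neg_apply]
  abel

theorem d_d_apply (v : F) : V.d (V.d v) = 0 := by
  rw [← Module.End.mul_apply, V.d_d, LinearMap.zero_apply]

theorem d_sgn_eq_zero {v : F} (hv : V.d v = 0) : V.d (V.sgn v) = 0 := by
  rw [← neg_eq_zero, ← V.sgn_d, hv, map_zero]

theorem d_Y_eq_zero (r s : ℝ) {a b : F} (ha : V.d a = 0) (hb : V.d b = 0) :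
    V.d (V.Y r s a b) = 0 := by
  simp [V.d_Y, ha, hb]

theorem Y_d_left (r s : ℝ) (a : F) {b : F} (hb : V.d b = 0) :
    V.Y r s (V.d a) b = V.d (V.Y r s a b) := by
  simp [V.d_Y, hb]

theorem Y_d_right (r s : ℝ) {a : F} (b : F) (ha : V.d a = 0) :
    V.Y r s a (V.d b) = V.d (V.Y r s (V.sgn a) b) := by
  simp [V.d_Y, V.d_sgn_eq_zero ha, V.sgn_sgn]

/-- This is {G⁺_{-1/2}, G⁻_{-1/2}}, where the J-term drops since r = s and the central term since r
+ s ≠ 0; the other half of `d` anticommutes with G⁻. Translations are thus null-homotopic, hence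
trivial on cohomology. -/
theorem L_neg_one_eq : V.L (-1) = V.d * V.Gm (-1 / 2) + V.Gm (-1 / 2) * V.d := by
  have h1 := V.left_rel.Gp_Gm _ neg_half_mem _ neg_half_mem
  have h2 := V.odd_odd _ ⟨_, neg_half_mem, Or.inr rfl⟩ _ ⟨_, neg_half_mem, Or.inl rfl⟩
  rw [show (-1 / 2 + -1 / 2 : ℝ) = -1 by norm_num, sub_self, zero_div, zero_smul, add_zero,
    if_neg (by norm_num), zero_smul, add_zero] at h1
  rw [← h1, d, add_mul, mul_add, ← sub_eq_zero, ← neg_eq_zero, ← h2]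
  abel

theorem Lb_neg_one_eq : V.Lb (-1) = V.d * V.Gbm (-1 / 2) + V.Gbm (-1 / 2) * V.d := by
  have h1 := V.right_rel.Gp_Gm _ neg_half_mem _ neg_half_mem
  have h2 := V.odd_odd _ ⟨_, neg_half_mem, Or.inl rfl⟩ _ ⟨_, neg_half_mem, Or.inr rfl⟩
  rw [show (-1 / 2 + -1 / 2 : ℝ) = -1 by norm_num, sub_self, zero_div, zero_smul, add_zero,
    if_neg (by norm_num), zero_smul, add_zero] at h1
  rw [← h1, d, add_mul, mul_add, ← sub_eq_zero, ← neg_eq_zero, ← h2]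
  abel

/-- All products of cocycles other than the `(-1,-1)`-product are coboundaries. -/
theorem Y_mem_range_d {r s : ℝ} (hrs : (r, s) ≠ (-1, -1)) {a b : F} (ha : V.d a = 0)
    (hb : V.d b = 0) : V.Y r s a b ∈ LinearMap.range V.d := by
  have hne : ∀ x : ℝ, x ≠ -1 → (-(x : ℂ) - 1) ≠ 0 := by
    intro x hx h
    have : (-(x : ℂ) - 1) = ((-x - 1 : ℝ) : ℂ) := by push_cast; rfl
    rw [this, Complex.ofReal_eq_zero] at h
    exact hx (by linarith)
  -- For a cocycle, Da is the coboundary of G⁻_{-1/2}a, so covariance makes (-r-1) a(r,s)b a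
  -- coboundary, which settles r ≠ -1. If r = -1, the same argument is applied to s with the
  -- conjugate operators.
  by_cases hr : r = -1
  · have hs : s ≠ -1 := fun hs => hrs (by rw [hr, hs])
    have h1 := V.Y_Dbar r s a b
    rw [← V.Lb_neg_one, V.Lb_neg_one_eq, LinearMap.add_apply, Module.End.mul_apply,
      Module.End.mul_apply, ha, map_zero, add_zero, V.Y_d_left _ _ _ hb] at h1
    exact (Submodule.smul_mem_iff _ (hne s hs)).1 (h1 ▸ ⟨_, rfl⟩)
  · have h1 := V.Y_D r s a b
    rw [← V.L_neg_one, V.L_neg_one_eq, LinearMap.add_apply, Module.End.mul_apply,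
      Module.End.mul_apply, ha, map_zero, add_zero, V.Y_d_left _ _ _ hb] at h1
    exact (Submodule.smul_mem_iff _ (hne r hr)).1 (h1 ▸ ⟨_, rfl⟩)

theorem Y_mem_range_left {r s : ℝ} {a b : F} (ha : a ∈ LinearMap.range V.d) (hb : V.d b = 0) :
    V.Y r s a b ∈ LinearMap.range V.d := by
  obtain ⟨a, rfl⟩ := ha
  exact ⟨_, (V.Y_d_left _ _ _ hb).symm⟩

theorem Y_mem_range_right {r s : ℝ} {a b : F} (ha : V.d a = 0) (hb : b ∈ LinearMap.range V.d) :
    V.Y r s a b ∈ LinearMap.range V.d := by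
  obtain ⟨b, rfl⟩ := hb
  exact ⟨_, (V.Y_d_right _ _ _ ha).symm⟩

/-- At least one of the two mode pairs differs from (-1,-1) and contributes a coboundary;
multiplying by cocycles keeps it one. -/
theorem Y_Y_mem_range {r s r' s' : ℝ} (h : ((r, s), (r', s')) ≠ ((-1, -1), (-1, -1))) {a b c : F}
    (ha : V.d a = 0) (hb : V.d b = 0) (hc : V.d c = 0) :
    V.Y r s a (V.Y r' s' b c) ∈ LinearMap.range V.d ∧
      V.Y r' s' (V.Y r s a b) c ∈ LinearMap.range V.d ∧
      V.Y r' s' b (V.Y r s a c) ∈ LinearMap.range V.d := by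
  by_cases h1 : (r, s) = (-1, -1)
  · have h2 : (r', s') ≠ (-1, -1) := fun h2 => h (by rw [h1, h2])
    exact ⟨V.Y_mem_range_right ha (V.Y_mem_range_d h2 hb hc),
      V.Y_mem_range_d h2 (V.d_Y_eq_zero _ _ ha hb) hc,
      V.Y_mem_range_d h2 hb (V.d_Y_eq_zero _ _ ha hc)⟩
  · exact ⟨V.Y_mem_range_d h1 ha (V.d_Y_eq_zero _ _ hb hc),
      V.Y_mem_range_left (V.Y_mem_range_d h1 ha hb) hc,
      V.Y_mem_range_right hb (V.Y_mem_range_d h1 ha hc)⟩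

/-- Functionals that vanish on coboundaries do not see the failure of associativity and
supercommutativity of the `(-1,-1)`-product of cocycles. -/
theorem apply_product_relations {h₀ hb₀ h₁ hb₁ h₂ hb₂ h₃ hb₃ : ℝ} {a b c : F} {u : F →ₗ[ℂ] ℂ}
    (ha : a ∈ V.wt h₁ hb₁) (hb : b ∈ V.wt h₂ hb₂) (hc : c ∈ V.wt h₃ hb₃)
    (hda : V.d a = 0) (hdb : V.d b = 0) (hdc : V.d c = 0)
    (hu : ∀ h hb : ℝ, (h, hb) ≠ (h₀, hb₀) → ∀ v ∈ V.wt h hb, u v = 0)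
    (hud : ∀ v, u (V.d v) = 0) :
    u (V.Y (-1) (-1) a (V.Y (-1) (-1) b c)) = u (V.Y (-1) (-1) (V.Y (-1) (-1) a b) c) ∧
    u (V.Y (-1) (-1) a (V.Y (-1) (-1) b c)) =
      (-1 : ℂ) ^ (fermion (h₁ - hb₁) * fermion (h₂ - hb₂)) *
        u (V.Y (-1) (-1) b (V.Y (-1) (-1) a c)) := by
  have hr : ∀ v ∈ LinearMap.range V.d, u v = 0 := by
    rintro _ ⟨v, rfl⟩
    exact hud v
  exact V.product_relations ha hb hc hu fun r s r' s' h =>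
    ⟨hr _ (V.Y_Y_mem_range h hda hdb hdc).1, hr _ (V.Y_Y_mem_range h hda hdb hdc).2.1,
      hr _ (V.Y_Y_mem_range h hda hdb hdc).2.2⟩

theorem mem_charge {p q : ℝ} {v : F} :
    v ∈ V.charge p q ↔ V.Jop 0 v = (p : ℂ) • v ∧ V.Jbop 0 v = (q : ℂ) • v := by
  rw [charge, Submodule.mem_inf, Module.End.mem_eigenspace_iff, Module.End.mem_eigenspace_iff]

theorem Y_mem_charge (r s : ℝ) {p q p' q' : ℝ} {a b : F} (ha : a ∈ V.charge p q)
    (hb : b ∈ V.charge p' q') : V.Y r s a b ∈ V.charge (p + p') (q + q') := by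
  rw [mem_charge] at *
  rw [V.Jop_zero_Y, V.Jbop_zero_Y, ha.1, ha.2, hb.1, hb.2]
  simp [add_smul]

/-! ### The vacuum -/

theorem Gp_one {r : ℝ} {n : ℤ} (hr : r + 1 / 2 = n) (hn : 0 ≤ n) :
    V.Gp r V.one = 0 ∧ V.Gm r V.one = 0 ∧ V.Gbp r V.one = 0 ∧ V.Gbm r V.one = 0 := by
  have hn' : (0 : ℝ) ≤ n := by exact_mod_cast hn
  have h1 : ¬ ∃ k l : ℕ, r + 1 / 2 = -(k : ℝ) - 1 ∧ (-1 : ℝ) = -(l : ℝ) - 1 := by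
    rintro ⟨k, l, h, -⟩
    have := k.cast_nonneg (α := ℝ)
    linarith
  have h2 : ¬ ∃ k l : ℕ, (-1 : ℝ) = -(k : ℝ) - 1 ∧ r + 1 / 2 = -(l : ℝ) - 1 := by
    rintro ⟨k, l, -, h⟩
    have := l.cast_nonneg (α := ℝ)
    linarith
  exact ⟨V.creation _ _ _ h1, V.creation _ _ _ h1, V.creation _ _ _ h2, V.creation _ _ _ h2⟩

theorem d_one : V.d V.one = 0 := by
  obtain ⟨h1, -, h2, -⟩ := V.Gp_one (r := -1 / 2) (n := 0) (by norm_num) le_rfl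
  simp [d, h1, h2]

theorem one_mem_charge : V.one ∈ V.charge 0 0 := by
  rw [mem_charge]
  constructor
  · rw [PreN22FullVOA.Jop, V.creation _ _ _ ?_]
    · simp
    · rintro ⟨k, l, h, -⟩
      have := k.cast_nonneg (α := ℝ)
      linarith
  · rw [PreN22FullVOA.Jbop, V.creation _ _ _ ?_]
    · simp
    · rintro ⟨k, l, -, h⟩
      have := l.cast_nonneg (α := ℝ)
      linarith

end N22FullVOA

end FullCFT

end

/-! ### The Laplacian, Hodge decomposition and adjoints -/

noncomputable section

namespace FullCFT

/-! ### Invariant subspaces of diagonalizable operators -/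

section Eigen

variable {F : Type*} [AddCommGroup F] [Module ℂ F]

/-- Applying T - a to a finite sum of eigenvectors in W removes the a-component and rescales the
others by nonzero factors, so induction on the number of eigenvalues puts each component in W. -/
theorem le_iSup_inf_eigenspace {T : Module.End ℂ F} (hT : ⨆ p : ℝ, T.eigenspace (p : ℂ) = ⊤)
    {W : Submodule ℂ F} (hW : ∀ v ∈ W, T v ∈ W) : W ≤ ⨆ p : ℝ, W ⊓ T.eigenspace (p : ℂ) := by
  classical
  have key : ∀ (s : Finset ℝ) (m : ℝ → F), (∀ p : ℝ, m p ∈ T.eigenspace (p : ℂ)) →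
      ∑ p ∈ s, m p ∈ W → ∀ p ∈ s, m p ∈ W := by
    intro s
    induction s using Finset.induction_on with
    | empty => simp
    | insert a s ha ih =>
      intro m hm hsum
      have hs : ∀ p ∈ s, m p ∈ W := by
        have h1 : ∑ p ∈ s, ((p : ℂ) - a) • m p ∈ W := by
          have := W.sub_mem (hW _ hsum) (W.smul_mem (a : ℂ) hsum)
          rw [Finset.sum_insert ha, map_add, map_sum, smul_add, Finset.smul_sum] at this
          simp only [fun p => Module.End.mem_eigenspace_iff.1 (hm p)] at this
          rw [add_sub_add_left_eq_sub, ← Finset.sum_sub_distrib] at this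
          simpa only [sub_smul] using this
        intro p hp
        have hne : (p : ℂ) - a ≠ 0 := by
          rw [sub_ne_zero, Ne, Complex.ofReal_inj]
          rintro rfl
          exact ha hp
        exact (W.smul_mem_iff hne).1
          (ih (fun p => ((p : ℂ) - a) • m p) (fun p => Submodule.smul_mem _ _ (hm p)) h1 p hp)
      intro p hp
      rcases Finset.mem_insert.1 hp with rfl | hp
      · rw [Finset.sum_insert ha] at hsum
        exact (W.add_mem_iff_left (W.sum_mem hs)).1 hsum
      · exact hs p hp
  intro v hv
  obtain ⟨m, hm, rfl⟩ := (Submodule.mem_iSup_iff_exists_finsupp _ _).1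
    (show v ∈ ⨆ p : ℝ, T.eigenspace (p : ℂ) by rw [hT]; trivial)
  exact Submodule.sum_mem _ fun p hp => Submodule.mem_iSup_of_mem p
    ⟨key m.support m hm hv p hp, hm p⟩

theorem inf_eigenspace_invariant {S T : Module.End ℂ F} (h : Commute S T) {W : Submodule ℂ F}
    (hW : ∀ v ∈ W, S v ∈ W) (p : ℂ) : ∀ v ∈ W ⊓ T.eigenspace p, S v ∈ W ⊓ T.eigenspace p := by
  rintro v ⟨h1, h2⟩
  refine ⟨hW v h1, ?_⟩
  rw [SetLike.mem_coe, Module.End.mem_eigenspace_iff] at h2 ⊢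
  rw [← Module.End.mul_apply, ← h.eq, Module.End.mul_apply, h2, map_smul]

end Eigen

/-! ### The Neveu-Schwarz algebra -/

namespace IsNeveuSchwarz

variable {F : Type*} [AddCommGroup F] [Module ℂ F] {c : ℂ} {L J Gp Gm : ℝ → Module.End ℂ F}
  (hN : IsNeveuSchwarz c L J Gp Gm)

include hN

theorem commute_L_J : Commute (L 0) (J 0) := by
  have := hN.L_J 0 0
  rw [Commute, SemiconjBy]
  simpa [sub_eq_zero] using this

/-- The modes ±1/2 are exactly those for which the central term r² - 1/4 vanishes. -/
theorem anticomm_neg_pos :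
    Gp (-1 / 2) * Gm (1 / 2) + Gm (1 / 2) * Gp (-1 / 2) = L 0 - (1 / 2 : ℂ) • J 0 := by
  rw [hN.Gp_Gm _ N22FullVOA.neg_half_mem _ half_mem]
  norm_num
  exact (sub_eq_add_neg _ _).symm

theorem anticomm_pos_neg :
    Gp (1 / 2) * Gm (-1 / 2) + Gm (-1 / 2) * Gp (1 / 2) = L 0 + (1 / 2 : ℂ) • J 0 := by
  rw [hN.Gp_Gm _ half_mem _ N22FullVOA.neg_half_mem]
  norm_num

/-- If `L(0) - J(0)/2` has no negative eigenvalues, then its kernel consists of vectors killed by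
the positive modes. -/
theorem primary_of_bound
    (hbound : ∀ (v : F) (k : ℝ), k < 0 → (L 0 - (1 / 2 : ℂ) • J 0) v = (k : ℂ) • v → v = 0)
    {v : F} (hv : (L 0 - (1 / 2 : ℂ) • J 0) v = 0) (hGm : Gm (1 / 2) v = 0) :
    (∀ n : ℤ, 1 ≤ n → L n v = 0 ∧ J n v = 0) ∧
      ∀ r ∈ HalfInt, 1 / 2 ≤ r → Gp r v = 0 ∧ Gm r v = 0 := by
  -- An operator shifting weight by x and charge by y shifts L(0) - J(0)/2 by x - y/2; a negative
  -- shift sends the kernel to a forbidden eigenvalue.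
  have key : ∀ (T : Module.End ℂ F) (x y : ℝ), L 0 * T - T * L 0 = (x : ℂ) • T →
      J 0 * T - T * J 0 = (y : ℂ) • T → x - y / 2 < 0 → T v = 0 := by
    intro T x y h1 h2 hxy
    refine hbound (T v) (x - y / 2) hxy ?_
    have e1 := LinearMap.congr_fun h1 v
    have e2 := LinearMap.congr_fun h2 v
    have e3 := congrArg T hv
    simp only [LinearMap.sub_apply, Module.End.mul_apply, LinearMap.smul_apply, map_sub, map_smul,
      map_zero] at e1 e2 e3 ⊢
    push_cast
    rw [sub_eq_iff_eq_add.1 e1, sub_eq_iff_eq_add.1 e2, sub_eq_zero.1 e3]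
    module
  refine ⟨fun n hn => ⟨?_, ?_⟩, fun r hr hr2 => ⟨?_, ?_⟩⟩
  · have hn' : (1 : ℝ) ≤ n := by exact_mod_cast hn
    refine key _ (-n) 0 ?_ ?_ (by linarith)
    · have := hN.L_L 0 n
      have hne : ¬ (n = 0) := by omega
      simpa [hne] using this
    · have := hN.L_J n 0
      simp only [Int.cast_zero, neg_zero, zero_smul, sub_eq_zero] at this
      simp [this]
  · have hn' : (1 : ℝ) ≤ n := by exact_mod_cast hn
    refine key _ (-n) 0 ?_ ?_ (by linarith)
    · have := hN.L_J 0 n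
      simpa using this
    · have := hN.J_J 0 n
      have hne : ¬ (n = 0) := by omega
      simpa [hne] using this
  · refine key _ (-r) 1 ?_ ?_ (by linarith)
    · have := hN.L_Gp 0 r hr
      simpa using this
    · have := hN.J_Gp 0 r hr
      simpa using this
  -- G⁻_r shifts by 1/2 - r, which is not negative at r = 1/2; this border case is the hypothesis
  -- `hGm`.
  · by_cases h : r = 1 / 2
    · rw [h, hGm]
    · have hlt : 1 / 2 < r := lt_of_le_of_ne hr2 (Ne.symm h)
      refine key _ (-r) (-1) ?_ ?_ (by linarith)
      · have := hN.L_Gm 0 r hr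
        simpa using this
      · have := hN.J_Gm 0 r hr
        simpa using this

end IsNeveuSchwarz

/-! ### Weights, charges and the Laplacian -/

namespace N22FullVOA

variable {F : Type*} [AddCommGroup F] [Module ℂ F] (V : N22FullVOA F)

/-- Since weights are real, (L(0)-h)² + (Lbar(0)-hb)² acts on each weight space by a squared
distance, which is nonzero except at (h, hb). Inverting it elsewhere recovers every vector, up to a
part of weight (h, hb), from its image; a simultaneous eigenvector has image zero. -/
theorem mem_wt_iff {h hb : ℝ} {v : F} :
    v ∈ V.wt h hb ↔ V.L 0 v = (h : ℂ) • v ∧ V.Lb 0 v = (hb : ℂ) • v := by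
  refine ⟨fun hv => ⟨V.L_zero_apply hv, V.Lb_zero_apply hv⟩, fun ⟨h1, h2⟩ => ?_⟩
  let ε : ℝ × ℝ → ℂ := fun x => ((x.1 : ℂ) - h) * (x.1 - h) + ((x.2 : ℂ) - hb) * (x.2 - hb)
  have hε : ∀ x, x ≠ (h, hb) → ε x ≠ 0 := by
    intro x hx h0
    have h0' : (x.1 - h) * (x.1 - h) + (x.2 - hb) * (x.2 - hb) = 0 := by
      simp only [ε] at h0
      exact_mod_cast h0
    have e1 : x.1 - h = 0 := by nlinarith [mul_self_nonneg (x.1 - h), mul_self_nonneg (x.2 - hb)]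
    have e2 : x.2 - hb = 0 := by nlinarith [mul_self_nonneg (x.1 - h), mul_self_nonneg (x.2 - hb)]
    exact hx (Prod.ext (by simpa [sub_eq_zero] using e1) (by simpa [sub_eq_zero] using e2))
  let A : Module.End ℂ F := V.L 0 - (h : ℂ) • 1
  let B : Module.End ℂ F := V.Lb 0 - (hb : ℂ) • 1
  have hdec : ∀ w : F, ∃ w' ∈ V.wt h hb,
      w = w' + V.scaling (fun x => (ε x)⁻¹) (A (A w) + B (B w)) := by
    intro w
    induction w using V.wt_induction with
    | add v w hv hw =>
      obtain ⟨v', hv', e1⟩ := hv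
      obtain ⟨w', hw', e2⟩ := hw
      refine ⟨v' + w', add_mem hv' hw', ?_⟩
      conv_lhs => rw [e1, e2]
      simp only [map_add]
      abel
    | mem k kb w hw =>
      have hA : A (A w) + B (B w) = ε (k, kb) • w := by
        simp only [A, B, LinearMap.sub_apply, LinearMap.smul_apply, Module.End.one_apply,
          V.L_zero_apply hw, V.Lb_zero_apply hw, ← sub_smul, map_smul, smul_smul, ← add_smul, ε]
      rw [hA, map_smul, V.scaling_apply _ hw, smul_smul]
      by_cases hx : (k, kb) = (h, hb)
      · obtain ⟨rfl, rfl⟩ := Prod.mk.inj hx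
        exact ⟨w, hw, by simp [ε]⟩
      · exact ⟨0, zero_mem _, by simp [hε _ hx]⟩
  obtain ⟨w, hw, e⟩ := hdec v
  have hA : A v = 0 := by simp [A, h1]
  have hB : B v = 0 := by simp [B, h2]
  rw [hA, hB, map_zero, map_zero, add_zero, map_zero, add_zero] at e
  rwa [e]

theorem commute_even {A B : Module.End ℂ F}
    (hA : A ∈ evenOps V.L V.Jop) (hB : B ∈ evenOps V.Lb V.Jbop) : Commute A B :=
  sub_eq_zero.1 (V.even_even A hA B hB)

theorem L_zero_mem : V.L 0 ∈ evenOps V.L V.Jop := ⟨0, Or.inl (by simp)⟩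
theorem Jop_zero_mem : V.Jop 0 ∈ evenOps V.L V.Jop := ⟨0, Or.inr (by simp)⟩
theorem Lb_zero_mem : V.Lb 0 ∈ evenOps V.Lb V.Jbop := ⟨0, Or.inl (by simp)⟩
theorem Jbop_zero_mem : V.Jbop 0 ∈ evenOps V.Lb V.Jbop := ⟨0, Or.inr (by simp)⟩

theorem iSup_eigenspace_L : ⨆ p : ℝ, (V.L 0).eigenspace (p : ℂ) = ⊤ := by
  refine eq_top_iff.2 (V.iSup_wt ▸ iSup_le fun x => le_iSup_of_le x.1 fun v hv => ?_)
  exact Module.End.mem_eigenspace_iff.2 (V.L_zero_apply hv)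

theorem iSup_eigenspace_Lb : ⨆ p : ℝ, (V.Lb 0).eigenspace (p : ℂ) = ⊤ := by
  refine eq_top_iff.2 (V.iSup_wt ▸ iSup_le fun x => le_iSup_of_le x.2 fun v hv => ?_)
  exact Module.End.mem_eigenspace_iff.2 (V.Lb_zero_apply hv)

/-- The simultaneous eigenspaces of `L(0)`, `Lbar(0)`, `J(0)` and `Jbar(0)`. -/
def joint (x : (ℝ × ℝ) × (ℝ × ℝ)) : Submodule ℂ F := V.wt x.1.1 x.1.2 ⊓ V.charge x.2.1 x.2.2

/-- The four operators commute and are diagonalizable, so W is split by one at a time, each piece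
staying invariant under those still to come. -/
theorem le_iSup_inf_joint {W : Submodule ℂ F} (hL : ∀ v ∈ W, V.L 0 v ∈ W)
    (hLb : ∀ v ∈ W, V.Lb 0 v ∈ W) (hJ : ∀ v ∈ W, V.Jop 0 v ∈ W) (hJb : ∀ v ∈ W, V.Jbop 0 v ∈ W) :
    W ≤ ⨆ x, W ⊓ V.joint x := by
  refine (le_iSup_inf_eigenspace V.iSup_eigenspace_L hL).trans (iSup_le fun h => ?_)
  have i1 := inf_eigenspace_invariant (V.commute_even V.L_zero_mem V.Lb_zero_mem).symm hLb (h : ℂ)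
  have i2 := inf_eigenspace_invariant V.left_rel.commute_L_J.symm hJ (h : ℂ)
  have i3 := inf_eigenspace_invariant (V.commute_even V.L_zero_mem V.Jbop_zero_mem).symm hJb (h : ℂ)
  refine (le_iSup_inf_eigenspace V.iSup_eigenspace_Lb i1).trans (iSup_le fun hb => ?_)
  have j2 := inf_eigenspace_invariant (V.commute_even V.Jop_zero_mem V.Lb_zero_mem) i2 (hb : ℂ)
  have j3 := inf_eigenspace_invariant V.right_rel.commute_L_J.symm i3 (hb : ℂ)
  refine (le_iSup_inf_eigenspace V.J_semisimple j2).trans (iSup_le fun p => ?_)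
  have k3 := inf_eigenspace_invariant (V.commute_even V.Jop_zero_mem V.Jbop_zero_mem).symm j3
    (p : ℂ)
  refine (le_iSup_inf_eigenspace V.Jb_semisimple k3).trans (iSup_le fun q => ?_)
  refine le_iSup_of_le ((h, hb), (p, q)) ?_
  rintro v ⟨⟨⟨⟨h1, h2⟩, h3⟩, h4⟩, h5⟩
  exact ⟨h1, V.mem_wt_iff.2 ⟨Module.End.mem_eigenspace_iff.1 h2, Module.End.mem_eigenspace_iff.1 h3⟩,
    h4, h5⟩

/-- The holomorphic half of the Laplacian. -/
def lap : Module.End ℂ F := V.L 0 - (1 / 2 : ℂ) • V.Jop 0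

/-- The antiholomorphic half of the Laplacian. -/
def lapb : Module.End ℂ F := V.Lb 0 - (1 / 2 : ℂ) • V.Jbop 0

theorem lap_eq : V.lap = V.Gp (-1 / 2) * V.Gm (1 / 2) + V.Gm (1 / 2) * V.Gp (-1 / 2) :=
  V.left_rel.anticomm_neg_pos.symm

theorem lapb_eq : V.lapb = V.Gbp (-1 / 2) * V.Gbm (1 / 2) + V.Gbm (1 / 2) * V.Gbp (-1 / 2) :=
  V.right_rel.anticomm_neg_pos.symm

/-- The adjoint of the B-twist. -/
def dAdj : Module.End ℂ F := V.Gm (1 / 2) + V.Gbm (1 / 2)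

/-- The cross terms in {d, d*} pair a holomorphic with an antiholomorphic odd mode and cancel, so
the two halves simply add. -/
theorem lap_add_lapb : V.lap + V.lapb = V.d * V.dAdj + V.dAdj * V.d := by
  have h1 := V.odd_odd _ ⟨_, neg_half_mem, Or.inl rfl⟩ _ ⟨_, half_mem, Or.inr rfl⟩
  have h2 := V.odd_odd _ ⟨_, half_mem, Or.inr rfl⟩ _ ⟨_, neg_half_mem, Or.inl rfl⟩
  calc
    V.lap + V.lapb = V.lap + V.lapb +
        (V.Gp (-1 / 2) * V.Gbm (1 / 2) + V.Gbm (1 / 2) * V.Gp (-1 / 2)) +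
        (V.Gm (1 / 2) * V.Gbp (-1 / 2) + V.Gbp (-1 / 2) * V.Gm (1 / 2)) := by
      rw [h1, h2, add_zero, add_zero]
    _ = _ := by
      rw [lap_eq, lapb_eq, d, dAdj]
      simp only [mul_add, add_mul]
      abel

theorem lap_add_lapb_apply (v : F) : V.lap v + V.lapb v = V.d (V.dAdj v) + V.dAdj (V.d v) := by
  have := LinearMap.congr_fun V.lap_add_lapb v
  simpa using this

/-- The Laplacian. -/
def laplacian : Module.End ℂ F := V.lap + V.lapb

theorem laplacian_apply (v : F) : V.laplacian v = V.d (V.dAdj v) + V.dAdj (V.d v) :=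
  V.lap_add_lapb_apply v

theorem laplacian_mem {W : Submodule ℂ F} (hL : ∀ v ∈ W, V.L 0 v ∈ W)
    (hLb : ∀ v ∈ W, V.Lb 0 v ∈ W) (hJ : ∀ v ∈ W, V.Jop 0 v ∈ W) (hJb : ∀ v ∈ W, V.Jbop 0 v ∈ W) :
    ∀ v ∈ W, V.laplacian v ∈ W := fun v hv =>
  W.add_mem (W.sub_mem (hL v hv) (W.smul_mem _ (hJ v hv)))
    (W.sub_mem (hLb v hv) (W.smul_mem _ (hJb v hv)))

theorem iSup_eigenspace_laplacian : ⨆ p : ℝ, V.laplacian.eigenspace (p : ℂ) = ⊤ := by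
  have := V.le_iSup_inf_joint (W := ⊤) (by simp) (by simp) (by simp) (by simp)
  refine eq_top_iff.2 (this.trans (iSup_le ?_))
  rintro ⟨⟨h, hb⟩, p, q⟩
  refine le_iSup_of_le (h - p / 2 + (hb - q / 2)) ?_
  rintro v ⟨-, hwt, hch⟩
  have h1 := V.mem_wt_iff.1 hwt
  have h2 := V.mem_charge.1 hch
  rw [Module.End.mem_eigenspace_iff]
  simp only [laplacian, lap, lapb, LinearMap.add_apply, LinearMap.sub_apply, LinearMap.smul_apply,
    h1, h2, smul_smul, ← sub_smul, ← add_smul]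
  congr 1
  push_cast
  ring

/-- Hodge decomposition of cocycles. -/
theorem exists_harmonic {W : Submodule ℂ F} (hW : ∀ v ∈ W, V.laplacian v ∈ W) {a : F} (ha : a ∈ W)
    (hda : V.d a = 0) : ∃ c ∈ W, V.laplacian c = 0 ∧ a - c ∈ LinearMap.range V.d := by
  have hinv : ∀ v ∈ W ⊓ LinearMap.ker V.d, V.laplacian v ∈ W ⊓ LinearMap.ker V.d := by
    rintro v ⟨h1, h2⟩
    rw [SetLike.mem_coe, LinearMap.mem_ker] at h2
    refine ⟨hW v h1, ?_⟩
    rw [SetLike.mem_coe, LinearMap.mem_ker, V.laplacian_apply, h2, map_zero, add_zero, V.d_d_apply]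
  -- Carrying `W` along lets the harmonic representative be chosen with prescribed parity or charge.
  have hle : W ⊓ LinearMap.ker V.d ≤ (W ⊓ LinearMap.ker V.laplacian) ⊔ LinearMap.range V.d := by
    refine (le_iSup_inf_eigenspace V.iSup_eigenspace_laplacian hinv).trans (iSup_le fun p => ?_)
    rintro v ⟨⟨h1, h2⟩, h3⟩
    rw [SetLike.mem_coe, LinearMap.mem_ker] at h2
    rw [SetLike.mem_coe, Module.End.mem_eigenspace_iff] at h3
    by_cases hp : p = 0
    · exact Submodule.mem_sup_left ⟨h1, by simpa [hp] using h3⟩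
    -- For a cocycle of eigenvalue p ≠ 0 the Laplacian gives p v = d(d* v).
    · refine Submodule.mem_sup_right ?_
      rw [V.laplacian_apply, h2, map_zero, add_zero] at h3
      exact (Submodule.smul_mem_iff _ (Complex.ofReal_ne_zero.2 hp)).1 (h3 ▸ ⟨_, rfl⟩)
  obtain ⟨c, hc, e, he, rfl⟩ := Submodule.mem_sup.1 (hle ⟨ha, hda⟩)
  exact ⟨c, hc.1, hc.2, by simpa using he⟩

end N22FullVOA

/-! ### Unitarity -/

namespace UnitaryN22FullVOA

variable {F : Type*} [AddCommGroup F] [Module ℂ F] (V : UnitaryN22FullVOA F)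

/-- The sesquilinear form `⟨u, v⟩ = (φ(u), v)`. -/
def ip (u v : F) : ℂ := V.form (V.φ u) v

theorem ip_add_left (u u' v : F) : V.ip (u + u') v = V.ip u v + V.ip u' v := by simp [ip]
theorem ip_add_right (u v v' : F) : V.ip u (v + v') = V.ip u v + V.ip u v' := by simp [ip]
theorem ip_smul_left (k : ℝ) (u v : F) : V.ip ((k : ℂ) • u) v = k * V.ip u v := by
  rw [ip, ip, map_smulₛₗ, Complex.conj_ofReal, map_smul, LinearMap.smul_apply, smul_eq_mul]
theorem ip_smul_right (k : ℂ) (u v : F) : V.ip u (k • v) = k * V.ip u v := by simp [ip]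
theorem ip_zero_right (u : F) : V.ip u 0 = 0 := by simp [ip]

theorem ip_self_nonneg (v : F) : 0 ≤ (V.ip v v).re := by
  by_cases h : v = 0
  · simp [h, ip]
  · exact (V.pos_def v h).1.le

theorem eq_zero_of_ip_self {v : F} (h : (V.ip v v).re ≤ 0) : v = 0 := by
  by_contra hv
  exact absurd (V.pos_def v hv).1 (not_lt.2 h)

/-- When L(1) and its conjugate kill `a`, the exponential in the invariance axiom reduces to its (0,
0) term. -/
theorem form_Y_of_quasiprimary {h hb : ℝ} {n : ℤ} (hn : h - hb = (n : ℝ) / 2) {a : F}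
    (ha : a ∈ V.wt h hb) (h1 : V.L 1 a = 0) (h2 : V.Lb 1 a = 0) (u v : F) (r s : ℝ) :
    V.form u (V.Y r s a v) = (-1 : ℂ) ^ (n * (n + 1) / 2) *
      V.form (V.Y (2 * h - r - 2) (2 * hb - s - 2) a u) v := by
  rw [V.form_invariant h hb n hn a ha u v r s, finsum_eq_single _ (0, 0)]
  · simp
  · rintro ⟨k, l⟩ hkl
    have : (V.L 1 ^ k) ((V.Lb 1 ^ l) a) = 0 := by
      rcases l with _ | l
      · rcases k with _ | k
        · simp at hkl
        · rw [pow_succ]; simp [h1]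
      · rw [pow_succ (V.Lb 1)]; simp [h2]
    simp [this]

theorem L_one_one : V.L 1 V.one = 0 ∧ V.Lb 1 V.one = 0 := by
  constructor
  · refine V.creation _ _ _ ?_
    rintro ⟨k, l, h, -⟩
    have := k.cast_nonneg (α := ℝ)
    linarith
  · refine V.creation _ _ _ ?_
    rintro ⟨k, l, -, h⟩
    have := l.cast_nonneg (α := ℝ)
    linarith

theorem neg_three_half_mem : (-3 / 2 : ℝ) ∈ HalfInt := ⟨-2, by norm_num⟩

/-- Meant for w the vacuum and G the mode -3/2 that creates `a`: the commutator with L(1) is then a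
multiple of the mode -1/2, which kills the vacuum. For operators of opposite chirality it is used
with k = 0 and G' = 0. -/
theorem quasiprimary_of_commutator {L G G' : Module.End ℂ F} {a w : F} {k : ℂ} (ha : G w = a)
    (h : L * G - G * L = k • G') (hw : L w = 0) (hw' : G' w = 0) : L a = 0 := by
  have := LinearMap.congr_fun h w
  simpa [hw, hw', ha] using this

theorem quasiprimary : (V.L 1 V.τp = 0 ∧ V.Lb 1 V.τp = 0) ∧ (V.L 1 V.τm = 0 ∧ V.Lb 1 V.τm = 0) ∧
    (V.L 1 V.τbp = 0 ∧ V.Lb 1 V.τbp = 0) ∧ (V.L 1 V.τbm = 0 ∧ V.Lb 1 V.τbm = 0) := by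
  obtain ⟨g1, g2, g3, g4⟩ := V.Gp_one (r := ((1 : ℤ) : ℝ) + -3 / 2) (n := 0) (by norm_num) le_rfl
  have e1 : V.Gp (-3 / 2) V.one = V.τp := by
    have := V.creation_eq V.τp
    rw [PreN22FullVOA.Gp]; norm_num; exact this
  have e2 : V.Gm (-3 / 2) V.one = V.τm := by
    have := V.creation_eq V.τm
    rw [PreN22FullVOA.Gm]; norm_num; exact this
  have e3 : V.Gbp (-3 / 2) V.one = V.τbp := by
    have := V.creation_eq V.τbp
    rw [PreN22FullVOA.Gbp]; norm_num; exact this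
  have e4 : V.Gbm (-3 / 2) V.one = V.τbm := by
    have := V.creation_eq V.τbm
    rw [PreN22FullVOA.Gbm]; norm_num; exact this
  obtain ⟨l1, l2⟩ := V.L_one_one
  have hm := neg_three_half_mem
  have c1 : V.L ((1 : ℤ) : ℝ) = V.L 1 := by norm_num
  have c2 : V.Lb ((1 : ℤ) : ℝ) = V.Lb 1 := by norm_num
  have m1 : V.L 1 ∈ evenOps V.L V.Jop := ⟨1, Or.inl c1.symm⟩
  have m2 : V.Lb 1 ∈ evenOps V.Lb V.Jbop := ⟨1, Or.inl c2.symm⟩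
  have z : ∀ {A B : Module.End ℂ F}, A * B - B * A = 0 →
      A * B - B * A = (0 : ℂ) • (0 : Module.End ℂ F) := by
    intro A B h
    rw [zero_smul, h]
  refine ⟨⟨?_, ?_⟩, ⟨?_, ?_⟩, ⟨?_, ?_⟩, ?_, ?_⟩
  · exact quasiprimary_of_commutator e1 (c1 ▸ V.left_rel.L_Gp 1 _ hm) l1 g1
  · have := V.odd_even _ ⟨_, hm, Or.inl rfl⟩ _ m2
    have := LinearMap.congr_fun this V.one
    simpa [l2, e1] using this
  · exact quasiprimary_of_commutator e2 (c1 ▸ V.left_rel.L_Gm 1 _ hm) l1 g2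
  · have := V.odd_even _ ⟨_, hm, Or.inr rfl⟩ _ m2
    have := LinearMap.congr_fun this V.one
    simpa [l2, e2] using this
  · exact quasiprimary_of_commutator e3 (z (V.even_odd _ m1 _ ⟨_, hm, Or.inl rfl⟩)) l1 rfl
  · exact quasiprimary_of_commutator e3 (c2 ▸ V.right_rel.L_Gp 1 _ hm) l2 g3
  · exact quasiprimary_of_commutator e4 (z (V.even_odd _ m1 _ ⟨_, hm, Or.inr rfl⟩)) l1 rfl
  · exact quasiprimary_of_commutator e4 (c2 ▸ V.right_rel.L_Gm 1 _ hm) l2 g4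

/-- The involution exchanges τ⁺ and τ⁻, and for spin 3/2 (n = 3) the invariance sign is (-1)^6 = 1.
-/
theorem ip_Gp (r : ℝ) (u v : F) : V.ip u (V.Gp r v) = V.ip (V.Gm (-r) u) v := by
  rw [ip, ip, PreN22FullVOA.Gp, PreN22FullVOA.Gm, V.φ_Y, V.φ_τm,
    V.form_Y_of_quasiprimary (n := 3) (by norm_num) V.τp_wt V.quasiprimary.1.1 V.quasiprimary.1.2]
  rw [show 2 * (3 / 2 : ℝ) - (r + 1 / 2) - 2 = -r + 1 / 2 by ring,
    show 2 * (0 : ℝ) - -1 - 2 = -1 by ring]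
  norm_num

theorem ip_Gm (r : ℝ) (u v : F) : V.ip u (V.Gm r v) = V.ip (V.Gp (-r) u) v := by
  rw [ip, ip, PreN22FullVOA.Gp, PreN22FullVOA.Gm, V.φ_Y, V.φ_τp,
    V.form_Y_of_quasiprimary (n := 3) (by norm_num) V.τm_wt V.quasiprimary.2.1.1
      V.quasiprimary.2.1.2]
  rw [show 2 * (3 / 2 : ℝ) - (r + 1 / 2) - 2 = -r + 1 / 2 by ring,
    show 2 * (0 : ℝ) - -1 - 2 = -1 by ring]
  norm_num

/-- For spin -3/2 (n = -3) the invariance sign is (-1)^3 = -1; it cancels the sign by which φ on the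
barred supercurrents differs from φ on τ⁺ and τ⁻. -/
theorem ip_Gbp (r : ℝ) (u v : F) : V.ip u (V.Gbp r v) = V.ip (V.Gbm (-r) u) v := by
  rw [ip, ip, PreN22FullVOA.Gbp, PreN22FullVOA.Gbm, V.φ_Y, V.φ_τbm,
    V.form_Y_of_quasiprimary (n := -3) (by norm_num) V.τbp_wt V.quasiprimary.2.2.1.1
      V.quasiprimary.2.2.1.2]
  rw [show 2 * (3 / 2 : ℝ) - (r + 1 / 2) - 2 = -r + 1 / 2 by ring,
    show 2 * (0 : ℝ) - -1 - 2 = -1 by ring]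
  norm_num

theorem ip_Gbm (r : ℝ) (u v : F) : V.ip u (V.Gbm r v) = V.ip (V.Gbp (-r) u) v := by
  rw [ip, ip, PreN22FullVOA.Gbp, PreN22FullVOA.Gbm, V.φ_Y, V.φ_τbp,
    V.form_Y_of_quasiprimary (n := -3) (by norm_num) V.τbm_wt V.quasiprimary.2.2.2.1
      V.quasiprimary.2.2.2.2]
  rw [show 2 * (3 / 2 : ℝ) - (r + 1 / 2) - 2 = -r + 1 / 2 by ring,
    show 2 * (0 : ℝ) - -1 - 2 = -1 by ring]
  norm_num

end UnitaryN22FullVOA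

end FullCFT

end

/-! ### The chiral ring and its comparison with the cohomology -/

noncomputable section

namespace FullCFT

/-! ### Transport of structure -/

section Transport

variable {A B : Type*} [AddCommGroup A] [Module ℂ A] [AddCommGroup B] [Module ℂ B]

theorem isInternal_map {ι : Type*} [DecidableEq ι] {p : ι → Submodule ℂ A}
    (h : DirectSum.IsInternal p) (e : A ≃ₗ[ℂ] B) :
    DirectSum.IsInternal fun i => (p i).map e.toLinearMap := by
  rw [DirectSum.isInternal_submodule_iff_iSupIndep_and_iSup_eq_top] at h ⊢
  refine ⟨LinearMap.iSupIndep_map _ e.injective h.1, ?_⟩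
  rw [← Submodule.map_iSup, h.2, Submodule.map_top]
  exact LinearEquiv.range e

theorem iSupIndep_of_map {ι : Type*} {p : ι → Submodule ℂ A} (f : A →ₗ[ℂ] B)
    (hf : Function.Injective f) (h : iSupIndep fun i => (p i).map f) : iSupIndep p := by
  intro i
  rw [Submodule.disjoint_def]
  intro x hx hx'
  refine hf ?_
  rw [map_zero]
  refine Submodule.disjoint_def.1 (h i) _ (Submodule.mem_map_of_mem hx) ?_
  have := Submodule.mem_map_of_mem (f := f) hx'
  simpa only [Submodule.map_iSup] using this

/-- The product on `B` obtained from a product on `A` by an isomorphism. -/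
def transportMul (mul : A →ₗ[ℂ] A →ₗ[ℂ] A) (e : A ≃ₗ[ℂ] B) : B →ₗ[ℂ] B →ₗ[ℂ] B :=
  (mul.compl₁₂ e.symm.toLinearMap e.symm.toLinearMap).compr₂ e.toLinearMap

theorem transportMul_apply (mul : A →ₗ[ℂ] A →ₗ[ℂ] A) (e : A ≃ₗ[ℂ] B) (a b : A) :
    transportMul mul e (e a) (e b) = e (mul a b) := by
  simp [transportMul]

theorem IsSupercommAlgebra.transport {mul : A →ₗ[ℂ] A →ₗ[ℂ] A} {one : A}
    {par : ZMod 2 → Submodule ℂ A} (h : IsSupercommAlgebra mul one par) (e : A ≃ₗ[ℂ] B) :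
    IsSupercommAlgebra (transportMul mul e) (e one) fun i => (par i).map e.toLinearMap where
  one_mul := e.surjective.forall.2 fun a => by rw [transportMul_apply, h.one_mul]
  mul_one := e.surjective.forall.2 fun a => by rw [transportMul_apply, h.mul_one]
  mul_assoc := e.surjective.forall₃.2 fun a b c => by simp only [transportMul_apply, h.mul_assoc]
  par_internal := isInternal_map h.par_internal e
  one_par := Submodule.mem_map_of_mem h.one_par
  mul_par := by
    rintro i j _ ⟨a, ha, rfl⟩ _ ⟨b, hb, rfl⟩
    exact ⟨_, h.mul_par i j a ha b hb, (transportMul_apply _ _ _ _).symm⟩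
  supercomm := by
    rintro i j _ ⟨a, ha, rfl⟩ _ ⟨b, hb, rfl⟩
    simp only [LinearEquiv.coe_coe, transportMul_apply]
    rw [h.supercomm i j a ha b hb, map_smul]

theorem IsRefinedGrading.transport {mul : A →ₗ[ℂ] A →ₗ[ℂ] A} {one : A}
    {par : ZMod 2 → Submodule ℂ A} {gr : ℝ × ℝ → Submodule ℂ A}
    (h : IsRefinedGrading mul one par gr) (e : A ≃ₗ[ℂ] B) :
    IsRefinedGrading (transportMul mul e) (e one) (fun i => (par i).map e.toLinearMap)
      fun x => (gr x).map e.toLinearMap where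
  internal := isInternal_map h.internal e
  one_gr := Submodule.mem_map_of_mem h.one_gr
  mul_gr := by
    rintro x y _ ⟨a, ha, rfl⟩ _ ⟨b, hb, rfl⟩
    exact ⟨_, h.mul_gr x y a ha b hb, (transportMul_apply _ _ _ _).symm⟩
  refines x hx := by
    obtain ⟨n, hn, hle⟩ := h.refines x fun h0 => hx (by simp [h0])
    exact ⟨n, hn, Submodule.map_mono hle⟩

end Transport

/-! ### Parity -/

theorem zmod_two_cases : ∀ i : ZMod 2, i = 0 ∨ i = 1 := by decide

theorem zmod_two_val_cases (i : ZMod 2) : i.val = 0 ∨ i.val = 1 := by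
  have := ZMod.val_lt i
  omega

theorem fermion_cases (x : ℝ) : fermion x = 0 ∨ fermion x = 1 := by
  unfold fermion
  split_ifs <;> simp

namespace FullVertexSuperalgebra

variable {F : Type*} [AddCommGroup F] [Module ℂ F] (V : FullVertexSuperalgebra F)

theorem sgn_of_mem_par {i : ZMod 2} {v : F} (hv : v ∈ V.par i) :
    V.sgn v = (-1 : ℂ) ^ i.val • v := by
  refine Submodule.iSup_induction
    (fun x : {x : ℝ × ℝ // ∃ n : ℤ, x.1 - x.2 = n + (i.val : ℝ) / 2} => V.wt x.1.1 x.1.2)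
    (motive := fun v => V.sgn v = (-1 : ℂ) ^ i.val • v) hv ?_ (by simp) ?_
  · rintro ⟨⟨h, hb⟩, n, hn⟩ v hv
    rw [V.sgn_apply hv]
    congr 2
    simp only at hn
    rw [hn]
    rcases zmod_two_cases i with rfl | rfl
    · simpa using fermion_int n
    · have h1 : (ZMod.val (1 : ZMod 2)) = 1 := rfl
      rw [h1, Nat.cast_one, fermion_half_int]
  · intro v w hv hw
    rw [map_add, hv, hw, smul_add]

theorem wt_le_par {h hb : ℝ} {i : ZMod 2} (hi : fermion (h - hb) = i.val) : V.wt h hb ≤ V.par i := by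
  intro v hv
  by_cases h0 : v = 0
  · rw [h0]; exact zero_mem _
  · obtain ⟨n, hn⟩ := V.spin_of_ne_zero hv h0
    refine Submodule.mem_iSup_of_mem ⟨(h, hb), ?_⟩ hv
    simp only
    rcases Int.even_or_odd' n with ⟨k, rfl | rfl⟩
    · refine ⟨k, ?_⟩
      have e : h - hb = (k : ℝ) := by rw [hn]; push_cast; ring
      rw [e, fermion_int] at hi
      rw [e, ← hi]; simp
    · refine ⟨k, ?_⟩
      have e : h - hb = (k : ℝ) + 1 / 2 := by rw [hn]; push_cast; ring
      rw [e, fermion_half_int] at hi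
      rw [e, ← hi]; simp

/-- For every w, the vector w + (-1)^i (-1)^F w is twice the projection of w to parity i; on an
eigenvector of the right sign it is 2w. -/
theorem mem_par_iff {i : ZMod 2} {v : F} : v ∈ V.par i ↔ V.sgn v = (-1 : ℂ) ^ i.val • v := by
  refine ⟨V.sgn_of_mem_par, fun h => ?_⟩
  have key : ∀ w : F, w + (-1 : ℂ) ^ i.val • V.sgn w ∈ V.par i := by
    intro w
    induction w using V.wt_induction with
    | add v w hv hw =>
      have := add_mem hv hw
      rw [map_add, smul_add]
      convert this using 1
      abel
    | mem k kb w hw =>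
      rw [V.sgn_apply hw, smul_smul]
      by_cases hi : fermion (k - kb) = i.val
      · exact add_mem (V.wt_le_par hi hw) (Submodule.smul_mem _ _ (V.wt_le_par hi hw))
      · have : (-1 : ℂ) ^ i.val * (-1) ^ fermion (k - kb) = -1 := by
          rcases fermion_cases (k - kb) with h1 | h1 <;> rcases zmod_two_val_cases i with h2 | h2 <;>
            first
            | exact absurd (h1.trans h2.symm) hi
            | norm_num [h1, h2]
        rw [this]
        simp
  have := key v
  rw [h, smul_smul, ← mul_pow, neg_one_mul, neg_neg, one_pow, one_smul, ← two_smul ℂ] at this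
  exact (Submodule.smul_mem_iff _ two_ne_zero).1 this

theorem fermion_eq_of_mem_par {i : ZMod 2} {h hb : ℝ} {v : F} (hv : v ∈ V.par i)
    (hw : v ∈ V.wt h hb) (h0 : v ≠ 0) : fermion (h - hb) = i.val := by
  have := V.sgn_of_mem_par hv
  rw [V.sgn_apply hw] at this
  have := smul_left_injective ℂ h0 this
  rcases fermion_cases (h - hb) with h1 | h1 <;> rcases zmod_two_val_cases i with h2 | h2 <;>
    rw [h1, h2] at this ⊢ <;> norm_num at this

theorem Y_mem_par (r s : ℝ) {i j : ZMod 2} {a b : F} (ha : a ∈ V.par i) (hb : b ∈ V.par j) :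
    V.Y r s a b ∈ V.par (i + j) := by
  rw [mem_par_iff] at *
  rw [V.sgn_Y, ha, hb, map_smul, map_smul, LinearMap.smul_apply, smul_smul, ← pow_add]
  congr 1
  rw [ZMod.val_add, ← neg_one_pow_eq_pow_mod_two, add_comm]

theorem one_mem_par : V.one ∈ V.par 0 :=
  V.wt_le_par (by simpa using fermion_int 0) V.one_wt

end FullVertexSuperalgebra

namespace N22FullVOA

variable {F : Type*} [AddCommGroup F] [Module ℂ F] (V : N22FullVOA F)

/-! ### The Laplacian is an even derivation -/

theorem weight_Y (a b : F) :
    V.L 0 (V.Y (-1) (-1) a b) = V.Y (-1) (-1) (V.L 0 a) b + V.Y (-1) (-1) a (V.L 0 b) ∧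
    V.Lb 0 (V.Y (-1) (-1) a b) = V.Y (-1) (-1) (V.Lb 0 a) b + V.Y (-1) (-1) a (V.Lb 0 b) := by
  induction a using V.wt_induction with
  | add v w hv hw =>
    simp only [map_add, LinearMap.add_apply, hv.1, hv.2, hw.1, hw.2]
    constructor <;> abel
  | mem h hb a ha =>
    induction b using V.wt_induction with
    | add v w hv hw =>
      simp only [map_add, hv.1, hv.2, hw.1, hw.2]
      constructor <;> abel
    | mem h' hb' b hb2 =>
      have := V.Y_mem (r := -1) (s := -1) (k := h + h') (kb := hb + hb') ha hb2 (by ring) (by ring)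
      simp only [V.L_zero_apply this, V.Lb_zero_apply this, V.L_zero_apply ha, V.Lb_zero_apply ha,
        V.L_zero_apply hb2, V.Lb_zero_apply hb2, map_smul, LinearMap.smul_apply, ← add_smul]
      push_cast
      exact ⟨rfl, rfl⟩

/-- Weights and charges both add under the (-1,-1)-product. The kernel of a derivation is a
subalgebra, so products of harmonic vectors need no correction. -/
theorem laplacian_Y (a b : F) : V.laplacian (V.Y (-1) (-1) a b) =
    V.Y (-1) (-1) (V.laplacian a) b + V.Y (-1) (-1) a (V.laplacian b) := by
  simp only [laplacian, lap, lapb, LinearMap.add_apply, LinearMap.sub_apply, LinearMap.smul_apply,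
    (V.weight_Y a b).1, (V.weight_Y a b).2, V.Jop_zero_Y, V.Jbop_zero_Y, map_add, map_sub,
    map_smul, smul_add]
  abel

theorem sgn_commute (v : F) : V.sgn (V.L 0 v) = V.L 0 (V.sgn v) ∧
    V.sgn (V.Lb 0 v) = V.Lb 0 (V.sgn v) ∧ V.sgn (V.Jop 0 v) = V.Jop 0 (V.sgn v) ∧
    V.sgn (V.Jbop 0 v) = V.Jbop 0 (V.sgn v) := by
  have key : ∀ {h hb : ℝ} {a : F} (n : ℤ), a ∈ V.wt h hb → h - hb = n → V.sgn a = a := by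
    intro h hb a n ha hn
    rw [V.sgn_apply ha, hn, fermion_int, pow_zero, one_smul]
  have h1 := key 2 V.ω_wt (by norm_num)
  have h2 := key (-2) V.ωb_wt (by norm_num)
  have h3 := key 1 V.J_wt (by norm_num)
  have h4 := key (-1) V.Jb_wt (by norm_num)
  refine ⟨?_, ?_, ?_, ?_⟩
  · rw [FullVOA.L, V.sgn_Y, h1]
  · rw [FullVOA.Lb, V.sgn_Y, h2]
  · rw [PreN22FullVOA.Jop, V.sgn_Y, h3]
  · rw [PreN22FullVOA.Jbop, V.sgn_Y, h4]

theorem par_invariant (i : ZMod 2) {v : F} (hv : v ∈ V.par i) : V.L 0 v ∈ V.par i ∧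
    V.Lb 0 v ∈ V.par i ∧ V.Jop 0 v ∈ V.par i ∧ V.Jbop 0 v ∈ V.par i := by
  obtain ⟨h1, h2, h3, h4⟩ := V.sgn_commute v
  rw [V.mem_par_iff] at hv
  simp only [V.mem_par_iff, h1, h2, h3, h4, hv, map_smul, and_self]

theorem laplacian_sgn (v : F) : V.laplacian (V.sgn v) = V.sgn (V.laplacian v) := by
  obtain ⟨h1, h2, h3, h4⟩ := V.sgn_commute v
  simp only [laplacian, lap, lapb, LinearMap.add_apply, LinearMap.sub_apply, LinearMap.smul_apply,
    map_add, map_sub, map_smul, h1, h2, h3, h4]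

theorem laplacian_mem_par (i : ZMod 2) : ∀ v ∈ V.par i, V.laplacian v ∈ V.par i :=
  V.laplacian_mem (fun _ hv => (V.par_invariant i hv).1) (fun _ hv => (V.par_invariant i hv).2.1)
    (fun _ hv => (V.par_invariant i hv).2.2.1) fun _ hv => (V.par_invariant i hv).2.2.2

theorem mem_eigenspace_of_commute {S T : Module.End ℂ F} (h : Commute S T) {k : ℂ} {v : F}
    (hv : T v = k • v) : T (S v) = k • S v := by
  rw [← Module.End.mul_apply, ← h.eq, Module.End.mul_apply, hv, map_smul]

theorem laplacian_mem_charge (p q : ℝ) :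
    ∀ v ∈ V.charge p q, V.laplacian v ∈ V.charge p q := by
  have key : ∀ {S : Module.End ℂ F}, Commute S (V.Jop 0) → Commute S (V.Jbop 0) →
      ∀ v ∈ V.charge p q, S v ∈ V.charge p q := by
    intro S h1 h2 v hv
    rw [mem_charge] at *
    exact ⟨mem_eigenspace_of_commute h1 hv.1, mem_eigenspace_of_commute h2 hv.2⟩
  have hJJ := V.commute_even V.Jop_zero_mem V.Jbop_zero_mem
  exact V.laplacian_mem (key V.left_rel.commute_L_J (V.commute_even V.L_zero_mem V.Jbop_zero_mem))
    (key (V.commute_even V.Jop_zero_mem V.Lb_zero_mem).symm V.right_rel.commute_L_J)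
    (key (Commute.refl _) hJJ) (key hJJ.symm (Commute.refl _))

theorem ker_laplacian_invariant {v : F} (hv : V.laplacian v = 0) :
    V.laplacian (V.L 0 v) = 0 ∧ V.laplacian (V.Lb 0 v) = 0 ∧ V.laplacian (V.Jop 0 v) = 0 ∧
      V.laplacian (V.Jbop 0 v) = 0 := by
  have key : ∀ {S : Module.End ℂ F}, Commute S (V.L 0) → Commute S (V.Lb 0) →
      Commute S (V.Jop 0) → Commute S (V.Jbop 0) → V.laplacian (S v) = 0 := by
    intro S h1 h2 h3 h4
    have : Commute S V.laplacian :=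
      (h1.sub_right (h3.smul_right _)).add_right (h2.sub_right (h4.smul_right _))
    rw [← Module.End.mul_apply, ← this.eq, Module.End.mul_apply, hv, map_zero]
  have c1 := V.commute_even V.L_zero_mem V.Lb_zero_mem
  have c2 := V.left_rel.commute_L_J
  have c3 := V.commute_even V.L_zero_mem V.Jbop_zero_mem
  have c4 := V.commute_even V.Jop_zero_mem V.Lb_zero_mem
  have c5 := V.right_rel.commute_L_J
  have c6 := V.commute_even V.Jop_zero_mem V.Jbop_zero_mem
  exact ⟨key (.refl _) c1 c2 c3, key c1.symm (.refl _) c4.symm c5, key c2.symm c4 (.refl _) c6,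
    key c3.symm c5.symm c6.symm (.refl _)⟩

theorem exists_int_of_mem_charge {p q : ℝ} {v : F} (hv : v ∈ V.charge p q) (h0 : v ≠ 0) :
    ∃ n : ℤ, p - q = n := by
  rw [mem_charge] at hv
  have hev : (V.Jop 0 - V.Jbop 0).HasEigenvalue ((p - q : ℝ) : ℂ) := by
    refine Module.End.hasEigenvalue_of_hasEigenvector (x := v)
      ⟨Module.End.mem_eigenspace_iff.2 ?_, h0⟩
    rw [LinearMap.sub_apply, hv.1, hv.2, ← sub_smul]
    push_cast
    rfl
  obtain ⟨n, hn⟩ := V.charge_int _ hev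
  exact ⟨n, by exact_mod_cast hn⟩

theorem charge_le_par {p q : ℝ} {n : ℤ} (hn : p - q = n) :
    V.charge p q ≤ V.par (n : ZMod 2) := by
  intro v hv
  rw [mem_charge] at hv
  refine V.charge_par n (Module.End.mem_eigenspace_iff.2 ?_)
  rw [LinearMap.sub_apply, hv.1, hv.2, ← sub_smul]
  congr 1
  exact_mod_cast hn

end N22FullVOA

namespace UnitaryN22FullVOA

variable {F : Type*} [AddCommGroup F] [Module ℂ F] (V : UnitaryN22FullVOA F)

/-! ### Harmonic vectors are chiral-chiral primary -/

/-- G⁺_{-1/2} and G⁻_{1/2} are mutually adjoint, so the half Laplacian has the form AA* + A*A and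
its expectation value is a sum of squared norms. -/
theorem ip_lap (v : F) : V.ip v (V.lap v) =
    V.ip (V.Gm (1 / 2) v) (V.Gm (1 / 2) v) + V.ip (V.Gp (-1 / 2) v) (V.Gp (-1 / 2) v) := by
  rw [V.lap_eq, LinearMap.add_apply, Module.End.mul_apply, Module.End.mul_apply, V.ip_add_right,
    V.ip_Gp _ v, V.ip_Gm _ v (V.Gp _ _), show -(-1 / 2 : ℝ) = 1 / 2 by norm_num,
    show -(1 / 2 : ℝ) = -1 / 2 by norm_num]

theorem ip_lapb (v : F) : V.ip v (V.lapb v) =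
    V.ip (V.Gbm (1 / 2) v) (V.Gbm (1 / 2) v) + V.ip (V.Gbp (-1 / 2) v) (V.Gbp (-1 / 2) v) := by
  rw [V.lapb_eq, LinearMap.add_apply, Module.End.mul_apply, Module.End.mul_apply, V.ip_add_right,
    V.ip_Gbp _ v, V.ip_Gbm _ v (V.Gbp _ _), show -(-1 / 2 : ℝ) = 1 / 2 by norm_num,
    show -(1 / 2 : ℝ) = -1 / 2 by norm_num]

/-- The unitarity bound. -/
theorem eq_zero_of_lap_neg {T : Module.End ℂ F} (hT : ∀ v, 0 ≤ (V.ip v (T v)).re) {v : F} {k : ℝ}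
    (hk : k < 0) (hv : T v = (k : ℂ) • v) : v = 0 := by
  have h := hT v
  rw [hv, V.ip_smul_right, Complex.re_ofReal_mul] at h
  exact V.eq_zero_of_ip_self (by nlinarith)

theorem ip_lap_nonneg (v : F) : 0 ≤ (V.ip v (V.lap v)).re := by
  rw [V.ip_lap, Complex.add_re]
  exact add_nonneg (V.ip_self_nonneg _) (V.ip_self_nonneg _)

theorem ip_lapb_nonneg (v : F) : 0 ≤ (V.ip v (V.lapb v)).re := by
  rw [V.ip_lapb, Complex.add_re]
  exact add_nonneg (V.ip_self_nonneg _) (V.ip_self_nonneg _)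

/-- The expectation value of the Laplacian is a sum of four squared norms, so all of them vanish. -/
theorem harmonic {v : F} (hv : V.laplacian v = 0) :
    V.Gp (-1 / 2) v = 0 ∧ V.Gm (1 / 2) v = 0 ∧ V.Gbp (-1 / 2) v = 0 ∧ V.Gbm (1 / 2) v = 0 := by
  have h : (V.ip v (V.lap v)).re + (V.ip v (V.lapb v)).re = 0 := by
    rw [← Complex.add_re, ← V.ip_add_right, ← LinearMap.add_apply]
    change (V.ip v (V.laplacian v)).re = 0
    rw [hv, V.ip_zero_right, Complex.zero_re]
  rw [V.ip_lap, V.ip_lapb, Complex.add_re, Complex.add_re] at h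
  have h1 := V.ip_self_nonneg (V.Gp (-1 / 2) v)
  have h2 := V.ip_self_nonneg (V.Gm (1 / 2) v)
  have h3 := V.ip_self_nonneg (V.Gbp (-1 / 2) v)
  have h4 := V.ip_self_nonneg (V.Gbm (1 / 2) v)
  exact ⟨V.eq_zero_of_ip_self (by linarith), V.eq_zero_of_ip_self (by linarith),
    V.eq_zero_of_ip_self (by linarith), V.eq_zero_of_ip_self (by linarith)⟩

theorem lap_eq_zero {v : F} (hv : V.laplacian v = 0) : V.lap v = 0 ∧ V.lapb v = 0 := by
  obtain ⟨h1, h2, h3, h4⟩ := V.harmonic hv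
  rw [V.lap_eq, V.lapb_eq]
  simp only [LinearMap.add_apply, Module.End.mul_apply, h1, h2, h3, h4, map_zero, add_zero, and_self]

theorem d_eq_zero {v : F} (hv : V.laplacian v = 0) : V.d v = 0 := by
  obtain ⟨h1, -, h3, -⟩ := V.harmonic hv
  simp [N22FullVOA.d, h1, h3]

/-- Moving `d` across the form turns it into its adjoint, which kills harmonic vectors. In
particular a harmonic coboundary is orthogonal to itself. -/
theorem ip_d {v : F} (hv : V.laplacian v = 0) (w : F) : V.ip v (V.d w) = 0 := by
  obtain ⟨-, h2, -, h4⟩ := V.harmonic hv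
  rw [N22FullVOA.d, LinearMap.add_apply, V.ip_add_right, V.ip_Gp, V.ip_Gbp,
    show -(-1 / 2 : ℝ) = 1 / 2 by norm_num, h2, h4]
  simp [ip]

theorem eq_zero_of_mem_range {v : F} (hv : V.laplacian v = 0) (hr : v ∈ LinearMap.range V.d) :
    v = 0 := by
  obtain ⟨w, rfl⟩ := hr
  exact V.eq_zero_of_ip_self (by rw [V.ip_d hv]; simp)

/-- `harmonic` supplies the four modes ±1/2 that occur in the Laplacian; the other positive modes
are excluded by the unitarity bound, separately in each chirality. -/
theorem harmonic_mem_ccPrimary {v : F} (hv : V.laplacian v = 0) {h hb p q : ℝ}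
    (hwt : v ∈ V.wt h hb) (hch : v ∈ V.charge p q) : v ∈ V.ccPrimary h hb p q := by
  obtain ⟨h1, h2, h3, h4⟩ := V.harmonic hv
  obtain ⟨l1, l2⟩ := V.lap_eq_zero hv
  obtain ⟨a1, a2⟩ := V.left_rel.primary_of_bound
    (fun w k hk hw => V.eq_zero_of_lap_neg V.ip_lap_nonneg hk hw) l1 h2
  obtain ⟨b1, b2⟩ := V.right_rel.primary_of_bound
    (fun w k hk hw => V.eq_zero_of_lap_neg V.ip_lapb_nonneg hk hw) l2 h4
  exact ⟨hwt, hch, fun n hn => ⟨(a1 n hn).1, (b1 n hn).1, (a1 n hn).2, (b1 n hn).2⟩,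
    fun r hr hr2 => ⟨(a2 r hr hr2).1, (a2 r hr hr2).2, (b2 r hr hr2).1, (b2 r hr hr2).2⟩, h1, h3⟩

theorem laplacian_of_mem_ccPrimary {h hb p q : ℝ} {v : F} (hv : v ∈ V.ccPrimary h hb p q) :
    V.laplacian v = 0 := by
  obtain ⟨-, -, -, h4, h5, h6⟩ := hv
  obtain ⟨-, h7, -, h8⟩ := h4 _ half_mem le_rfl
  rw [V.laplacian_apply]
  simp only [N22FullVOA.d, N22FullVOA.dAdj, LinearMap.add_apply, h5, h6, h7, h8, map_zero, add_zero]

theorem harmonic_le {W : Submodule ℂ F} (hW : ∀ v ∈ W, V.laplacian v = 0) (hL : ∀ v ∈ W, V.L 0 v ∈ W)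
    (hLb : ∀ v ∈ W, V.Lb 0 v ∈ W) (hJ : ∀ v ∈ W, V.Jop 0 v ∈ W) (hJb : ∀ v ∈ W, V.Jbop 0 v ∈ W) :
    W ≤ ⨆ x : (ℝ × ℝ) × (ℝ × ℝ), W ⊓ V.ccPrimary x.1.1 x.1.2 x.2.1 x.2.2 :=
  (V.le_iSup_inf_joint hL hLb hJ hJb).trans <| iSup_mono fun _ _ hv =>
    ⟨hv.1, V.harmonic_mem_ccPrimary (hW _ hv.1) hv.2.1 hv.2.2⟩

/-- The pivot of the proof: the span of all c-c primaries becomes a single linear condition, since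
the kernel of the Laplacian splits into joint eigenvectors and each of these is c-c primary. -/
theorem mem_C_iff {v : F} : v ∈ V.C ↔ V.laplacian v = 0 := by
  constructor
  · intro hv
    have : V.C ≤ LinearMap.ker V.laplacian :=
      iSup_le fun _ _ hw => V.laplacian_of_mem_ccPrimary hw
    exact this hv
  · intro hv
    have := V.harmonic_le (W := LinearMap.ker V.laplacian) (fun _ h => h)
      (fun _ h => (V.ker_laplacian_invariant h).1) (fun _ h => (V.ker_laplacian_invariant h).2.1)
      (fun _ h => (V.ker_laplacian_invariant h).2.2.1)
      (fun _ h => (V.ker_laplacian_invariant h).2.2.2)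
    exact (this.trans (iSup_mono fun x => inf_le_right)) hv

theorem weight_of_harmonic {p q : ℝ} {v : F} (hv : V.laplacian v = 0) (hch : v ∈ V.charge p q) :
    v ∈ V.wt (p / 2) (q / 2) := by
  obtain ⟨l1, l2⟩ := V.lap_eq_zero hv
  rw [V.mem_charge] at hch
  rw [N22FullVOA.lap, LinearMap.sub_apply, LinearMap.smul_apply, hch.1, sub_eq_zero,
    smul_smul] at l1
  rw [N22FullVOA.lapb, LinearMap.sub_apply, LinearMap.smul_apply, hch.2, sub_eq_zero,
    smul_smul] at l2
  refine V.mem_wt_iff.2 ⟨l1.trans ?_, l2.trans ?_⟩ <;> congr 1 <;> push_cast <;> ring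

/-! ### Orthogonality of the homogeneous components -/

/-- 2L(0) is the sum of the anticommutators {G⁺_{-1/2}, G⁻_{1/2}} and {G⁺_{1/2}, G⁻_{-1/2}}, in
which the J(0)-terms cancel, so self-adjointness follows from that of the supercurrent modes. -/
theorem ip_L_zero (u v : F) : V.ip u (V.L 0 v) = V.ip (V.L 0 u) v := by
  have h1 := V.left_rel.anticomm_neg_pos
  have h2 := V.left_rel.anticomm_pos_neg
  have h : V.L 0 = ((1 / 2 : ℝ) : ℂ) • (V.Gp (-1 / 2) * V.Gm (1 / 2) + V.Gm (1 / 2) * V.Gp (-1 / 2) +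
      (V.Gp (1 / 2) * V.Gm (-1 / 2) + V.Gm (-1 / 2) * V.Gp (1 / 2))) := by
    rw [h1, h2]
    push_cast
    module
  rw [h]
  simp only [LinearMap.smul_apply, LinearMap.add_apply, Module.End.mul_apply, V.ip_smul_left,
    V.ip_smul_right, V.ip_add_left, V.ip_add_right, V.ip_Gp, V.ip_Gm,
    show -(-1 / 2 : ℝ) = 1 / 2 by norm_num, show -(1 / 2 : ℝ) = -1 / 2 by norm_num]

theorem ip_Lb_zero (u v : F) : V.ip u (V.Lb 0 v) = V.ip (V.Lb 0 u) v := by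
  have h1 := V.right_rel.anticomm_neg_pos
  have h2 := V.right_rel.anticomm_pos_neg
  have h : V.Lb 0 = ((1 / 2 : ℝ) : ℂ) •
      (V.Gbp (-1 / 2) * V.Gbm (1 / 2) + V.Gbm (1 / 2) * V.Gbp (-1 / 2) +
      (V.Gbp (1 / 2) * V.Gbm (-1 / 2) + V.Gbm (-1 / 2) * V.Gbp (1 / 2))) := by
    rw [h1, h2]
    push_cast
    module
  rw [h]
  simp only [LinearMap.smul_apply, LinearMap.add_apply, Module.End.mul_apply, V.ip_smul_left,
    V.ip_smul_right, V.ip_add_left, V.ip_add_right, V.ip_Gbp, V.ip_Gbm,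
    show -(-1 / 2 : ℝ) = 1 / 2 by norm_num, show -(1 / 2 : ℝ) = -1 / 2 by norm_num]

theorem ip_orthogonal {h hb h' hb' : ℝ} (hne : (h', hb') ≠ (h, hb)) {u v : F} (hu : u ∈ V.wt h hb)
    (hv : v ∈ V.wt h' hb') : V.ip u v = 0 := by
  have e1 := V.ip_L_zero u v
  have e2 := V.ip_Lb_zero u v
  rw [V.L_zero_apply hu, V.L_zero_apply hv, V.ip_smul_left, V.ip_smul_right] at e1
  rw [V.Lb_zero_apply hu, V.Lb_zero_apply hv, V.ip_smul_left, V.ip_smul_right] at e2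
  by_contra h0
  have e1' := mul_right_cancel₀ h0 e1
  have e2' := mul_right_cancel₀ h0 e2
  exact hne (Prod.ext (by exact_mod_cast e1') (by exact_mod_cast e2'))

/-! ### The chiral ring -/

theorem Y_mem_C {a b : F} (ha : a ∈ V.C) (hb : b ∈ V.C) : V.Y (-1) (-1) a b ∈ V.C := by
  rw [V.mem_C_iff] at *
  simp [V.laplacian_Y, ha, hb]

theorem one_mem_C : V.one ∈ V.C := by
  rw [V.mem_C_iff, V.laplacian_apply, V.d_one]
  obtain ⟨-, h1, -, h2⟩ := V.Gp_one (r := 1 / 2) (n := 1) (by norm_num) (by norm_num)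
  simp only [N22FullVOA.dAdj, LinearMap.add_apply, h1, h2, map_zero, add_zero]

theorem C_induction {p : F → Prop}
    (mem : ∀ h hb, ∀ v ∈ V.C, v ∈ V.wt h hb → p v)
    (add : ∀ v w, p v → p w → p (v + w)) {v : F} (hv : v ∈ V.C) : p v :=
  Submodule.iSup_induction
    (fun x : (ℝ × ℝ) × (ℝ × ℝ) => V.ccPrimary x.1.1 x.1.2 x.2.1 x.2.2) (motive := p) hv
    (fun _ v hv => mem _ _ v (V.mem_C_iff.2 (V.laplacian_of_mem_ccPrimary hv)) hv.1)
    (mem 0 0 0 (zero_mem _) (zero_mem _)) add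

/-- Two homogeneous harmonic vectors are equal if no functional vanishing on coboundaries separates
them. -/
theorem eq_of_forall_functional {h hb : ℝ} {x y : F} (hx : x ∈ V.C) (hy : y ∈ V.C)
    (hxw : x ∈ V.wt h hb) (hyw : y ∈ V.wt h hb)
    (H : ∀ u : F →ₗ[ℂ] ℂ, (∀ h' hb' : ℝ, (h', hb') ≠ (h, hb) → ∀ v ∈ V.wt h' hb', u v = 0) →
      (∀ v, u (V.d v) = 0) → u x = u y) : x = y := by
  have hC := V.mem_C_iff.1 (V.C.sub_mem hx hy)
  have hw := (V.wt h hb).sub_mem hxw hyw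
  -- The functional ⟨x - y, ·⟩ is supported on one weight by orthogonality and vanishes on
  -- coboundaries because x - y is harmonic; equality on it says that x - y has norm zero.
  have := H (V.form (V.φ (x - y))) (fun h' hb' hne v hv => V.ip_orthogonal hne hw hv)
    (fun v => V.ip_d hC v)
  rw [← sub_eq_zero, ← map_sub] at this
  exact sub_eq_zero.1 (V.eq_zero_of_ip_self (by rw [ip, this]; simp))

/-- Both sides are harmonic, so it suffices to test with functionals vanishing on coboundaries, for
which associativity is known. The three inductions reduce to homogeneous vectors, as the bootstrap
axiom requires. -/
theorem Y_assoc {a b c : F} (ha : a ∈ V.C) (hb : b ∈ V.C) (hc : c ∈ V.C) :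
    V.Y (-1) (-1) (V.Y (-1) (-1) a b) c = V.Y (-1) (-1) a (V.Y (-1) (-1) b c) := by
  refine V.C_induction (p := fun a => V.Y (-1) (-1) (V.Y (-1) (-1) a b) c =
    V.Y (-1) (-1) a (V.Y (-1) (-1) b c)) ?_ ?_ ha
  swap
  · intro v w hv hw
    simp only [map_add, LinearMap.add_apply, hv, hw]
  intro h₁ hb₁ a ha haw
  refine V.C_induction (p := fun b => V.Y (-1) (-1) (V.Y (-1) (-1) a b) c =
    V.Y (-1) (-1) a (V.Y (-1) (-1) b c)) ?_ ?_ hb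
  swap
  · intro v w hv hw
    simp only [map_add, LinearMap.add_apply, hv, hw]
  intro h₂ hb₂ b hb hbw
  refine V.C_induction (p := fun c => V.Y (-1) (-1) (V.Y (-1) (-1) a b) c =
    V.Y (-1) (-1) a (V.Y (-1) (-1) b c)) ?_ ?_ hc
  swap
  · intro v w hv hw
    simp only [map_add, hv, hw]
  intro h₃ hb₃ c hc hcw
  refine V.eq_of_forall_functional (h := h₁ + h₂ + h₃) (hb := hb₁ + hb₂ + hb₃)
    (V.Y_mem_C (V.Y_mem_C ha hb) hc) (V.Y_mem_C ha (V.Y_mem_C hb hc))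
    (V.Y_mem (V.Y_mem haw hbw rfl rfl) hcw (by ring) (by ring))
    (V.Y_mem haw (V.Y_mem hbw hcw rfl rfl) (by ring) (by ring)) fun u hu hud => ?_
  exact (V.apply_product_relations haw hbw hcw (V.C_le_ker ha) (V.C_le_ker hb) (V.C_le_ker hc)
    hu hud).1.symm

theorem Y_supercomm_of_mem {h₁ hb₁ h₂ hb₂ : ℝ} {a b : F} (ha : a ∈ V.C) (hb : b ∈ V.C)
    (haw : a ∈ V.wt h₁ hb₁) (hbw : b ∈ V.wt h₂ hb₂) : V.Y (-1) (-1) a b =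
      (-1 : ℂ) ^ (fermion (h₁ - hb₁) * fermion (h₂ - hb₂)) • V.Y (-1) (-1) b a := by
  refine V.eq_of_forall_functional (h := h₁ + h₂) (hb := hb₁ + hb₂) (V.Y_mem_C ha hb)
    (V.C.smul_mem _ (V.Y_mem_C hb ha)) (V.Y_mem haw hbw (by ring) (by ring))
    (Submodule.smul_mem _ _ (V.Y_mem hbw haw (by ring) (by ring))) fun u hu hud => ?_
  -- With the vacuum as third vector, locality of the correlator becomes supercommutativity of the
  -- product.
  have := (V.apply_product_relations haw hbw V.one_wt (V.C_le_ker ha) (V.C_le_ker hb) V.d_one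
    hu hud).2
  rwa [V.creation_eq, V.creation_eq, ← smul_eq_mul, ← map_smul] at this

/-- Refines `C_induction`: harmonicity and parity are both stable under the four grading operators,
so the homogeneous components keep the parity and the sign rule can be read off their spins. -/
theorem par_induction {i : ZMod 2} {p : F → Prop}
    (mem : ∀ h hb, ∀ v ∈ V.C, v ∈ V.wt h hb → v ∈ V.par i → p v)
    (add : ∀ v w, p v → p w → p (v + w)) {v : F} (hv : v ∈ V.C) (hvi : v ∈ V.par i) : p v := by
  have := V.harmonic_le (W := LinearMap.ker V.laplacian ⊓ V.par i) (fun _ h => h.1)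
    (fun _ h => ⟨(V.ker_laplacian_invariant h.1).1, (V.par_invariant i h.2).1⟩)
    (fun _ h => ⟨(V.ker_laplacian_invariant h.1).2.1, (V.par_invariant i h.2).2.1⟩)
    (fun _ h => ⟨(V.ker_laplacian_invariant h.1).2.2.1, (V.par_invariant i h.2).2.2.1⟩)
    (fun _ h => ⟨(V.ker_laplacian_invariant h.1).2.2.2, (V.par_invariant i h.2).2.2.2⟩)
  exact Submodule.iSup_induction _ (motive := p) (this ⟨V.mem_C_iff.1 hv, hvi⟩)
    (fun x v hv => mem _ _ v (V.mem_C_iff.2 hv.1.1) hv.2.1 hv.1.2)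
    (mem 0 0 0 (zero_mem _) (zero_mem _) (zero_mem _)) add

theorem Y_supercomm {i j : ZMod 2} {a b : F} (ha : a ∈ V.C) (hb : b ∈ V.C) (hai : a ∈ V.par i)
    (hbj : b ∈ V.par j) :
    V.Y (-1) (-1) a b = (-1 : ℂ) ^ (i.val * j.val) • V.Y (-1) (-1) b a := by
  refine V.par_induction (p := fun a => V.Y (-1) (-1) a b =
    (-1 : ℂ) ^ (i.val * j.val) • V.Y (-1) (-1) b a) ?_ ?_ ha hai
  swap
  · intro v w hv hw
    simp only [map_add, LinearMap.add_apply, hv, hw, smul_add]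
  intro h₁ hb₁ a ha haw hai
  refine V.par_induction (p := fun b => V.Y (-1) (-1) a b =
    (-1 : ℂ) ^ (i.val * j.val) • V.Y (-1) (-1) b a) ?_ ?_ hb hbj
  swap
  · intro v w hv hw
    simp only [map_add, LinearMap.add_apply, hv, hw, smul_add]
  intro h₂ hb₂ b hb hbw hbj
  by_cases ha0 : a = 0
  · simp [ha0]
  by_cases hb0 : b = 0
  · simp [hb0]
  rw [V.Y_supercomm_of_mem ha hb haw hbw, V.fermion_eq_of_mem_par hai haw ha0,
    V.fermion_eq_of_mem_par hbj hbw hb0]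

/-- The product of `C(F)`. -/
def mulC : ↥V.C →ₗ[ℂ] ↥V.C →ₗ[ℂ] ↥V.C :=
  LinearMap.mk₂ ℂ (fun v w => ⟨V.Y (-1) (-1) v w, V.Y_mem_C v.2 w.2⟩)
    (fun _ _ _ => Subtype.ext (by simp)) (fun _ _ _ => Subtype.ext (by simp))
    (fun _ _ _ => Subtype.ext (by simp)) (fun _ _ _ => Subtype.ext (by simp))

theorem coe_mulC (v w : ↥V.C) : (V.mulC v w : F) = V.Y (-1) (-1) (v : F) (w : F) := rfl

/-- The unit of `C(F)`. -/
def oneC : ↥V.C := ⟨V.one, V.one_mem_C⟩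

theorem isInternal_Cpar : DirectSum.IsInternal V.Cpar := by
  rw [DirectSum.isInternal_submodule_iff_isCompl V.Cpar (i := 0) (j := 1) (by decide)
    (by ext i; simpa using zmod_two_cases i)]
  constructor
  · rw [Submodule.disjoint_def]
    rintro ⟨v, hv⟩ h0 h1
    have e0 := V.sgn_of_mem_par (show v ∈ V.par 0 from h0)
    have e1 := V.sgn_of_mem_par (show v ∈ V.par 1 from h1)
    rw [e0] at e1
    have e2 : (2 : ℂ) • v = 0 := by
      have h1 : (ZMod.val (1 : ZMod 2)) = 1 := rfl
      rw [ZMod.val_zero, h1, pow_zero, one_smul, pow_one, neg_one_smul] at e1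
      rw [two_smul]
      nth_rw 1 [e1]
      exact neg_add_cancel v
    exact Subtype.ext ((smul_eq_zero.1 e2).resolve_left two_ne_zero)
  · rw [codisjoint_iff, eq_top_iff]
    rintro ⟨v, hv⟩ -
    -- The sign operator commutes with the Laplacian, so the projections (1 ± (-1)^F)/2 stay inside
    -- C(F).
    have hs : V.sgn v ∈ V.C := by
      rw [V.mem_C_iff] at *
      rw [V.laplacian_sgn, hv, map_zero]
    refine Submodule.mem_sup.2 ⟨⟨(1 / 2 : ℂ) • (v + V.sgn v), V.C.smul_mem _ (add_mem hv hs)⟩, ?_,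
      ⟨(1 / 2 : ℂ) • (v - V.sgn v), V.C.smul_mem _ (sub_mem hv hs)⟩, ?_, Subtype.ext ?_⟩
    · refine (V.mem_par_iff (i := 0)).2 ?_
      simp only [Submodule.coe_subtype, map_smul, map_add, V.sgn_sgn, ZMod.val_zero]
      module
    · refine (V.mem_par_iff (i := 1)).2 ?_
      have h1 : (ZMod.val (1 : ZMod 2)) = 1 := rfl
      simp only [Submodule.coe_subtype, map_smul, map_sub, V.sgn_sgn, h1]
      module
    · simp only [Submodule.coe_add]
      module

theorem isSupercommAlgebra_C : IsSupercommAlgebra V.mulC V.oneC V.Cpar where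
  one_mul a := Subtype.ext (by
    rw [coe_mulC]
    exact LinearMap.congr_fun V.one_Y (a : F))
  mul_one a := Subtype.ext (V.creation_eq a)
  mul_assoc a b c := Subtype.ext (V.Y_assoc a.2 b.2 c.2)
  par_internal := V.isInternal_Cpar
  one_par := V.one_mem_par
  mul_par i j a ha b hb := V.Y_mem_par (-1) (-1) (a := (a : F)) (b := (b : F)) ha hb
  supercomm i j a ha b hb := Subtype.ext (V.Y_supercomm a.2 b.2 ha hb)

/-- On harmonic vectors L(0) = J(0)/2 and likewise for the conjugates, so the charges determine the
weights. -/
theorem map_Ccharge (p q : ℝ) :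
    (V.Ccharge (p, q)).map V.C.subtype = V.ccPrimary (p / 2) (q / 2) p q := by
  ext v
  constructor
  · rintro ⟨⟨w, hw⟩, hch, rfl⟩
    rw [V.mem_C_iff] at hw
    exact V.harmonic_mem_ccPrimary hw (V.weight_of_harmonic hw hch) hch
  · intro hv
    exact ⟨⟨v, V.mem_C_iff.2 (V.laplacian_of_mem_ccPrimary hv)⟩, hv.2.1, rfl⟩

theorem isRefinedGrading_C : IsRefinedGrading V.mulC V.oneC V.Cpar V.Ccharge where
  internal := by
    rw [DirectSum.isInternal_submodule_iff_iSupIndep_and_iSup_eq_top]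
    constructor
    -- The piece of charge (p, q) lies in weight (p/2, q/2), so independence is inherited from the
    -- weight spaces.
    · refine iSupIndep_of_map V.C.subtype V.C.injective_subtype ?_
      have hinj : Function.Injective fun x : ℝ × ℝ => (x.1 / 2, x.2 / 2) := by
        intro x y h
        obtain ⟨h1, h2⟩ := Prod.mk.inj h
        exact Prod.ext (by linarith) (by linarith)
      refine (V.iSupIndep_wt.comp hinj).mono fun x v hv => ?_
      rw [V.map_Ccharge x.1 x.2] at hv
      exact hv.1
    · refine Submodule.map_injective_of_injective V.C.injective_subtype ?_
      rw [Submodule.map_subtype_top, Submodule.map_iSup]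
      refine le_antisymm (iSup_le fun x => Submodule.map_subtype_le _ _)
        (iSup_le fun x => le_iSup_of_le x.2 fun v hv => ?_)
      exact ⟨⟨v, V.mem_C_iff.2 (V.laplacian_of_mem_ccPrimary hv)⟩, hv.2.1, rfl⟩
  one_gr := V.one_mem_charge
  mul_gr x y a ha b hb := V.Y_mem_charge (-1) (-1) (a := (a : F)) (b := (b : F)) ha hb
  refines x hx := by
    obtain ⟨v, hv, h0⟩ := Submodule.exists_mem_ne_zero_of_ne_bot hx
    obtain ⟨n, hn⟩ := V.exists_int_of_mem_charge (v := (v : F)) hv (by simpa using h0)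
    exact ⟨n, hn, Submodule.comap_mono (V.charge_le_par hn)⟩

/-! ### The comparison with the cohomology -/

theorem R_eq_cls {c : ↥V.C} {a : ↥(LinearMap.ker V.d)}
    (h : (a : F) - c ∈ LinearMap.range V.d) : V.R c = V.cls a :=
  ((Submodule.Quotient.eq _).2 (show a - Submodule.inclusion V.C_le_ker c ∈ V.boundaries from h)).symm

/-- Injective because a harmonic coboundary is zero, surjective by the Hodge decomposition. -/
theorem bijective_R : Function.Bijective V.R := by
  constructor
  · rw [injective_iff_map_eq_zero]
    rintro ⟨c, hc⟩ h0
    have : (Submodule.inclusion V.C_le_ker ⟨c, hc⟩) ∈ V.boundaries :=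
      (Submodule.Quotient.mk_eq_zero _).1 h0
    exact Subtype.ext (V.eq_zero_of_mem_range (V.mem_C_iff.1 hc) this)
  · intro x
    obtain ⟨⟨a, ha⟩, rfl⟩ := Submodule.mkQ_surjective _ x
    obtain ⟨c, -, hc, hr⟩ := V.exists_harmonic (W := ⊤) (fun _ _ => trivial) (a := a) trivial ha
    exact ⟨⟨c, V.mem_C_iff.2 hc⟩, V.R_eq_cls hr⟩

/-- A class with a representative in a Laplacian-stable subspace has its harmonic representative
there too. Parity and charge spaces are such subspaces, so this matches both gradings. -/
theorem map_R_comap {W : Submodule ℂ F} (hW : ∀ v ∈ W, V.laplacian v ∈ W) :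
    (W.comap V.C.subtype).map V.R =
      (W.comap (LinearMap.ker V.d).subtype).map V.cls := by
  refine le_antisymm ?_ ?_
  · rintro _ ⟨c, hc, rfl⟩
    exact ⟨Submodule.inclusion V.C_le_ker c, hc, rfl⟩
  · rintro _ ⟨⟨a, ha⟩, haW, rfl⟩
    obtain ⟨c, hcW, hc, hr⟩ := V.exists_harmonic hW haW ha
    exact ⟨⟨c, V.mem_C_iff.2 hc⟩, hcW, V.R_eq_cls hr⟩

/-- `R` as an isomorphism. -/
def equivR : ↥V.C ≃ₗ[ℂ] V.H := LinearEquiv.ofBijective V.R V.bijective_R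

/-- The product on the cohomology. -/
def mulH : V.H →ₗ[ℂ] V.H →ₗ[ℂ] V.H := transportMul V.mulC V.equivR

theorem mulH_R (v w : ↥V.C) : V.mulH (V.R v) (V.R w) = V.R (V.mulC v w) :=
  transportMul_apply V.mulC V.equivR v w

/-- The product on cohomology is defined through harmonic representatives c, c'; it is given by
arbitrary cocycles because ab - cc' = (a - c)b + c(b - c') is a coboundary. -/
theorem mulH_cls (a b : ↥(LinearMap.ker V.d)) :
    V.mulH (V.cls a) (V.cls b) =
      V.cls ⟨V.Y (-1) (-1) (a : F) (b : F), V.d_Y_eq_zero _ _ a.2 b.2⟩ := by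
  obtain ⟨c, -, hc, hr⟩ := V.exists_harmonic (W := ⊤) (fun _ _ => trivial) (a := a) trivial a.2
  obtain ⟨c', -, hc', hr'⟩ := V.exists_harmonic (W := ⊤) (fun _ _ => trivial) (a := b) trivial b.2
  rw [← V.R_eq_cls (c := ⟨c, V.mem_C_iff.2 hc⟩) hr,
    ← V.R_eq_cls (c := ⟨c', V.mem_C_iff.2 hc'⟩) hr', mulH_R]
  refine V.R_eq_cls ?_
  rw [coe_mulC]
  have h1 := V.Y_mem_range_left (r := -1) (s := -1) hr b.2
  have h2 := V.Y_mem_range_right (r := -1) (s := -1) (V.d_eq_zero hc) hr'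
  have := add_mem h1 h2
  simpa using this

end UnitaryN22FullVOA

end FullCFT

end

/-! ### Assembly of the proposition -/

theorem proposition2p20 {F : Type*} [AddCommGroup F] [Module ℂ F]
    (V : FullCFT.UnitaryN22FullVOA F) :
    ∃ (mulC : ↥V.C →ₗ[ℂ] ↥V.C →ₗ[ℂ] ↥V.C) (oneC : ↥V.C)
      (mulH : V.H →ₗ[ℂ] V.H →ₗ[ℂ] V.H) (oneH : V.H),
      -- the products are induced by the (-1,-1)-product, the units by the vacuum
      (∀ v w : ↥V.C, (mulC v w : F) = V.Y (-1) (-1) (v : F) (w : F)) ∧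
      (oneC : F) = V.one ∧
      (∀ a b : ↥(LinearMap.ker V.d),
        ∃ hab : V.Y (-1) (-1) (a : F) (b : F) ∈ LinearMap.ker V.d,
          mulH (V.cls a) (V.cls b) = V.cls ⟨V.Y (-1) (-1) (a : F) (b : F), hab⟩) ∧
      (∃ h1 : V.one ∈ LinearMap.ker V.d, oneH = V.cls ⟨V.one, h1⟩) ∧
      -- both are supercommutative algebras
      FullCFT.IsSupercommAlgebra mulC oneC V.Cpar ∧
      FullCFT.IsSupercommAlgebra mulH oneH V.Hpar ∧
      -- the map induced by the inclusion is an isomorphism of them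
      Function.Bijective V.R ∧
      (∀ v w : ↥V.C, V.R (mulC v w) = mulH (V.R v) (V.R w)) ∧
      V.R oneC = oneH ∧
      (∀ i : ZMod 2, (V.Cpar i).map V.R = V.Hpar i) ∧
      -- the eigenvalues of J(0), Jbar(0) refine the grading to an algebra grading by ℝ²
      FullCFT.IsRefinedGrading mulC oneC V.Cpar V.Ccharge ∧
      FullCFT.IsRefinedGrading mulH oneH V.Hpar V.Hcharge ∧
      (∀ x : ℝ × ℝ, (V.Ccharge x).map V.R = V.Hcharge x) ∧
      -- the component of charge (p, q) consists of the c-c primaries of weight (p/2, q/2)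
      (∀ p q : ℝ, (V.Ccharge (p, q)).map V.C.subtype =
        V.ccPrimary (p / 2) (q / 2) p q) := by
  have hpar : ∀ i : ZMod 2, (V.Cpar i).map V.R = V.Hpar i := fun i =>
    V.map_R_comap (V.laplacian_mem_par i)
  have hcharge : ∀ x : ℝ × ℝ, (V.Ccharge x).map V.R = V.Hcharge x := fun x =>
    V.map_R_comap (V.laplacian_mem_charge x.1 x.2)
  have hpar' : (fun i => (V.Cpar i).map V.equivR.toLinearMap) = V.Hpar := funext hpar
  have hcharge' : (fun x => (V.Ccharge x).map V.equivR.toLinearMap) = V.Hcharge := funext hcharge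
  have hH := V.isSupercommAlgebra_C.transport V.equivR
  have hG := V.isRefinedGrading_C.transport V.equivR
  rw [hpar'] at hH
  rw [hpar', hcharge'] at hG
  exact ⟨V.mulC, V.oneC, V.mulH, V.R V.oneC, V.coe_mulC, rfl,
    fun a b => ⟨V.d_Y_eq_zero _ _ a.2 b.2, V.mulH_cls a b⟩, ⟨V.d_one, rfl⟩,
    V.isSupercommAlgebra_C, hH, V.bijective_R, fun v w => (V.mulH_R v w).symm, rfl, hpar,
    V.isRefinedGrading_C, hG, hcharge, V.map_Ccharge⟩
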